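/- Let $a(s)=sA(s)$ for $s\ge 0$, where $A\in C^2([0,\infty))$, $A>0$ and $1+sA'(s)/A(s)>0$ on $[0,\infty)$, and put $b(s)=\frac{s a'(s)}{a(s)}-1$ and $b^-=\min\{b,0\}$. Consider the following two conditions on $a$. Condition I: there are $s_0>0$ and a non-decreasing $g$ on $[s_0,\infty)$ with $(1+b^-(s))s^2\ge g(s)$ for $s\ge s_0$ and $\int_{s_0}^\infty \frac{g(s)}{s^2}\,ds=+\infty$. Condition II: there are $s_0>0$ and a non-increasing $g$ on $[s_0,\infty)$ with $(1+b^-(s))s^2\ge g(s)$ for $s\ge s_0$ and $\int_{s_0}^\infty \frac{g(s)}{s}\,ds=+\infty$. Let $m\in\mathbb N$, $\delta>0$ and $K\in\mathbb R$. Then there is a constant $C$, depending only on $m$, $a$, $\delta$ and $K$, with the following property. Let $N$ be a complete $m$-dimensional Riemannian manifold, $J$ a smooth vector field on $N$, and $\Lambda\subset N$ a bounded domain of class $C^2$. Let $\delta_0\ge\delta$ be such that $d(x)=\operatorname{dist}(x,\partial\Lambda)$ is of class $C^2$ in the strip $\{x\in\overline\Lambda: d(x)\le\delta_0\}$. Let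 $\psi\in C^2(\overline\Lambda)$, and let $u\in C^1(\overline\Lambda)\cap C^2(\Lambda)$ solve $$\operatorname{div}\Big(\frac{a(\|\nabla u\|)}{\|\nabla u\|}\nabla u\Big)-\frac{a(\|\nabla u\|)}{\|\nabla u\|}\langle\nabla u,J\rangle=0\ \text{ in }\Lambda,\qquad u=\psi\ \text{ on }\partial\Lambda .$$ Suppose that $|\psi|$, $\|\nabla\psi\|$ and $|\nabla^2\psi|$ are at most $K$ in $\Lambda$, and that $|\nabla^2 d|$ and $\|J\|$ are at most $K$ in $\{x\in\Lambda: d(x)<\delta_0\}$. Suppose moreover that either Condition I holds, or Condition II holds and $$H_{\partial\Lambda_t}\ge-\langle J,\eta_t\rangle\qquad\text{for } 0<t<\delta,$$ where $H_{\partial\Lambda_t}$ is the non-normalized mean curvature of the inner parallel hypersurface $\partial\Lambda_t=\{x\in\Lambda: d(x)=t\}$ with respect to its interior unit normal $\eta_t$ (the unit normal pointing in the direction of increasing $d$). Then, with $\nu$ the inner unit normal of $\partial\Lambda$, $$|\partial_\nu u|\le C\quad\text{on }\partial\Lambda .$$ -/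

import Mathlib

open Set Filter Topology Manifold Bundle
open scoped ContDiff

noncomputable section

/-! ### The equation: structural conditions on `a` -/

/-- The structural assumptions on `a` in the regular case: `a(s) = s A(s)` for `s ≥ 0`, where
`A ∈ C²([0, ∞))` is positive and `1 + s A'(s) / A(s) > 0` on `[0, ∞)`. -/
def IsRegularOperator (a : ℝ → ℝ) : Prop :=
  ∃ A : ℝ → ℝ, ContDiffOn ℝ 2 A (Ici 0) ∧
    (∀ s, 0 ≤ s → 0 < A s) ∧
    (∀ s, 0 ≤ s → a s = s * A s) ∧
    (∀ s, 0 ≤ s → 0 < 1 + s * derivWithin A (Ici 0) s / A s)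

/-- `b(s) = s a'(s) / a(s) - 1` (used for `s > 0` only). -/
def bFun (a : ℝ → ℝ) (s : ℝ) : ℝ := s * deriv a s / a s - 1

/-- Mild decay of the eigenvalue ratio: `(1 + b⁻(s)) s² ≥ g(s)` for `s ≥ s₀ > 0`, where
`b⁻ = min {b, 0}`, `g` is non-decreasing and `∫_{s₀}^∞ g(s) / s² ds = +∞`. -/
def ConditionI (a : ℝ → ℝ) : Prop :=
  ∃ (s₀ : ℝ) (g : ℝ → ℝ), 0 < s₀ ∧
    (∀ s, s₀ ≤ s → g s ≤ (1 + min (bFun a s) 0) * s ^ 2) ∧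
    MonotoneOn g (Ici s₀) ∧
    Tendsto (fun R : ℝ => ∫ s in s₀..R, g s / s ^ 2) atTop atTop

/-- Strong decay of the eigenvalue ratio: `(1 + b⁻(s)) s² ≥ g(s)` for `s ≥ s₀ > 0`, where
`g` is non-increasing and `∫_{s₀}^∞ g(s) / s ds = +∞`. -/
def ConditionII (a : ℝ → ℝ) : Prop :=
  ∃ (s₀ : ℝ) (g : ℝ → ℝ), 0 < s₀ ∧
    (∀ s, s₀ ≤ s → g s ≤ (1 + min (bFun a s) 0) * s ^ 2) ∧
    AntitoneOn g (Ici s₀) ∧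
    Tendsto (fun R : ℝ => ∫ s in s₀..R, g s / s) atTop atTop

/-! ### Riemannian calculus -/

section Riemannian

variable (E : Type*) [NormedAddCommGroup E] [NormedSpace ℝ E] [FiniteDimensional ℝ E]
  {N : Type*} [TopologicalSpace N] [ChartedSpace E N]

instance instFiniteDimensionalTangent (x : N) :
    FiniteDimensional ℝ (TangentSpace 𝓘(ℝ, E) x) :=
  inferInstanceAs (FiniteDimensional ℝ E)

variable [IsManifold 𝓘(ℝ, E) ∞ N] [RiemannianBundle (fun x : N => TangentSpace 𝓘(ℝ, E) x)]

/-- The Riemannian gradient: `⟨∇u(x), v⟩ = du_x(v)`. -/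
def rGrad (u : N → ℝ) (x : N) : TangentSpace 𝓘(ℝ, E) x :=
  haveI : CompleteSpace (TangentSpace 𝓘(ℝ, E) x) := FiniteDimensional.complete ℝ _
  (InnerProductSpace.toDual ℝ (TangentSpace 𝓘(ℝ, E) x)).symm (mvfderiv 𝓘(ℝ, E) u x)

variable {E}

/-- The Koszul expression: half of
`V⟨X,W⟩ + X⟨V,W⟩ - W⟨V,X⟩ + ⟨[V,X],W⟩ - ⟨[V,W],X⟩ - ⟨[X,W],V⟩` at `x`, where `V`, `W` are local
smooth extensions of the tangent vectors `v`, `w`.  It is the value of `⟨∇_v X, w⟩` for the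
Levi-Civita connection `∇`. -/
def koszul (X : ∀ x : N, TangentSpace 𝓘(ℝ, E) x) (x : N) (v w : TangentSpace 𝓘(ℝ, E) x) : ℝ :=
  let V : ∀ y : N, TangentSpace 𝓘(ℝ, E) y := FiberBundle.extend E v
  let W : ∀ y : N, TangentSpace 𝓘(ℝ, E) y := FiberBundle.extend E w
  (mvfderiv 𝓘(ℝ, E) (fun y => inner ℝ (X y) (W y)) x v
    + mvfderiv 𝓘(ℝ, E) (fun y => inner ℝ (V y) (W y)) x (X x)
    - mvfderiv 𝓘(ℝ, E) (fun y => inner ℝ (V y) (X y)) x w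
    + inner ℝ (VectorField.mlieBracket 𝓘(ℝ, E) V X x) w
    - inner ℝ (VectorField.mlieBracket 𝓘(ℝ, E) V W x) (X x)
    - inner ℝ (VectorField.mlieBracket 𝓘(ℝ, E) X W x) v) / 2

/-- The Levi-Civita covariant derivative `∇_v X` of a vector field `X` at `x`, for `v ∈ T_x N`. -/
def covDeriv (X : ∀ x : N, TangentSpace 𝓘(ℝ, E) x) (x : N) (v : TangentSpace 𝓘(ℝ, E) x) :
    TangentSpace 𝓘(ℝ, E) x :=
  ∑ i, koszul X x v (stdOrthonormalBasis ℝ (TangentSpace 𝓘(ℝ, E) x) i) •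
    stdOrthonormalBasis ℝ (TangentSpace 𝓘(ℝ, E) x) i

/-- The divergence `div X = ∑ᵢ ⟨∇_{eᵢ} X, eᵢ⟩` over an orthonormal basis of `T_x N`. -/
def rDiv (X : ∀ x : N, TangentSpace 𝓘(ℝ, E) x) (x : N) : ℝ :=
  ∑ i, inner ℝ (covDeriv X x (stdOrthonormalBasis ℝ (TangentSpace 𝓘(ℝ, E) x) i))
    (stdOrthonormalBasis ℝ (TangentSpace 𝓘(ℝ, E) x) i)

/-- The Hessian `∇²u(v, w) = ⟨∇_v ∇u, w⟩`. -/
def rHess (u : N → ℝ) (x : N) (v w : TangentSpace 𝓘(ℝ, E) x) : ℝ :=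
  inner ℝ (covDeriv (rGrad E u) x v) w

variable (E)

/-- The (Hilbert–Schmidt) norm `|∇²u|` at `x`. -/
def hessNorm (u : N → ℝ) (x : N) : ℝ :=
  Real.sqrt (∑ i, ∑ j, rHess u x (stdOrthonormalBasis ℝ (TangentSpace 𝓘(ℝ, E) x) i)
    (stdOrthonormalBasis ℝ (TangentSpace 𝓘(ℝ, E) x) j) ^ 2)

/-- The unit normal `∇φ / ‖∇φ‖` of the level hypersurfaces of `φ`, pointing towards larger
values of `φ`. -/
def levelNormal (φ : N → ℝ) (x : N) : TangentSpace 𝓘(ℝ, E) x :=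
  ‖rGrad E φ x‖⁻¹ • rGrad E φ x

/-- The non-normalized mean curvature at `x`, with respect to the unit normal
`η = ∇φ / ‖∇φ‖`, of the level hypersurface of `φ` through `x`:
`H = ∑ᵢ ⟨∇_{Fᵢ} Fᵢ, η⟩ = - ∑ᵢ ⟨∇_{Fᵢ} η, Fᵢ⟩`, where the `Fᵢ` form an orthonormal basis of the
tangent space `η^⊥` of the hypersurface. -/
def levelMeanCurvature (φ : N → ℝ) (x : N) : ℝ :=
  -∑ i, inner ℝ
      (covDeriv (levelNormal E φ) x
        (stdOrthonormalBasis ℝ (Submodule.span ℝ {levelNormal E φ x})ᗮ i :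
          TangentSpace 𝓘(ℝ, E) x))
      (stdOrthonormalBasis ℝ (Submodule.span ℝ {levelNormal E φ x})ᗮ i :
          TangentSpace 𝓘(ℝ, E) x)

/-- `u` solves `div((a(‖∇u‖)/‖∇u‖) ∇u) - (a(‖∇u‖)/‖∇u‖) ⟨∇u, J⟩ = 0` pointwise in `Λ`. For
`a(s) = s A(s)` the field `(a(‖∇u‖)/‖∇u‖) ∇u` is `A(‖∇u‖) ∇u`, also where `∇u = 0`. -/
def SolvesReducedEquation (a : ℝ → ℝ) (J : ∀ x : N, TangentSpace 𝓘(ℝ, E) x) (Λ : Set N)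
    (u : N → ℝ) : Prop :=
  ∀ x ∈ Λ,
    rDiv (fun y : N => (a ‖rGrad E u y‖ / ‖rGrad E u y‖) • rGrad E u y) x
      - a ‖rGrad E u x‖ / ‖rGrad E u x‖ * inner ℝ (rGrad E u x) (J x) = 0

/-! ### Domains of class `C²` -/

/-- `ρ` is a `C²` defining function of `Λ` near `y`: on an open neighbourhood `U` of `y` it is of
class `C²`, `U ∩ Λ = {x ∈ U | ρ x > 0}`, and `∇ρ(y) ≠ 0`. -/
def IsLocalDefiningFunction (Λ : Set N) (y : N) (ρ : N → ℝ) : Prop :=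
  rGrad E ρ y ≠ 0 ∧ ∃ U : Set N, IsOpen U ∧ y ∈ U ∧ ContMDiffOn 𝓘(ℝ, E) 𝓘(ℝ, ℝ) 2 ρ U ∧
    U ∩ Λ = {x ∈ U | 0 < ρ x}

/-- A domain (non-empty connected open set) with boundary of class `C²`. -/
def IsC2Domain (Λ : Set N) : Prop :=
  IsOpen Λ ∧ IsConnected Λ ∧ ∀ y ∈ frontier Λ, ∃ ρ : N → ℝ, IsLocalDefiningFunction E Λ y ρ

/-- `ν` is the unit normal of `∂Λ` at `y ∈ ∂Λ` pointing into `Λ`. -/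
def IsInnerUnitNormal (Λ : Set N) (y : N) (ν : TangentSpace 𝓘(ℝ, E) y) : Prop :=
  ∃ ρ : N → ℝ, IsLocalDefiningFunction E Λ y ρ ∧ ν = ‖rGrad E ρ y‖⁻¹ • rGrad E ρ y

end Riemannian

/-- The distance `d(x) = d(x, ∂Λ)` to the boundary. -/
def bdryDist {N : Type*} [MetricSpace N] (Λ : Set N) (x : N) : ℝ :=
  Metric.infDist x (frontier Λ)

end

/-! The estimate is a barrier argument. Near the boundary `u` is compared with `ψ + f(d)` and `-u`
with `-ψ + f(d)`, where `f` is increasing and concave on `[0, ℓ]`, `f 0 = 0` and `f ℓ ≥ 2K`. The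
maximum principle `le_of_solves` gives `|u| ≤ K`, so the barrier dominates at `d = 0` and at `d =
ℓ`. If it is a strict supersolution in between, it dominates in the whole strip (`le_barrier`). Then
`|u - ψ| ≤ P d` with `f' ≤ P`, which bounds the normal derivative.

At points with `∇w ≠ 0`, division by `a(s)/s` turns the equation into `Δw + b(|∇w|) |∇w|⁻² ∇²w(∇w,
∇w) - ⟨∇w, J⟩ = 0`, which is elliptic because `1 + b > 0`. Since `|∇d| = 1`, the left side at `w = ψ
+ f(d)`, for `f''` negative enough, is at most `f' (Δd - ⟨∇d, J⟩) + f'' (1 + b⁻(|∇w|))` plus terms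
bounded by `m` and `K`. Under Condition I the first summand is bounded by a multiple of `f'`; under
Condition II the curvature hypothesis makes it nonpositive, because `H = -Δd`. So `-f'' (1 + b⁻(s))
≥ C κ(f')` is needed for `s` within `K` of `f'`, with `κ(p) = p` or `κ = 1` respectively
(`HasBarrierProfile`, `reducedOperator_barrier_neg`).

Such an `f` comes from the equation `-q' h(q) = C q` for `q = f'`, where `h` averages `g(s)/s²` or
`g(s)/s` over unit intervals. With `q` as the independent variable the height of `f` is `C⁻¹ ∫ h
dq`, so divergence of the integral allows any height, while `ℓ = C⁻¹ ∫ h/q dq` is at most the height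
divided by the smallest slope, hence less than `δ` if that slope is large
(`exists_profile_of_primitive`). Only `m`, `a`, `δ` and `K` enter.

The maximum principle must cope with critical points of `u`. As `b(s) → 0` for `s → 0`, a Hopf
barrier of small nonzero gradient sees almost the Laplacian (`not_touching_of_isMax`). No geodesics
are used: `|∇d| = 1` is proved with nearly minimizing paths, and completeness enters through
Hopf–Rinow. -/

noncomputable section

set_option linter.unusedSectionVars false
set_option linter.unusedSimpArgs false

/-! ### The Levi-Civita derivative through the Koszul formula -/

section KoszulCalculus

variable {E : Type*} [NormedAddCommGroup E] [NormedSpace ℝ E] [FiniteDimensional ℝ E]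
  {N : Type*} [TopologicalSpace N] [ChartedSpace E N]
  [IsManifold 𝓘(ℝ, E) ∞ N] [RiemannianBundle (fun x : N => TangentSpace 𝓘(ℝ, E) x)]

/-- A vector field, as a section of the tangent bundle. -/
abbrev fieldSection (X : ∀ x : N, TangentSpace 𝓘(ℝ, E) x) : N → TangentBundle 𝓘(ℝ, E) N :=
  fun x => ⟨x, X x⟩

/-- Differentiability of a vector field at a point. -/
abbrev DiffField (X : ∀ x : N, TangentSpace 𝓘(ℝ, E) x) (x : N) : Prop :=
  MDifferentiableAt 𝓘(ℝ, E) 𝓘(ℝ, E).tangent (fieldSection X) x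

/-- The Koszul expression for three vector fields. -/
def koszulField (X V W : ∀ x : N, TangentSpace 𝓘(ℝ, E) x) (x : N) : ℝ :=
  (mvfderiv 𝓘(ℝ, E) (fun y => inner ℝ (X y) (W y)) x (V x)
    + mvfderiv 𝓘(ℝ, E) (fun y => inner ℝ (V y) (W y)) x (X x)
    - mvfderiv 𝓘(ℝ, E) (fun y => inner ℝ (V y) (X y)) x (W x)
    + inner ℝ (VectorField.mlieBracket 𝓘(ℝ, E) V X x) (W x)
    - inner ℝ (VectorField.mlieBracket 𝓘(ℝ, E) V W x) (X x)
    - inner ℝ (VectorField.mlieBracket 𝓘(ℝ, E) X W x) (V x)) / 2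

lemma koszul_eq_koszulField_extend (X : ∀ x : N, TangentSpace 𝓘(ℝ, E) x) (x : N)
    (v w : TangentSpace 𝓘(ℝ, E) x) :
    koszul X x v w = koszulField X (FiberBundle.extend E v) (FiberBundle.extend E w) x := by
  simp [koszul, koszulField]

variable [IsContMDiffRiemannianBundle 𝓘(ℝ, E) ∞ E (fun x : N => TangentSpace 𝓘(ℝ, E) x)]

lemma mdifferentiableAt_inner_field {X Y : ∀ x : N, TangentSpace 𝓘(ℝ, E) x} {x : N}
    (hX : DiffField X x) (hY : DiffField Y x) :
    MDifferentiableAt 𝓘(ℝ, E) 𝓘(ℝ, ℝ) (fun y => inner ℝ (X y) (Y y)) x :=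
  MDifferentiableAt.inner_bundle hX hY

variable {X Y V W V' W' : ∀ x : N, TangentSpace 𝓘(ℝ, E) x} {x : N} {f : N → ℝ}

lemma DiffField.add (hX : DiffField X x) (hY : DiffField Y x) : DiffField (X + Y) x :=
  mdifferentiableAt_add_section hX hY

lemma koszulField_add_left (hX : DiffField X x) (hY : DiffField Y x) (hV : DiffField V x)
    (hW : DiffField W x) :
    koszulField (X + Y) V W x = koszulField X V W x + koszulField Y V W x := by
  have : CompleteSpace E := FiniteDimensional.complete ℝ E
  simp only [koszulField, Pi.add_apply, inner_add_left, inner_add_right]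
  rw [mvfderiv_fun_add (mdifferentiableAt_inner_field hX hW) (mdifferentiableAt_inner_field hY hW),
    mvfderiv_fun_add (mdifferentiableAt_inner_field hV hX) (mdifferentiableAt_inner_field hV hY),
    VectorField.mlieBracket_add_right hX hY, VectorField.mlieBracket_add_left hX hY]
  simp only [add_apply, map_add, inner_add_left, inner_add_right]
  ring

/-- The two derivatives of `f` along `W` cancel, and the two along `V` add up to cancel the factor
`1/2`: this is the Leibniz rule. -/
lemma koszulField_smul_left (hf : MDifferentiableAt 𝓘(ℝ, E) 𝓘(ℝ, ℝ) f x) (hX : DiffField X x)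
    (hV : DiffField V x) (hW : DiffField W x) :
    koszulField (f • X) V W x =
      f x * koszulField X V W x + mvfderiv 𝓘(ℝ, E) f x (V x) * inner ℝ (X x) (W x) := by
  have : CompleteSpace E := FiniteDimensional.complete ℝ E
  simp only [koszulField, Pi.smul_apply', inner_smul_left, inner_smul_right, conj_trivial]
  rw [mvfderiv_fun_mul hf (mdifferentiableAt_inner_field hX hW),
    mvfderiv_fun_mul hf (mdifferentiableAt_inner_field hV hX),
    VectorField.mlieBracket_smul_right hf hX, VectorField.mlieBracket_smul_left hf hX]
  simp only [add_apply, smul_apply, map_smul,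
    inner_add_left, inner_smul_left, conj_trivial, smul_eq_mul]
  rw [real_inner_comm (X x) (V x)]
  ring

lemma koszulField_add_right (hX : DiffField X x) (hV : DiffField V x)
    (hW : DiffField W x) (hW' : DiffField W' x) :
    koszulField X V (W + W') x = koszulField X V W x + koszulField X V W' x := by
  have : CompleteSpace E := FiniteDimensional.complete ℝ E
  simp only [koszulField, Pi.add_apply, inner_add_left, inner_add_right]
  rw [mvfderiv_fun_add (mdifferentiableAt_inner_field hX hW) (mdifferentiableAt_inner_field hX hW'),
    mvfderiv_fun_add (mdifferentiableAt_inner_field hV hW) (mdifferentiableAt_inner_field hV hW'),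
    VectorField.mlieBracket_add_right hW hW', VectorField.mlieBracket_add_right hW hW']
  simp only [add_apply, map_add, inner_add_left, inner_add_right]
  ring

/-- The derivatives of `f` from the inner products cancel those from the brackets. This
tensoriality, with its analogue in `V`, makes the expression a bilinear form on the tangent space.
-/
lemma koszulField_smul_right (hf : MDifferentiableAt 𝓘(ℝ, E) 𝓘(ℝ, ℝ) f x) (hX : DiffField X x)
    (hV : DiffField V x) (hW : DiffField W x) :
    koszulField X V (f • W) x = f x * koszulField X V W x := by
  have : CompleteSpace E := FiniteDimensional.complete ℝ E
  simp only [koszulField, Pi.smul_apply', inner_smul_left, inner_smul_right, conj_trivial]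
  rw [mvfderiv_fun_mul hf (mdifferentiableAt_inner_field hX hW),
    mvfderiv_fun_mul hf (mdifferentiableAt_inner_field hV hW),
    VectorField.mlieBracket_smul_right hf hW, VectorField.mlieBracket_smul_right hf hW]
  simp only [add_apply, smul_apply, map_smul,
    inner_add_left, inner_smul_left, conj_trivial, smul_eq_mul]
  rw [real_inner_comm (X x) (W x), real_inner_comm (V x) (W x)]
  ring

lemma koszulField_add_middle (hX : DiffField X x) (hV : DiffField V x)
    (hV' : DiffField V' x) (hW : DiffField W x) :
    koszulField X (V + V') W x = koszulField X V W x + koszulField X V' W x := by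
  have : CompleteSpace E := FiniteDimensional.complete ℝ E
  simp only [koszulField, Pi.add_apply, inner_add_left, inner_add_right]
  rw [mvfderiv_fun_add (mdifferentiableAt_inner_field hV hX) (mdifferentiableAt_inner_field hV' hX),
    mvfderiv_fun_add (mdifferentiableAt_inner_field hV hW) (mdifferentiableAt_inner_field hV' hW),
    VectorField.mlieBracket_add_left hV hV', VectorField.mlieBracket_add_left hV hV']
  simp only [add_apply, map_add, inner_add_left, inner_add_right]
  ring

lemma koszulField_smul_middle (hf : MDifferentiableAt 𝓘(ℝ, E) 𝓘(ℝ, ℝ) f x) (hX : DiffField X x)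
    (hV : DiffField V x) (hW : DiffField W x) :
    koszulField X (f • V) W x = f x * koszulField X V W x := by
  have : CompleteSpace E := FiniteDimensional.complete ℝ E
  simp only [koszulField, Pi.smul_apply', inner_smul_left, inner_smul_right, conj_trivial]
  rw [mvfderiv_fun_mul hf (mdifferentiableAt_inner_field hV hX),
    mvfderiv_fun_mul hf (mdifferentiableAt_inner_field hV hW),
    VectorField.mlieBracket_smul_left hf hV, VectorField.mlieBracket_smul_left hf hV]
  simp only [add_apply, smul_apply, map_smul,
    inner_add_left, inner_smul_left, conj_trivial, smul_eq_mul]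
  ring

variable (X x) in
/-- The Levi-Civita derivative of `X` as a bilinear form on the tangent space. -/
def koszulForm (hX : DiffField X x) :
    TangentSpace 𝓘(ℝ, E) x →L[ℝ] TangentSpace 𝓘(ℝ, E) x →L[ℝ] ℝ :=
  TensorialAt.mkHom₂ (I := 𝓘(ℝ, E)) (F := E) (F' := E) (fun V W => koszulField X V W x) x
    (fun _ hW => ⟨fun hf hV => koszulField_smul_middle hf hX hV hW,
      fun hV hV' => koszulField_add_middle hX hV hV' hW⟩)
    (fun _ hV => ⟨fun hf hW => koszulField_smul_right hf hX hV hW,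
      fun hW hW' => koszulField_add_right hX hV hW hW'⟩)

lemma koszulForm_apply (hX : DiffField X x) (v w : TangentSpace 𝓘(ℝ, E) x) :
    koszulForm X x hX v w = koszul X x v w := by
  rw [koszul_eq_koszulField_extend]
  exact TensorialAt.mkHom₂_apply_eq_extend _ _ v w

lemma koszulForm_apply_field (hX : DiffField X x) (hV : DiffField V x) (hW : DiffField W x) :
    koszulForm X x hX (V x) (W x) = koszulField X V W x :=
  TensorialAt.mkHom₂_apply _ _ hV hW

/-- By tensoriality, the standard extensions in `koszul` may be replaced by any differentiable
fields. -/
lemma koszul_apply_field (hX : DiffField X x) (hV : DiffField V x) (hW : DiffField W x) :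
    koszul X x (V x) (W x) = koszulField X V W x := by
  rw [← koszulForm_apply hX, koszulForm_apply_field hX hV hW]

lemma diffField_extend {y : N} (v : TangentSpace 𝓘(ℝ, E) y) :
    DiffField (FiberBundle.extend E v) y :=
  FiberBundle.mdifferentiableAt_extend ..

lemma koszul_add (hX : DiffField X x) (hY : DiffField Y x) (v w : TangentSpace 𝓘(ℝ, E) x) :
    koszul (X + Y) x v w = koszul X x v w + koszul Y x v w := by
  simp only [koszul_eq_koszulField_extend]
  exact koszulField_add_left hX hY (diffField_extend v) (diffField_extend w)

lemma koszul_smul (hf : MDifferentiableAt 𝓘(ℝ, E) 𝓘(ℝ, ℝ) f x) (hX : DiffField X x)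
    (v w : TangentSpace 𝓘(ℝ, E) x) :
    koszul (f • X) x v w =
      f x * koszul X x v w + mvfderiv 𝓘(ℝ, E) f x v * inner ℝ (X x) w := by
  simp only [koszul_eq_koszulField_extend]
  rw [koszulField_smul_left hf hX (diffField_extend v) (diffField_extend w)]
  simp

/-- Metric compatibility. -/
lemma mvfderiv_inner_eq_koszul (hX : DiffField X x) (hY : DiffField Y x)
    (v : TangentSpace 𝓘(ℝ, E) x) :
    mvfderiv 𝓘(ℝ, E) (fun y => inner ℝ (X y) (Y y)) x v =
      koszul X x v (Y x) + koszul Y x v (X x) := by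
  have hV := diffField_extend v
  have h1 := koszul_apply_field hX hV hY
  have h2 := koszul_apply_field hY hV hX
  rw [FiberBundle.extend_apply_self] at h1 h2
  -- In the sum of the two Koszul expressions everything cancels by antisymmetry of the bracket,
  -- except twice the derivative of `⟨X, Y⟩`.
  rw [h1, h2]
  simp only [koszulField, FiberBundle.extend_apply_self]
  rw [VectorField.mlieBracket_swap_apply (V := Y) (W := X)]
  have e1 : (fun y => inner ℝ (Y y) (X y)) = fun y : N => inner ℝ (X y) (Y y) := by
    funext y; exact real_inner_comm _ _
  rw [e1, inner_neg_left]
  ring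

lemma mvfderiv_congr {f g : N → ℝ} (h : f =ᶠ[𝓝 x] g) (v : TangentSpace 𝓘(ℝ, E) x) :
    mvfderiv 𝓘(ℝ, E) f x v = mvfderiv 𝓘(ℝ, E) g x v := by
  change (mfderiv 𝓘(ℝ, E) 𝓘(ℝ, ℝ) f x v : ℝ) = mfderiv 𝓘(ℝ, E) 𝓘(ℝ, ℝ) g x v
  rw [h.mfderiv_eq]
  rfl

lemma koszul_congr (h : X =ᶠ[𝓝 x] Y) (v w : TangentSpace 𝓘(ℝ, E) x) :
    koszul X x v w = koszul Y x v w := by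
  have h1 : (fun y => inner ℝ (X y) (FiberBundle.extend E w y)) =ᶠ[𝓝 x]
      fun y => inner ℝ (Y y) (FiberBundle.extend E w y) := h.mono fun y hy => by simp only [hy]
  have h2 : (fun y => inner ℝ (FiberBundle.extend E v y) (X y)) =ᶠ[𝓝 x]
      fun y => inner ℝ (FiberBundle.extend E v y) (Y y) := h.mono fun y hy => by simp only [hy]
  have h3 : ∀ Z : ∀ x : N, TangentSpace 𝓘(ℝ, E) x,
      VectorField.mlieBracket 𝓘(ℝ, E) Z X x = VectorField.mlieBracket 𝓘(ℝ, E) Z Y x :=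
    fun Z => EventuallyEq.rfl.mlieBracket_vectorField_eq h
  have h4 : ∀ Z : ∀ x : N, TangentSpace 𝓘(ℝ, E) x,
      VectorField.mlieBracket 𝓘(ℝ, E) X Z x = VectorField.mlieBracket 𝓘(ℝ, E) Y Z x :=
    fun Z => h.mlieBracket_vectorField_eq EventuallyEq.rfl
  simp only [koszul]
  rw [mvfderiv_congr h1, mvfderiv_congr h2, h3, h4, h.self_of_nhds]

/-- `covDeriv` has prescribed coordinates in one orthonormal basis; linearity in the second slot
extends the identity to every `w`. -/
lemma inner_covDeriv (hX : DiffField X x) (v w : TangentSpace 𝓘(ℝ, E) x) :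
    inner ℝ (covDeriv X x v) w = koszul X x v w := by
  simp only [covDeriv, sum_inner, inner_smul_left, conj_trivial, ← koszulForm_apply hX]
  conv_rhs => rw [← (stdOrthonormalBasis ℝ (TangentSpace 𝓘(ℝ, E) x)).sum_repr' w]
  simp [map_sum, mul_comm]

lemma rDiv_eq_sum_koszul (hX : DiffField X x) :
    rDiv X x = ∑ i, koszul X x (stdOrthonormalBasis ℝ (TangentSpace 𝓘(ℝ, E) x) i)
      (stdOrthonormalBasis ℝ (TangentSpace 𝓘(ℝ, E) x) i) := by
  simp only [rDiv, inner_covDeriv hX]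

end KoszulCalculus

/-! ### The gradient and its regularity -/

section Gradient

variable {E : Type*} [NormedAddCommGroup E] [NormedSpace ℝ E] [FiniteDimensional ℝ E]
  {N : Type*} [TopologicalSpace N] [ChartedSpace E N]
  [IsManifold 𝓘(ℝ, E) ∞ N] [RiemannianBundle (fun x : N => TangentSpace 𝓘(ℝ, E) x)]
  [IsContMDiffRiemannianBundle 𝓘(ℝ, E) ∞ E (fun x : N => TangentSpace 𝓘(ℝ, E) x)]

variable {u v : N → ℝ} {x : N}

lemma inner_rGrad (u : N → ℝ) (x : N) (w : TangentSpace 𝓘(ℝ, E) x) :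
    inner ℝ (rGrad E u x) w = mvfderiv 𝓘(ℝ, E) u x w := by
  have : CompleteSpace (TangentSpace 𝓘(ℝ, E) x) := FiniteDimensional.complete ℝ _
  simp [rGrad]

lemma rGrad_unique {p : TangentSpace 𝓘(ℝ, E) x}
    (h : ∀ w, inner ℝ p w = mvfderiv 𝓘(ℝ, E) u x w) : rGrad E u x = p :=
  ext_inner_right ℝ fun w => by rw [inner_rGrad, h]

lemma rGrad_congr (h : u =ᶠ[𝓝 x] v) : rGrad E u x = rGrad E v x :=
  rGrad_unique fun w => by rw [inner_rGrad, mvfderiv_congr h]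

lemma rGrad_eventuallyEq (h : u =ᶠ[𝓝 x] v) : rGrad E u =ᶠ[𝓝 x] rGrad E v :=
  h.eventuallyEq_nhds.mono fun _ hy => rGrad_congr hy

lemma rGrad_add (hu : MDifferentiableAt 𝓘(ℝ, E) 𝓘(ℝ, ℝ) u x)
    (hv : MDifferentiableAt 𝓘(ℝ, E) 𝓘(ℝ, ℝ) v x) :
    rGrad E (u + v) x = rGrad E u x + rGrad E v x :=
  rGrad_unique fun w => by
    rw [inner_add_left, inner_rGrad, inner_rGrad, mvfderiv_add hu hv, add_apply]

lemma mvfderiv_comp_real {F : ℝ → ℝ} {F' : ℝ} (hu : MDifferentiableAt 𝓘(ℝ, E) 𝓘(ℝ, ℝ) u x)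
    (hF : HasDerivAt F F' (u x)) (w : TangentSpace 𝓘(ℝ, E) x) :
    mvfderiv 𝓘(ℝ, E) (fun y => F (u y)) x w = F' * mvfderiv 𝓘(ℝ, E) u x w := by
  have h := (hF.hasFDerivAt.hasMFDerivAt.comp x hu.hasMFDerivAt).mfderiv
  have h2 : mvfderiv 𝓘(ℝ, E) (fun y => F (u y)) x w = mvfderiv 𝓘(ℝ, E) u x w * F' :=
    congrArg (fun l : TangentSpace 𝓘(ℝ, E) x →L[ℝ] ℝ => l w) h
  rw [h2, mul_comm]

lemma rGrad_comp {F : ℝ → ℝ} {F' : ℝ} (hu : MDifferentiableAt 𝓘(ℝ, E) 𝓘(ℝ, ℝ) u x)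
    (hF : HasDerivAt F F' (u x)) :
    rGrad E (fun y => F (u y)) x = F' • rGrad E u x :=
  rGrad_unique fun w => by
    rw [inner_smul_left, inner_rGrad, mvfderiv_comp_real hu hF, conj_trivial]

lemma contMDiffAt_clm_of_apply {F : Type*} [NormedAddCommGroup F] [NormedSpace ℝ F]
    {n : WithTop ℕ∞} {G : N → E →L[ℝ] F}
    (h : ∀ e : E, ContMDiffAt 𝓘(ℝ, E) 𝓘(ℝ, F) n (fun y => G y e) x) :
    ContMDiffAt 𝓘(ℝ, E) 𝓘(ℝ, E →L[ℝ] F) n G x := by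
  let b := Module.finBasis ℝ E
  have hG : G = fun y => ∑ i, ContinuousLinearMap.smulRightL ℝ E F
      (LinearMap.toContinuousLinearMap (b.coord i)) (G y (b i)) := by
    funext y
    ext e
    conv_lhs => rw [← b.sum_repr e, map_sum]
    simp
  rw [hG]
  exact contMDiffAt_finsetSum fun i _ =>
    (ContinuousLinearMap.contMDiff _).contMDiffAt.comp x (h (b i))

/-- The inverse of the trivialization of the tangent bundle at `x₀`. -/
abbrev tangentSymm (x₀ y : N) : E →L[ℝ] TangentSpace 𝓘(ℝ, E) y :=
  (trivializationAt E (TangentSpace 𝓘(ℝ, E)) x₀).symmL ℝ y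

lemma contMDiffAt_mvfderiv_tangentSymm (hu : ContMDiffAt 𝓘(ℝ, E) 𝓘(ℝ, ℝ) 2 u x) :
    ContMDiffAt 𝓘(ℝ, E) 𝓘(ℝ, E →L[ℝ] ℝ) 1
      (fun y => (mvfderiv 𝓘(ℝ, E) u y).comp (tangentSymm x y)) x := by
  have h := hu.mfderiv_const (m := 1) (by norm_num [one_add_one_eq_two])
  refine h.congr_of_eventuallyEq (Eventually.of_forall fun y => ?_)
  ext e
  simp [inTangentCoordinates, ContinuousLinearMap.inCoordinates, mvfderiv, tangentSymm]
  rfl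

lemma contMDiffAt_tangentSymm (x : N) (e : E) :
    ContMDiffAt 𝓘(ℝ, E) 𝓘(ℝ, E).tangent ∞
      (fieldSection fun y => tangentSymm x y e) x := by
  have h := FiberBundle.contMDiffAt_extend (k := ∞) 𝓘(ℝ, E) E (tangentSymm x x e)
  have hx := FiberBundle.mem_baseSet_trivializationAt' (F := E) (E := TangentSpace 𝓘(ℝ, E)) x
  have h2 : (trivializationAt E (TangentSpace 𝓘(ℝ, E)) x ⟨x, tangentSymm x x e⟩).2 = e := by
    simpa [Trivialization.continuousLinearMapAt_apply, Trivialization.linearMapAt_apply, hx] using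
      (trivializationAt E (TangentSpace 𝓘(ℝ, E)) x).continuousLinearMapAt_symmL (R := ℝ) hx e
  refine h.congr_of_eventuallyEq ?_
  filter_upwards [(trivializationAt E (TangentSpace 𝓘(ℝ, E)) x).open_baseSet.mem_nhds hx] with y hy
  rw [fieldSection, FiberBundle.extend, h2, Trivialization.symmL_apply _ hy]

lemma contMDiffAt_inner_field {X Y : ∀ x : N, TangentSpace 𝓘(ℝ, E) x}
    (hX : ContMDiffAt 𝓘(ℝ, E) 𝓘(ℝ, E).tangent 1 (fieldSection X) x)
    (hY : ContMDiffAt 𝓘(ℝ, E) 𝓘(ℝ, E).tangent 1 (fieldSection Y) x) :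
    ContMDiffAt 𝓘(ℝ, E) 𝓘(ℝ, ℝ) 1 (fun y => inner ℝ (X y) (Y y)) x :=
  ContMDiffAt.inner_bundle hX hY

/-- The metric in the trivialization at `x₀`. -/
def metricCoord (x₀ y : N) : E →L[ℝ] E →L[ℝ] ℝ :=
  (innerSL ℝ (E := TangentSpace 𝓘(ℝ, E) y)).bilinearComp (tangentSymm x₀ y) (tangentSymm x₀ y)

lemma contMDiffAt_metricCoord (x : N) :
    ContMDiffAt 𝓘(ℝ, E) 𝓘(ℝ, E →L[ℝ] E →L[ℝ] ℝ) 1 (metricCoord (E := E) x) x := by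
  refine contMDiffAt_clm_of_apply fun e => contMDiffAt_clm_of_apply fun e' => ?_
  have h1 : ContMDiffAt 𝓘(ℝ, E) 𝓘(ℝ, E).tangent 1 (fieldSection fun y => tangentSymm x y e) x :=
    (contMDiffAt_tangentSymm x e).of_le (by simp)
  have h2 : ContMDiffAt 𝓘(ℝ, E) 𝓘(ℝ, E).tangent 1 (fieldSection fun y => tangentSymm x y e') x :=
    (contMDiffAt_tangentSymm x e').of_le (by simp)
  exact contMDiffAt_inner_field h1 h2

/-- In the trivialization the gradient is the inverse of the metric applied to the coordinates of
`du`, and inversion is smooth at invertible operators. -/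
lemma contMDiffAt_rGrad (hu : ContMDiffAt 𝓘(ℝ, E) 𝓘(ℝ, ℝ) 2 u x) :
    ContMDiffAt 𝓘(ℝ, E) 𝓘(ℝ, E).tangent 1 (fieldSection (rGrad E u)) x := by
  refine (contMDiffAt_section _).2 ?_
  set t := trivializationAt E (TangentSpace 𝓘(ℝ, E)) x
  have hx : x ∈ t.baseSet := FiberBundle.mem_baseSet_trivializationAt' x
  have hinv : ∀ y ∈ t.baseSet, (metricCoord (E := E) x y).IsInvertible := by
    intro y hy
    have hinj : Function.Injective (metricCoord (E := E) x y) := by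
      refine (injective_iff_map_eq_zero _).2 fun e he => ?_
      have h1 : inner ℝ (tangentSymm x y e) (tangentSymm x y e) = 0 := by
        simpa [metricCoord] using congrArg (fun l : E →L[ℝ] ℝ => l e) he
      have h2 : t.symmL ℝ y e = 0 := inner_self_eq_zero.1 h1
      have := t.continuousLinearMapAt_symmL (R := ℝ) hy e
      rw [h2, map_zero] at this
      exact this.symm
    let L : E ≃ₗ[ℝ] (E →L[ℝ] ℝ) := LinearEquiv.ofInjectiveOfFinrankEq (metricCoord (E := E) x y).toLinearMap hinj
      (by
        rw [← (LinearMap.toContinuousLinearMap (𝕜 := ℝ) (E := E) (F' := ℝ)).finrank_eq]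
        exact Subspace.dual_finrank_eq.symm)
    exact ⟨L.toContinuousLinearEquiv, by ext e; rfl⟩
  have key : ∀ y ∈ t.baseSet, (t ⟨y, rGrad E u y⟩).2 =
      (metricCoord (E := E) x y).inverse ((mvfderiv 𝓘(ℝ, E) u y).comp (tangentSymm x y)) := by
    intro y hy
    have h1 : metricCoord (E := E) x y ((t ⟨y, rGrad E u y⟩).2) =
        (mvfderiv 𝓘(ℝ, E) u y).comp (tangentSymm x y) := by
      ext e
      have h3 : tangentSymm x y ((t ⟨y, rGrad E u y⟩).2) = rGrad E u y := by
        have h4 : (t ⟨y, rGrad E u y⟩).2 = t.continuousLinearMapAt ℝ y (rGrad E u y) := by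
          rw [t.continuousLinearMapAt_apply (R := ℝ), t.linearMapAt_apply (R := ℝ), if_pos hy]
        rw [h4]
        exact Trivialization.symmL_continuousLinearMapAt (R := ℝ) t hy (rGrad E u y)
      simp [metricCoord, h3, inner_rGrad]
    rw [← h1]
    obtain ⟨L, hL⟩ := hinv y hy
    rw [← hL]
    simp
  refine ContMDiffAt.congr_of_eventuallyEq ?_
    (Filter.mem_of_superset (t.open_baseSet.mem_nhds hx) key)
  have h1 : ContMDiffAt 𝓘(ℝ, E) 𝓘(ℝ, (E →L[ℝ] ℝ) →L[ℝ] E) 1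
      (fun y => (metricCoord (E := E) x y).inverse) x :=
    ((hinv x hx).contDiffAt_map_inverse).contMDiffAt.comp x (contMDiffAt_metricCoord x)
  exact h1.clm_apply (contMDiffAt_mvfderiv_tangentSymm hu)

lemma diffField_rGrad (hu : ContMDiffAt 𝓘(ℝ, E) 𝓘(ℝ, ℝ) 2 u x) : DiffField (rGrad E u) x :=
  (contMDiffAt_rGrad hu).mdifferentiableAt one_ne_zero

end Gradient

/-! ### Curves with prescribed velocity -/

section Curves

variable {E : Type*} [NormedAddCommGroup E] [NormedSpace ℝ E] [FiniteDimensional ℝ E]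
  {N : Type*} [TopologicalSpace N] [ChartedSpace E N]
  [IsManifold 𝓘(ℝ, E) ∞ N]

/-- Every tangent vector is the velocity of a smooth curve, whose velocity is the standard local
extension of the vector. -/
lemma exists_curve {x : N} (v : TangentSpace 𝓘(ℝ, E) x) :
    ∃ γ : ℝ → N, γ 0 = x ∧ ∀ᶠ t in 𝓝 (0 : ℝ), ContMDiffAt 𝓘(ℝ, ℝ) 𝓘(ℝ, E) ∞ γ t ∧
      mfderiv 𝓘(ℝ, ℝ) 𝓘(ℝ, E) γ t (1 : ℝ) = FiberBundle.extend E v (γ t) := by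
  set φ := extChartAt 𝓘(ℝ, E) x
  set e : E := (trivializationAt E (TangentSpace 𝓘(ℝ, E)) x ⟨x, v⟩).2 with he
  refine ⟨fun t => φ.symm (φ x + t • e), by simp [φ], ?_⟩
  have hcont : Continuous fun t : ℝ => φ x + t • e := by fun_prop
  have htar : ∀ᶠ t in 𝓝 (0 : ℝ), φ x + t • e ∈ φ.target := by
    refine hcont.continuousAt.eventually_mem ?_
    rw [zero_smul, add_zero]
    exact (isOpen_extChartAt_target (I := 𝓘(ℝ, E)) x).mem_nhds (mem_extChartAt_target (I := 𝓘(ℝ, E)) x)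
  filter_upwards [htar] with t ht
  have hsymm : ContMDiffAt 𝓘(ℝ, E) 𝓘(ℝ, E) ∞ φ.symm (φ x + t • e) :=
    (contMDiffOn_extChartAt_symm x).contMDiffAt ((isOpen_extChartAt_target (I := 𝓘(ℝ, E)) x).mem_nhds ht)
  have hline : HasFDerivAt (fun t : ℝ => φ x + t • e)
      (ContinuousLinearMap.toSpanSingleton ℝ e) t := by
    have := ((hasDerivAt_id t).smul_const e).const_add (φ x)
    simpa using! this.hasFDerivAt
  have hlineC : ContMDiffAt 𝓘(ℝ, ℝ) 𝓘(ℝ, E) ∞ (fun t : ℝ => φ x + t • e) t :=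
    (contDiff_const.add (contDiff_id.smul contDiff_const)).contMDiff.contMDiffAt
  refine ⟨hsymm.comp t hlineC, ?_⟩
  have h1 := ((hsymm.mdifferentiableAt (by simp)).hasMFDerivAt.comp t hline.hasMFDerivAt).mfderiv
  have hsrc : φ.symm (φ x + t • e) ∈ (chartAt E x).source := by
    rw [← extChartAt_source 𝓘(ℝ, E)]
    exact φ.map_target ht
  have h2 := TangentBundle.symmL_trivializationAt (I := 𝓘(ℝ, E)) hsrc
  have h3 : φ (φ.symm (φ x + t • e)) = φ x + t • e := φ.right_inv ht
  have h4 : FiberBundle.extend E v (φ.symm (φ x + t • e)) =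
      tangentSymm x (φ.symm (φ x + t • e)) e := by
    rw [FiberBundle.extend, ← he, Trivialization.symmL_apply _ (by simpa using hsrc)]
  rw [h4, tangentSymm, h2]
  rw [h3, ModelWithCorners.range_eq_univ, mfderivWithin_univ]
  exact (DFunLike.congr_fun h1 (1 : ℝ)).trans
    (congrArg (mfderiv 𝓘(ℝ, E) 𝓘(ℝ, E) φ.symm (φ x + t • e)) (one_smul ℝ e))

lemma hasDerivAt_comp_curve {u : N → ℝ} {γ : ℝ → N} {t : ℝ}
    (hu : MDifferentiableAt 𝓘(ℝ, E) 𝓘(ℝ, ℝ) u (γ t))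
    (hγ : MDifferentiableAt 𝓘(ℝ, ℝ) 𝓘(ℝ, E) γ t) :
    HasDerivAt (fun s => u (γ s))
      (mvfderiv 𝓘(ℝ, E) u (γ t) (mfderiv 𝓘(ℝ, ℝ) 𝓘(ℝ, E) γ t (1 : ℝ))) t := by
  let L : ℝ →L[ℝ] ℝ := (mvfderiv 𝓘(ℝ, E) u (γ t)).comp (mfderiv 𝓘(ℝ, ℝ) 𝓘(ℝ, E) γ t)
  have h : HasFDerivAt (fun s => u (γ s)) L t :=
    (hu.hasMFDerivAt.comp t hγ.hasMFDerivAt).hasFDerivAt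
  exact h.hasDerivAt

end Curves

/-! ### Traces and norms of bilinear forms -/

section TraceSplit

variable {F : Type*} [NormedAddCommGroup F] [InnerProductSpace ℝ F] [FiniteDimensional ℝ F]

/-- Both sums are the trace of the operator that represents `B`. -/
lemma sum_diag_eq_sum_diag {ι κ : Type*} [Fintype ι] [Fintype κ] (B : F →L[ℝ] F →L[ℝ] ℝ)
    (e : OrthonormalBasis ι ℝ F) (f : OrthonormalBasis κ ℝ F) :
    ∑ i, B (e i) (e i) = ∑ j, B (f j) (f j) := by
  have : CompleteSpace F := FiniteDimensional.complete ℝ F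
  let T : F →ₗ[ℝ] F :=
    ((InnerProductSpace.toDual ℝ F).symm.toLinearEquiv.toLinearMap).comp B.toLinearMap
  have hT : ∀ v w, inner ℝ w (T v) = B v w := fun v w => by
    rw [real_inner_comm]
    simp [T]
  simp only [← hT]
  rw [← LinearMap.trace_eq_sum_inner T e, LinearMap.trace_eq_sum_inner T f]

/-- The trace of a bilinear form, split along a unit vector and its orthogonal complement. -/
lemma sum_diag_eq_add_orthogonal {ι κ : Type*} [Fintype ι] [Fintype κ] (B : F →L[ℝ] F →L[ℝ] ℝ)
    (e : OrthonormalBasis ι ℝ F) {η : F} (hη : ‖η‖ = 1)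
    (f : OrthonormalBasis κ ℝ (Submodule.span ℝ {η})ᗮ) :
    ∑ i, B (e i) (e i) = B η η + ∑ j, B (f j : F) (f j : F) := by
  classical
  let g : Option κ → F := fun o => o.elim η (fun j => (f j : F))
  have hperp : ∀ j, inner ℝ η (f j : F) = 0 := fun j =>
    Submodule.mem_orthogonal_singleton_iff_inner_right.1 (f j).2
  have hg : Orthonormal ℝ g := by
    rw [orthonormal_iff_ite]
    rintro (_ | i) (_ | j)
    · simp [g, hη]
    · simpa [g] using hperp j
    · simpa [g, real_inner_comm] using hperp i
    · simpa [g] using orthonormal_iff_ite.1 f.orthonormal i j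
  have hne : η ≠ 0 := by
    rintro rfl
    simp at hη
  have hcard : Fintype.card (Option κ) = Module.finrank ℝ F := by
    rw [Fintype.card_option, ← Submodule.finrank_add_finrank_orthogonal (Submodule.span ℝ {η}),
      finrank_span_singleton hne, Module.finrank_eq_card_basis f.toBasis, add_comm]
  let b := (basisOfOrthonormalOfCardEqFinrank hg hcard).toOrthonormalBasis (by simpa using hg)
  have hb : ∀ o, b o = g o := fun o => by simp [b]
  rw [sum_diag_eq_sum_diag B e b, Fintype.sum_option]
  simp [hb, g]

lemma le_sum_diag_of_nonneg {ι : Type*} [Fintype ι] {B : F →L[ℝ] F →L[ℝ] ℝ}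
    (hB : ∀ v, 0 ≤ B v v) (e : OrthonormalBasis ι ℝ F) {η : F} (hη : ‖η‖ = 1) :
    B η η ≤ ∑ i, B (e i) (e i) := by
  rw [sum_diag_eq_add_orthogonal B e hη (stdOrthonormalBasis ℝ _)]
  exact le_add_of_nonneg_right (Finset.sum_nonneg fun j _ => hB _)

/-- Cauchy–Schwarz over pairs of indices, applied to the coordinates of `v` and `w`. -/
lemma abs_bilin_le {ι : Type*} [Fintype ι] (B : F →L[ℝ] F →L[ℝ] ℝ)
    (e : OrthonormalBasis ι ℝ F) (v w : F) :
    |B v w| ≤ Real.sqrt (∑ i, ∑ j, B (e i) (e j) ^ 2) * ‖v‖ * ‖w‖ := by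
  have h1 : B v w = ∑ p : ι × ι, B (e p.1) (e p.2) * (inner ℝ (e p.1) v * inner ℝ (e p.2) w) := by
    conv_lhs => rw [← e.sum_repr' v, ← e.sum_repr' w]
    simp only [map_sum, map_smul, sum_apply, smul_apply, smul_eq_mul, Finset.mul_sum]
    rw [Finset.sum_comm, Fintype.sum_prod_type]
    exact Finset.sum_congr rfl fun i _ => Finset.sum_congr rfl fun j _ => by ring
  have h2 : ∑ p : ι × ι, (inner ℝ (e p.1) v * inner ℝ (e p.2) w) ^ 2 = (‖v‖ * ‖w‖) ^ 2 := by
    rw [mul_pow, ← e.sum_sq_inner_right v, ← e.sum_sq_inner_right w, Finset.sum_mul_sum,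
      Fintype.sum_prod_type]
    exact Finset.sum_congr rfl fun i _ => Finset.sum_congr rfl fun j _ => by ring
  have h3 := Finset.sum_mul_sq_le_sq_mul_sq Finset.univ (fun p : ι × ι => B (e p.1) (e p.2))
    (fun p : ι × ι => inner ℝ (e p.1) v * inner ℝ (e p.2) w)
  rw [← h1, h2, Fintype.sum_prod_type] at h3
  have h4 : 0 ≤ ∑ i, ∑ j, B (e i) (e j) ^ 2 :=
    Finset.sum_nonneg fun i _ => Finset.sum_nonneg fun j _ => sq_nonneg _
  rw [mul_assoc]
  refine abs_le_of_sq_le_sq ?_ (by positivity)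
  rw [mul_pow _ (‖v‖ * ‖w‖), Real.sq_sqrt h4]
  exact h3

end TraceSplit

/-! ### The Hessian, the expanded divergence and the derivative tests -/

section Hessian

variable {E : Type*} [NormedAddCommGroup E] [NormedSpace ℝ E] [FiniteDimensional ℝ E]
  {N : Type*} [TopologicalSpace N] [ChartedSpace E N]
  [IsManifold 𝓘(ℝ, E) ∞ N] [RiemannianBundle (fun x : N => TangentSpace 𝓘(ℝ, E) x)]
  [IsContMDiffRiemannianBundle 𝓘(ℝ, E) ∞ E (fun x : N => TangentSpace 𝓘(ℝ, E) x)]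

variable {u v : N → ℝ} {x : N}

lemma continuousAt_norm_field {X : ∀ x : N, TangentSpace 𝓘(ℝ, E) x} (hX : DiffField X x) :
    ContinuousAt (fun y => ‖X y‖) x := by
  have h := (mdifferentiableAt_inner_field hX hX).continuousAt.sqrt
  refine h.congr (Eventually.of_forall fun y => ?_)
  simp only [real_inner_self_eq_norm_sq]
  exact Real.sqrt_sq (norm_nonneg _)

/-- `u` is of class `C²` at `x`. -/
abbrev IsC2At (u : N → ℝ) (x : N) : Prop := ContMDiffAt 𝓘(ℝ, E) 𝓘(ℝ, ℝ) 2 u x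

lemma IsC2At.mdiff (hu : IsC2At (E := E) u x) : MDifferentiableAt 𝓘(ℝ, E) 𝓘(ℝ, ℝ) u x :=
  hu.mdifferentiableAt (by simp)

lemma IsC2At.eventually (hu : IsC2At (E := E) u x) : ∀ᶠ y in 𝓝 x, IsC2At (E := E) u y :=
  (contMDiffAt_iff_contMDiffAt_nhds (by simp)).1 hu

lemma IsC2At.comp_real {F : ℝ → ℝ} (hu : IsC2At (E := E) u x) (hF : ContDiffAt ℝ 2 F (u x)) :
    IsC2At (E := E) (fun y => F (u y)) x :=
  hF.contMDiffAt.comp x hu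

lemma rHess_eq_koszul (hu : IsC2At (E := E) u x) (w z : TangentSpace 𝓘(ℝ, E) x) :
    rHess u x w z = koszul (rGrad E u) x w z :=
  inner_covDeriv (diffField_rGrad hu) w z

/-- The Hessian as a continuous bilinear form. -/
def hessForm (hu : IsC2At (E := E) u x) :
    TangentSpace 𝓘(ℝ, E) x →L[ℝ] TangentSpace 𝓘(ℝ, E) x →L[ℝ] ℝ :=
  koszulForm (rGrad E u) x (diffField_rGrad hu)

lemma hessForm_apply (hu : IsC2At (E := E) u x) (w z : TangentSpace 𝓘(ℝ, E) x) :
    hessForm hu w z = rHess u x w z := by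
  rw [rHess_eq_koszul hu, hessForm, koszulForm_apply]

lemma abs_rHess_le (hu : IsC2At (E := E) u x) (w z : TangentSpace 𝓘(ℝ, E) x) :
    |rHess u x w z| ≤ hessNorm E u x * ‖w‖ * ‖z‖ := by
  have h := abs_bilin_le (hessForm hu) (stdOrthonormalBasis ℝ _) w z
  simpa only [hessForm_apply, hessNorm] using h

lemma rDiv_rGrad (hu : IsC2At (E := E) u x) :
    rDiv (rGrad E u) x = ∑ i, rHess u x (stdOrthonormalBasis ℝ (TangentSpace 𝓘(ℝ, E) x) i)
      (stdOrthonormalBasis ℝ (TangentSpace 𝓘(ℝ, E) x) i) := by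
  rw [rDiv_eq_sum_koszul (diffField_rGrad hu)]
  simp only [rHess_eq_koszul hu]

lemma rHess_add (hu : IsC2At (E := E) u x) (hv : IsC2At (E := E) v x)
    (w z : TangentSpace 𝓘(ℝ, E) x) :
    rHess (u + v) x w z = rHess u x w z + rHess v x w z := by
  have h : rGrad E (u + v) =ᶠ[𝓝 x] rGrad E u + rGrad E v := by
    filter_upwards [hu.eventually, hv.eventually] with y hy hy'
    exact rGrad_add hy.mdiff hy'.mdiff
  rw [rHess_eq_koszul (ContMDiffAt.add hu hv), rHess_eq_koszul hu, rHess_eq_koszul hv,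
    koszul_congr h, koszul_add (diffField_rGrad hu) (diffField_rGrad hv)]

lemma rHess_comp {F F' : ℝ → ℝ} {F'' : ℝ} (hu : IsC2At (E := E) u x)
    (hFC : ContDiffAt ℝ 2 F (u x))
    (hF : ∀ᶠ t in 𝓝 (u x), HasDerivAt F (F' t) t) (hF' : HasDerivAt F' F'' (u x))
    (w z : TangentSpace 𝓘(ℝ, E) x) :
    rHess (fun y => F (u y)) x w z =
      F' (u x) * rHess u x w z + F'' * mvfderiv 𝓘(ℝ, E) u x w * mvfderiv 𝓘(ℝ, E) u x z := by
  have h : rGrad E (fun y => F (u y)) =ᶠ[𝓝 x] (fun y => F' (u y)) • rGrad E u := by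
    filter_upwards [hu.eventually, hu.continuousAt.eventually hF] with y hy hy'
    exact rGrad_comp hy.mdiff hy'
  have hd : MDifferentiableAt 𝓘(ℝ, E) 𝓘(ℝ, ℝ) (fun y => F' (u y)) x :=
    hF'.differentiableAt.mdifferentiableAt.comp x hu.mdiff
  rw [rHess_eq_koszul (hu.comp_real hFC), koszul_congr h,
    koszul_smul hd (diffField_rGrad hu), rHess_eq_koszul hu, mvfderiv_comp_real hu.mdiff hF',
    inner_rGrad]

lemma mvfderiv_normSq_rGrad (hu : IsC2At (E := E) u x) (w : TangentSpace 𝓘(ℝ, E) x) :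
    mvfderiv 𝓘(ℝ, E) (fun y => inner ℝ (rGrad E u y) (rGrad E u y)) x w =
      2 * rHess u x w (rGrad E u x) := by
  rw [mvfderiv_inner_eq_koszul (diffField_rGrad hu) (diffField_rGrad hu), rHess_eq_koszul hu]
  ring

lemma mdifferentiableAt_norm_rGrad (hu : IsC2At (E := E) u x) (h0 : rGrad E u x ≠ 0) :
    MDifferentiableAt 𝓘(ℝ, E) 𝓘(ℝ, ℝ) (fun y => ‖rGrad E u y‖) x := by
  have h1 := mdifferentiableAt_inner_field (diffField_rGrad hu) (diffField_rGrad hu)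
  have h2 : (fun y => ‖rGrad E u y‖) =
      fun y => Real.sqrt (inner ℝ (rGrad E u y) (rGrad E u y)) := by
    funext y
    rw [real_inner_self_eq_norm_sq, Real.sqrt_sq (norm_nonneg _)]
  rw [h2]
  refine (DifferentiableAt.sqrt differentiableAt_id ?_).mdifferentiableAt.comp x h1
  simpa using h0

lemma mvfderiv_norm_rGrad (hu : IsC2At (E := E) u x) (h0 : rGrad E u x ≠ 0)
    (w : TangentSpace 𝓘(ℝ, E) x) :
    mvfderiv 𝓘(ℝ, E) (fun y => ‖rGrad E u y‖) x w =
      rHess u x w (rGrad E u x) / ‖rGrad E u x‖ := by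
  have h1 := mvfderiv_normSq_rGrad hu w
  have h2 : (fun y => inner ℝ (rGrad E u y) (rGrad E u y)) =
      fun y : N => (fun s : ℝ => s ^ 2) ‖rGrad E u y‖ := by
    funext y
    exact real_inner_self_eq_norm_sq _
  rw [h2, mvfderiv_comp_real (mdifferentiableAt_norm_rGrad hu h0) (hasDerivAt_pow 2 _)] at h1
  have h3 : ‖rGrad E u x‖ ≠ 0 := norm_ne_zero_iff.2 h0
  field_simp
  norm_num at h1
  linarith

/-- The expansion of the divergence of `α(‖∇u‖) ∇u` at a regular point. -/
lemma rDiv_quasilinear {α : ℝ → ℝ} {α' : ℝ} (hu : IsC2At (E := E) u x) (h0 : rGrad E u x ≠ 0)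
    (hα : HasDerivAt α α' ‖rGrad E u x‖) :
    rDiv (fun y => α ‖rGrad E u y‖ • rGrad E u y) x =
      α ‖rGrad E u x‖ * rDiv (rGrad E u) x +
        α' / ‖rGrad E u x‖ * rHess u x (rGrad E u x) (rGrad E u x) := by
  have hd := mdifferentiableAt_norm_rGrad hu h0
  have hf : MDifferentiableAt 𝓘(ℝ, E) 𝓘(ℝ, ℝ) (fun y => α ‖rGrad E u y‖) x :=
    hα.differentiableAt.mdifferentiableAt.comp x hd
  have hX := diffField_rGrad hu
  have hfX : DiffField ((fun y => α ‖rGrad E u y‖) • rGrad E u) x :=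
    hf.smul_section hX
  change rDiv ((fun y => α ‖rGrad E u y‖) • rGrad E u) x = _
  rw [rDiv_eq_sum_koszul hfX, rDiv_eq_sum_koszul hX]
  simp only [koszul_smul hf hX, Finset.sum_add_distrib, ← Finset.mul_sum,
    mvfderiv_comp_real hd hα, mvfderiv_norm_rGrad hu h0]
  congr 1
  set p := rGrad E u x
  set e := stdOrthonormalBasis ℝ (TangentSpace 𝓘(ℝ, E) x)
  simp only [← hessForm_apply hu]
  have h1 : hessForm hu p p = ∑ i, inner ℝ (e i) p * hessForm hu (e i) p := by
    have h2 := congrArg (fun z => hessForm hu z p) (e.sum_repr' p)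
    simpa only [map_sum, sum_apply, map_smul, smul_apply, smul_eq_mul] using h2.symm
  rw [h1, Finset.mul_sum]
  refine Finset.sum_congr rfl fun i _ => ?_
  rw [real_inner_comm]
  ring

/-- The first and second derivative tests at an interior maximum. -/
lemma rGrad_eq_zero_of_isLocalMax (hu : IsC2At (E := E) u x) (hmax : IsLocalMax u x) :
    rGrad E u x = 0 := by
  refine rGrad_unique fun w => ?_
  obtain ⟨γ, h0, hγ⟩ := exists_curve w
  obtain ⟨hγC, hγ'⟩ := hγ.self_of_nhds
  subst h0
  have h1 := hasDerivAt_comp_curve hu.mdiff (hγC.mdifferentiableAt (by simp))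
  rw [hγ', FiberBundle.extend_apply_self] at h1
  have h2 : IsLocalMax (fun s => u (γ s)) 0 := hγC.continuousAt.eventually hmax
  rw [inner_zero_left, h2.hasDerivAt_eq_zero h1]

/-- Restrict `u` to a curve with initial velocity `w`. Because the gradient vanishes at `x`, the
acceleration of the curve does not contribute, and the second derivative at `0` is the Hessian. -/
lemma rHess_nonpos_of_isLocalMax (hu : IsC2At (E := E) u x) (hmax : IsLocalMax u x)
    (w : TangentSpace 𝓘(ℝ, E) x) : rHess u x w w ≤ 0 := by
  have hgrad := rGrad_eq_zero_of_isLocalMax hu hmax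
  obtain ⟨γ, h0, hγ⟩ := exists_curve w
  obtain ⟨hγC, hγ'⟩ := hγ.self_of_nhds
  subst h0
  set V : ∀ y : N, TangentSpace 𝓘(ℝ, E) y := FiberBundle.extend E w
  have hV : DiffField V (γ 0) := diffField_extend w
  have hV0 : V (γ 0) = w := FiberBundle.extend_apply_self E w
  set k : N → ℝ := fun y => inner ℝ (rGrad E u y) (V y)
  have hk : MDifferentiableAt 𝓘(ℝ, E) 𝓘(ℝ, ℝ) k (γ 0) :=
    mdifferentiableAt_inner_field (diffField_rGrad hu) hV
  have hk' : HasDerivAt (fun s => k (γ s)) (rHess u (γ 0) w w) 0 := by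
    have h1 := hasDerivAt_comp_curve hk (hγC.mdifferentiableAt (by simp))
    rw [hγ', hV0, mvfderiv_inner_eq_koszul (diffField_rGrad hu) hV,
      hgrad, ← koszulForm_apply hV, map_zero, add_zero, ← rHess_eq_koszul hu, hV0] at h1
    exact h1
  have hg : ∀ᶠ s in 𝓝 (0 : ℝ), HasDerivAt (fun s => u (γ s)) (k (γ s)) s := by
    filter_upwards [hγ, hγC.continuousAt.eventually hu.eventually] with s hs hus
    have h1 := hasDerivAt_comp_curve hus.mdiff (hs.1.mdifferentiableAt (by simp))
    rwa [hs.2, ← inner_rGrad] at h1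
  have hderiv : deriv (fun s => u (γ s)) =ᶠ[𝓝 0] fun s => k (γ s) := hg.mono fun s hs => hs.deriv
  have hlm : IsLocalMax (fun s => u (γ s)) 0 := hγC.continuousAt.eventually hmax
  by_contra hpos
  have hdd : deriv (deriv fun s => u (γ s)) 0 = rHess u (γ 0) w w := by
    rw [hderiv.deriv_eq, hk'.deriv]
  -- A positive second derivative would make `0` a local minimum as well; then `u` is constant along
  -- the curve near `0` and its second derivative is zero.
  have hmin : IsLocalMin (fun s => u (γ s)) 0 :=
    isLocalMin_of_deriv_deriv_pos (by rw [hdd]; exact not_le.1 hpos) hlm.deriv_eq_zero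
      hg.self_of_nhds.continuousAt
  have hconst : (fun s => u (γ s)) =ᶠ[𝓝 0] fun _ => u (γ 0) := by
    filter_upwards [hlm, hmin] with s h1 h2 using le_antisymm h1 h2
  have h3 : deriv (fun s => u (γ s)) =ᶠ[𝓝 0] fun _ => 0 := by
    simpa using hconst.deriv
  have h4 := h3.deriv_eq
  rw [hdd, deriv_const] at h4
  exact hpos h4.le

end Hessian

/-! ### Properness of complete length spaces -/

section HopfRinow

variable {X : Type*} [MetricSpace X]

/-- Hopf–Rinow–Cohn-Vossen: a complete locally compact length space is proper. -/
lemma properSpace_of_length [CompleteSpace X] [LocallyCompactSpace X]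
    (h : ∀ (p x : X) (r s : ℝ), 0 ≤ r → 0 < s → dist p x < r + s →
      ∃ y, dist p y ≤ r ∧ dist y x < s) : ProperSpace X := by
  suffices H : ∀ (p : X) (R : ℝ), IsCompact (Metric.closedBall p R) from ⟨H⟩
  intro p
  have hmono : ∀ r r' : ℝ, r ≤ r' → IsCompact (Metric.closedBall p r') →
      IsCompact (Metric.closedBall p r) := fun r r' hr hc =>
    hc.of_isClosed_subset Metric.isClosed_closedBall (Metric.closedBall_subset_closedBall hr)
  -- Compactness passes to the limit radius: the ball of radius `R` lies within `ε / 2` of the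
  -- compact ball of radius `max 0 (R - ε / 4)`.
  have hlim : ∀ R : ℝ, 0 < R → (∀ r, 0 ≤ r → r < R → IsCompact (Metric.closedBall p r)) →
      IsCompact (Metric.closedBall p R) := by
    intro R hR hc
    refine TotallyBounded.isCompact_of_isClosed ?_ Metric.isClosed_closedBall
    refine Metric.totallyBounded_iff.2 fun ε hε => ?_
    set r' := max 0 (R - ε / 4)
    have hr' : r' < R := max_lt hR (by linarith)
    obtain ⟨t, ht, hcov⟩ := Metric.totallyBounded_iff.1
      (hc r' (le_max_left _ _) hr').totallyBounded (ε / 2) (by linarith)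
    refine ⟨t, ht, fun x hx => ?_⟩
    have h1 : dist p x ≤ R := by
      rw [dist_comm]
      exact hx
    obtain ⟨y, hy1, hy2⟩ := h p x r' (ε / 2) (le_max_left _ _) (by linarith)
      (by linarith [le_max_right 0 (R - ε / 4)])
    obtain ⟨z, hz, hzy⟩ := mem_iUnion₂.1 (hcov (Metric.mem_closedBall'.2 hy1))
    refine mem_iUnion₂.2 ⟨z, hz, ?_⟩
    rw [Metric.mem_ball] at hzy ⊢
    linarith [dist_triangle x y z, dist_comm x y]
  -- By local compactness a compact ball has a neighbourhood with compact closure, so the radius can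
  -- be increased. With `hlim` this excludes a finite supremum of compact radii.
  have hext : ∀ r : ℝ, 0 ≤ r → IsCompact (Metric.closedBall p r) →
      ∃ ε > 0, IsCompact (Metric.closedBall p (r + ε)) := by
    intro r hr hc
    obtain ⟨K', hK', hsub⟩ := exists_compact_superset hc
    obtain ⟨δ, hδ, hth⟩ := hc.exists_thickening_subset_open isOpen_interior hsub
    refine ⟨δ / 2, by linarith, hK'.of_isClosed_subset Metric.isClosed_closedBall fun x hx => ?_⟩
    have h1 : dist p x ≤ r + δ / 2 := by
      rw [dist_comm]
      exact hx
    obtain ⟨y, hy1, hy2⟩ := h p x r δ hr hδ (by linarith)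
    refine interior_subset (hth (Metric.mem_thickening_iff.2 ⟨y, Metric.mem_closedBall'.2 hy1, ?_⟩))
    rwa [dist_comm]
  by_contra! hcon
  obtain ⟨R, hR⟩ := hcon
  set T := {r : ℝ | 0 ≤ r ∧ IsCompact (Metric.closedBall p r)}
  have h0 : (0 : ℝ) ∈ T := ⟨le_rfl, by simp⟩
  have hbdd : BddAbove T := ⟨R, fun r hr => le_of_not_gt fun hlt => hR (hmono R r hlt.le hr.2)⟩
  have hρ0 : 0 ≤ sSup T := le_csSup hbdd h0
  have hlt : ∀ r, 0 ≤ r → r < sSup T → IsCompact (Metric.closedBall p r) := by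
    intro r _ hr
    obtain ⟨r', hr', hrr'⟩ := exists_lt_of_lt_csSup ⟨0, h0⟩ hr
    exact hmono r r' hrr'.le hr'.2
  have hρ : IsCompact (Metric.closedBall p (sSup T)) := by
    rcases hρ0.eq_or_lt with h1 | h1
    · rw [← h1]
      exact h0.2
    · exact hlim _ h1 hlt
  obtain ⟨ε, hε, hc⟩ := hext _ hρ0 hρ
  have := le_csSup hbdd (show sSup T + ε ∈ T from ⟨by linarith, hc⟩)
  linarith

end HopfRinow

/-! ### Lengths of curves and nearly minimizing paths -/

section Lengths

variable {E : Type*} [NormedAddCommGroup E] [NormedSpace ℝ E] [FiniteDimensional ℝ E]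
  {N : Type*} [MetricSpace N] [ChartedSpace E N]
  [IsManifold 𝓘(ℝ, E) ∞ N] [RiemannianBundle (fun x : N => TangentSpace 𝓘(ℝ, E) x)]
  [IsContMDiffRiemannianBundle 𝓘(ℝ, E) ∞ E (fun x : N => TangentSpace 𝓘(ℝ, E) x)]
  [IsRiemannianManifold 𝓘(ℝ, E) N]

variable {γ : ℝ → N} {a b : ℝ}

lemma edist_le_pathELength (hγ : ContMDiffOn 𝓘(ℝ, ℝ) 𝓘(ℝ, E) 1 γ (Icc a b)) (hab : a ≤ b) :
    edist (γ a) (γ b) ≤ pathELength 𝓘(ℝ, E) γ a b := by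
  rw [IsRiemannianManifold.out (I := 𝓘(ℝ, E))]
  exact riemannianEDist_le_pathELength hγ rfl rfl hab

lemma exists_path {x y : N} {r : ℝ} (h : dist x y < r) :
    ∃ γ : ℝ → N, γ 0 = x ∧ γ 1 = y ∧ ContMDiffOn 𝓘(ℝ, ℝ) 𝓘(ℝ, E) 1 γ (Icc 0 1) ∧
      pathELength 𝓘(ℝ, E) γ 0 1 < ENNReal.ofReal r := by
  apply exists_lt_of_riemannianEDist_lt
  rw [← IsRiemannianManifold.out (I := 𝓘(ℝ, E)), edist_dist]
  exact (ENNReal.ofReal_lt_ofReal_iff_of_nonneg dist_nonneg).2 h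

/-- The length of a curve, as a real number. -/
def realLength (E : Type*) [NormedAddCommGroup E] [NormedSpace ℝ E] {N : Type*}
    [TopologicalSpace N] [ChartedSpace E N] [IsManifold 𝓘(ℝ, E) ∞ N]
    [RiemannianBundle (fun x : N => TangentSpace 𝓘(ℝ, E) x)] (γ : ℝ → N) (a b : ℝ) : ℝ :=
  (pathELength 𝓘(ℝ, E) γ a b).toReal

lemma dist_le_realLength (hγ : ContMDiffOn 𝓘(ℝ, ℝ) 𝓘(ℝ, E) 1 γ (Icc a b)) (hab : a ≤ b)
    (hfin : pathELength 𝓘(ℝ, E) γ a b ≠ ⊤) : dist (γ a) (γ b) ≤ realLength E γ a b := by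
  rw [dist_edist]
  exact ENNReal.toReal_mono hfin (edist_le_pathELength hγ hab)

/-- A nearly minimizing path, together with its length function. -/
lemma exists_path_split {x y : N} {r : ℝ} (h : dist x y < r) :
    ∃ γ : ℝ → N, γ 0 = x ∧ γ 1 = y ∧ ContMDiffOn 𝓘(ℝ, ℝ) 𝓘(ℝ, E) 1 γ (Icc 0 1) ∧
      ∀ t ∈ Icc (0 : ℝ) 1, pathELength 𝓘(ℝ, E) γ 0 t ≠ ⊤ ∧
        dist x (γ t) ≤ realLength E γ 0 t ∧ realLength E γ 0 t + dist (γ t) y < r := by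
  obtain ⟨γ, h0, h1, hγ, hlen⟩ := exists_path (E := E) h
  refine ⟨γ, h0, h1, hγ, fun t ht => ?_⟩
  have hsum := pathELength_add (I := 𝓘(ℝ, E)) (γ := γ) ht.1 ht.2
  have hfin : pathELength 𝓘(ℝ, E) γ 0 1 ≠ ⊤ := hlen.ne_top
  have hf1 : pathELength 𝓘(ℝ, E) γ 0 t ≠ ⊤ :=
    ne_top_of_le_ne_top hfin (hsum ▸ le_self_add)
  have hf2 : pathELength 𝓘(ℝ, E) γ t 1 ≠ ⊤ :=
    ne_top_of_le_ne_top hfin (hsum ▸ le_add_self)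
  refine ⟨hf1, ?_, ?_⟩
  · rw [← h0]
    exact dist_le_realLength (hγ.mono (Icc_subset_Icc le_rfl ht.2)) ht.1 hf1
  · have h2 : dist (γ t) y ≤ realLength E γ t 1 := by
      rw [← h1]
      exact dist_le_realLength (hγ.mono (Icc_subset_Icc ht.1 le_rfl)) ht.2 hf2
    have h3 : realLength E γ 0 t + realLength E γ t 1 = realLength E γ 0 1 := by
      rw [realLength, realLength, realLength, ← hsum, ENNReal.toReal_add hf1 hf2]
    have h4 : realLength E γ 0 1 < r := by
      have hr : 0 ≤ r := dist_nonneg.trans h.le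
      rw [realLength]
      exact (ENNReal.lt_ofReal_iff_toReal_lt hfin).1 hlen
    linarith

/-- The mean value inequality along a curve. -/
lemma abs_sub_le_mul_realLength {f : N → ℝ} {L : ℝ}
    (hγ : ContMDiffOn 𝓘(ℝ, ℝ) 𝓘(ℝ, E) 1 γ (Icc a b)) (hab : a ≤ b)
    (hfin : pathELength 𝓘(ℝ, E) γ a b ≠ ⊤)
    (hf : ∀ t ∈ Icc a b, ContMDiffAt 𝓘(ℝ, E) 𝓘(ℝ, ℝ) 1 f (γ t))
    (hL : ∀ t ∈ Icc a b, ‖rGrad E f (γ t)‖ ≤ L) :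
    |f (γ a) - f (γ b)| ≤ L * realLength E γ a b := by
  have hL0 : 0 ≤ L := (norm_nonneg _).trans (hL a ⟨le_rfl, hab⟩)
  have hfγ : ContMDiffOn 𝓘(ℝ, ℝ) 𝓘(ℝ, ℝ) 1 (f ∘ γ) (Icc a b) := fun t ht =>
    (hf t ht).comp_contMDiffWithinAt t (hγ t ht)
  have h1 : edist (f (γ a)) (f (γ b)) ≤ pathELength 𝓘(ℝ, ℝ) (f ∘ γ) a b := by
    rw [IsRiemannianManifold.out (I := 𝓘(ℝ, ℝ)) (f (γ a))]
    exact riemannianEDist_le_pathELength hfγ rfl rfl hab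
  have h2 : pathELength 𝓘(ℝ, ℝ) (f ∘ γ) a b ≤
      ENNReal.ofReal L * pathELength 𝓘(ℝ, E) γ a b := by
    rw [pathELength_eq_lintegral_mfderiv_Ioo, pathELength_eq_lintegral_mfderiv_Ioo,
      ← MeasureTheory.lintegral_const_mul' _ _ ENNReal.ofReal_ne_top]
    refine MeasureTheory.setLIntegral_mono' measurableSet_Ioo fun t ht => ?_
    have hm : MDifferentiableAt 𝓘(ℝ, ℝ) 𝓘(ℝ, E) γ t :=
      ((hγ t (Ioo_subset_Icc_self ht)).contMDiffAt
        (Icc_mem_nhds ht.1 ht.2)).mdifferentiableAt one_ne_zero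
    have hfm := (hf t (Ioo_subset_Icc_self ht)).mdifferentiableAt one_ne_zero
    have hd := (hfm.hasMFDerivAt.comp t hm.hasMFDerivAt).mfderiv
    have hb : ‖mvfderiv 𝓘(ℝ, E) f (γ t) (mfderiv 𝓘(ℝ, ℝ) 𝓘(ℝ, E) γ t (1 : ℝ))‖ ≤
        L * ‖mfderiv 𝓘(ℝ, ℝ) 𝓘(ℝ, E) γ t (1 : ℝ)‖ := by
      rw [← inner_rGrad]
      exact (norm_inner_le_norm _ _).trans
        (mul_le_mul_of_nonneg_right (hL t (Ioo_subset_Icc_self ht)) (norm_nonneg _))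
    have hd' : (mfderiv 𝓘(ℝ, ℝ) 𝓘(ℝ, ℝ) (f ∘ γ) t (1 : ℝ) : ℝ) =
        mvfderiv 𝓘(ℝ, E) f (γ t) (mfderiv 𝓘(ℝ, ℝ) 𝓘(ℝ, E) γ t (1 : ℝ)) :=
      congrArg (fun G : ℝ →L[ℝ] ℝ => G 1) hd
    have he : ‖mfderiv 𝓘(ℝ, ℝ) 𝓘(ℝ, ℝ) (f ∘ γ) t (1 : ℝ)‖ₑ = ENNReal.ofReal
        ‖mvfderiv 𝓘(ℝ, E) f (γ t) (mfderiv 𝓘(ℝ, ℝ) 𝓘(ℝ, E) γ t (1 : ℝ))‖ := by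
      rw [enorm_tangentSpace_vectorSpace, ofReal_norm]
      exact congrArg (fun r : ℝ => ‖r‖ₑ) hd'
    refine (le_of_eq he).trans ?_
    rw [← ofReal_norm, ← ENNReal.ofReal_mul hL0]
    exact ENNReal.ofReal_le_ofReal hb
  have h3 := ENNReal.toReal_mono (ENNReal.mul_ne_top ENNReal.ofReal_ne_top hfin) (h1.trans h2)
  rwa [← dist_edist, ENNReal.toReal_mul, ENNReal.toReal_ofReal hL0, Real.dist_eq] at h3

/-- A nearly minimizing path from `p` to `x` crosses the sphere of radius `r` about `p`; having used
length at least `r`, it has less than `s` left. -/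
lemma exists_between_dist (E : Type*) [NormedAddCommGroup E] [NormedSpace ℝ E]
    [FiniteDimensional ℝ E] {N : Type*} [MetricSpace N] [ChartedSpace E N]
    [IsManifold 𝓘(ℝ, E) ∞ N] [RiemannianBundle (fun x : N => TangentSpace 𝓘(ℝ, E) x)]
    [IsContMDiffRiemannianBundle 𝓘(ℝ, E) ∞ E (fun x : N => TangentSpace 𝓘(ℝ, E) x)]
    [IsRiemannianManifold 𝓘(ℝ, E) N]
    (p x : N) (r s : ℝ) (hr : 0 ≤ r) (hs : 0 < s)
    (h : dist p x < r + s) : ∃ y, dist p y ≤ r ∧ dist y x < s := by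
  by_cases hpx : dist p x ≤ r
  · exact ⟨x, hpx, by simpa using hs⟩
  obtain ⟨γ, h0, h1, hγ, hlen⟩ := exists_path_split (E := E) h
  have hcont : ContinuousOn (fun t => dist p (γ t)) (Icc 0 1) :=
    (continuous_const.dist continuous_id).comp_continuousOn hγ.continuousOn
  obtain ⟨t, ht, htr⟩ := intermediate_value_Icc zero_le_one hcont
    (show r ∈ Icc (dist p (γ 0)) (dist p (γ 1)) from
      ⟨by rw [h0, dist_self]; exact hr, by rw [h1]; exact (not_le.1 hpx).le⟩)
  obtain ⟨-, h2, h3⟩ := hlen t ht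
  exact ⟨γ t, htr.le, by linarith⟩

lemma properSpace_of_complete (E : Type*) [NormedAddCommGroup E] [NormedSpace ℝ E]
    [FiniteDimensional ℝ E] (N : Type*) [MetricSpace N] [ChartedSpace E N]
    [IsManifold 𝓘(ℝ, E) ∞ N] [RiemannianBundle (fun x : N => TangentSpace 𝓘(ℝ, E) x)]
    [IsContMDiffRiemannianBundle 𝓘(ℝ, E) ∞ E (fun x : N => TangentSpace 𝓘(ℝ, E) x)]
    [IsRiemannianManifold 𝓘(ℝ, E) N]
    [CompleteSpace N] : ProperSpace N := by
  have : LocallyCompactSpace N := Manifold.locallyCompact_of_finiteDimensional 𝓘(ℝ, E)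
  exact properSpace_of_length (exists_between_dist E)

end Lengths

/-! ### The distance function has unit gradient -/

section Eikonal

variable {E : Type*} [NormedAddCommGroup E] [NormedSpace ℝ E] [FiniteDimensional ℝ E]
  {N : Type*} [MetricSpace N] [ChartedSpace E N]
  [IsManifold 𝓘(ℝ, E) ∞ N] [RiemannianBundle (fun x : N => TangentSpace 𝓘(ℝ, E) x)]
  [IsContMDiffRiemannianBundle 𝓘(ℝ, E) ∞ E (fun x : N => TangentSpace 𝓘(ℝ, E) x)]
  [IsRiemannianManifold 𝓘(ℝ, E) N]

variable {γ : ℝ → N} {a b C : ℝ} {x : N}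

lemma dist_le_mul_of_norm_le (hγ : ContMDiffOn 𝓘(ℝ, ℝ) 𝓘(ℝ, E) 1 γ (Icc a b)) (hab : a ≤ b)
    (hC : 0 ≤ C) (h : ∀ t ∈ Ioo a b, ‖mfderiv 𝓘(ℝ, ℝ) 𝓘(ℝ, E) γ t (1 : ℝ)‖ ≤ C) :
    dist (γ a) (γ b) ≤ C * (b - a) := by
  have h1 : pathELength 𝓘(ℝ, E) γ a b ≤ ENNReal.ofReal (C * (b - a)) := by
    rw [pathELength_eq_lintegral_mfderiv_Ioo]
    calc _ ≤ ∫⁻ _ in Ioo a b, ENNReal.ofReal C := by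
          refine MeasureTheory.setLIntegral_mono' measurableSet_Ioo fun t ht => ?_
          rw [← ofReal_norm]
          exact ENNReal.ofReal_le_ofReal (h t ht)
      _ = ENNReal.ofReal (C * (b - a)) := by
          rw [MeasureTheory.setLIntegral_const, Real.volume_Ioo, ENNReal.ofReal_mul hC]
  have h2 := (edist_le_pathELength hγ hab).trans h1
  rw [edist_dist] at h2
  exact (ENNReal.ofReal_le_ofReal_iff (mul_nonneg hC (sub_nonneg.2 hab))).1 h2

/-- A curve with prescribed initial velocity whose speed stays bounded. -/
lemma exists_curve_speed_le (v : TangentSpace 𝓘(ℝ, E) x) (hC : ‖v‖ < C) :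
    ∃ γ : ℝ → N, γ 0 = x ∧ (∃ τ > 0, ∀ t ∈ Icc 0 τ, ContMDiffAt 𝓘(ℝ, ℝ) 𝓘(ℝ, E) ∞ γ t ∧
      ‖mfderiv 𝓘(ℝ, ℝ) 𝓘(ℝ, E) γ t (1 : ℝ)‖ ≤ C) ∧
      (∀ u : N → ℝ, MDifferentiableAt 𝓘(ℝ, E) 𝓘(ℝ, ℝ) u x →
        HasDerivAt (fun t => u (γ t)) (mvfderiv 𝓘(ℝ, E) u x v) 0) ∧
      ∀ (u : N → ℝ) (S : Set N) (T : Set ℝ), MDifferentiableWithinAt 𝓘(ℝ, E) 𝓘(ℝ, ℝ) u S x →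
        MapsTo γ T S →
          HasDerivWithinAt (fun t => u (γ t)) (mvfderivWithin 𝓘(ℝ, E) u S x v) T 0 := by
  obtain ⟨γ, h0, hγ⟩ := exists_curve v
  subst h0
  have hγ0 := hγ.self_of_nhds
  have hv : mfderiv 𝓘(ℝ, ℝ) 𝓘(ℝ, E) γ 0 (1 : ℝ) = v := by
    rw [hγ0.2, FiberBundle.extend_apply_self]
  have hn : ∀ᶠ y in 𝓝 (γ 0), ‖FiberBundle.extend E v y‖ < C := by
    refine (continuousAt_norm_field (diffField_extend v)).eventually_lt_const ?_
    simpa only [FiberBundle.extend_apply_self] using hC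
  have hγm := hγ0.1.mdifferentiableAt (by simp)
  refine ⟨γ, rfl, ?_, fun u hu => ?_, fun u S T hu hmap => ?_⟩
  · obtain ⟨ε, hε, hb⟩ := Metric.eventually_nhds_iff_ball.1
      (hγ.and (hγ0.1.continuousAt.eventually hn))
    refine ⟨ε / 2, by linarith, fun t ht => ?_⟩
    obtain ⟨⟨h1, h2⟩, h3⟩ := hb t (by
      rw [Metric.mem_ball, Real.dist_eq, abs_lt]
      constructor <;> linarith [ht.1, ht.2])
    exact ⟨h1, by rw [h2]; exact h3.le⟩
  · have := hasDerivAt_comp_curve hu hγm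
    rwa [hv] at this
  · let L : ℝ →L[ℝ] ℝ := (mvfderivWithin 𝓘(ℝ, E) u S (γ 0)).comp (mfderiv 𝓘(ℝ, ℝ) 𝓘(ℝ, E) γ 0)
    have h1 : HasFDerivWithinAt (fun t => u (γ t)) L T 0 :=
      (hu.hasMFDerivWithinAt.comp 0 hγm.hasMFDerivAt.hasMFDerivWithinAt hmap).hasFDerivWithinAt
    refine h1.hasDerivWithinAt.congr_deriv ?_
    exact congrArg (mvfderivWithin 𝓘(ℝ, E) u S (γ 0)) hv

/-- Along a curve leaving in the direction `v = ∇f`, the function grows at the rate `‖v‖²` but,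
being 1-Lipschitz, no faster than the speed. A speed bound `C < ‖v‖²` is available as soon as `‖v‖ >
1`. -/
lemma norm_rGrad_le_one {f : N → ℝ} (hf : MDifferentiableAt 𝓘(ℝ, E) 𝓘(ℝ, ℝ) f x)
    (hlip : ∀ y z, |f y - f z| ≤ dist y z) : ‖rGrad E f x‖ ≤ 1 := by
  by_contra! hcon
  set v := rGrad E f x with hv
  obtain ⟨C, hC1, hC2⟩ := exists_between (show ‖v‖ < ‖v‖ ^ 2 by nlinarith)
  obtain ⟨γ, h0, ⟨τ, hτ, hγ⟩, hd, -⟩ := exists_curve_speed_le v hC1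
  have hd := hd f hf
  rw [← inner_rGrad, ← hv, real_inner_self_eq_norm_sq] at hd
  have hle : ‖v‖ ^ 2 ≤ C := by
    have htend := hd.hasDerivWithinAt (s := Ioi 0)
    rw [hasDerivWithinAt_iff_tendsto_slope' (by simp)] at htend
    refine le_of_tendsto htend ?_
    filter_upwards [Ioo_mem_nhdsGT hτ] with t ht
    have h1 := dist_le_mul_of_norm_le (E := E) (γ := γ) (a := 0) (b := t) (C := C)
      (fun s hs => ((hγ s ⟨hs.1, hs.2.trans ht.2.le⟩).1.of_le (by simp)).contMDiffWithinAt)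
      ht.1.le ((norm_nonneg v).trans hC1.le) (fun s hs => (hγ s ⟨hs.1.le, hs.2.le.trans ht.2.le⟩).2)
    rw [slope_def_field, div_le_iff₀ (by linarith [ht.1])]
    refine (le_abs_self _).trans ((hlip _ _).trans ?_)
    rwa [dist_comm]
  linarith

/-- The distance to a closed set has gradient of norm one where it is of class `C²`. -/
lemma norm_rGrad_infDist {S : Set N} (hS : IsClosed S) (hne : S.Nonempty) (hx : x ∉ S)
    (hf : IsC2At (E := E) (fun y => Metric.infDist y S) x) :
    ‖rGrad E (fun y => Metric.infDist y S) x‖ = 1 := by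
  set f := fun y => Metric.infDist y S with hfdef
  have hlip : ∀ y z, |f y - f z| ≤ dist y z := fun y z => by
    have := (Metric.lipschitz_infDist_pt S).dist_le_mul y z
    simpa [Real.dist_eq] using this
  refine le_antisymm (norm_rGrad_le_one hf.mdiff hlip) ?_
  -- If the gradient has norm below `c < 1` near `x`, a path towards `S` lowers `f` by at most `c`
  -- times its length, whereas a nearly minimizing one must lower it by almost its full length.
  by_contra! hcon
  obtain ⟨c, hc1, hc2⟩ := exists_between hcon
  have hfx : 0 < f x := (hS.notMem_iff_infDist_pos hne).1 hx
  have hev : ∀ᶠ y in 𝓝 x, ‖rGrad E f y‖ < c ∧ IsC2At (E := E) f y :=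
    ((continuousAt_norm_field (diffField_rGrad hf)).eventually_lt_const hc1).and hf.eventually
  obtain ⟨ρ₀, hρ₀, hball⟩ := Metric.eventually_nhds_iff_ball.1 hev
  obtain ⟨ρ, hρ, hρlt⟩ := exists_between (lt_min hρ₀ hfx)
  have hc0 : 0 ≤ c := (norm_nonneg _).trans hc1.le
  -- The slack `(1 - c) * ρ` is the gain that a piece of path of length at least `ρ` contradicts.
  obtain ⟨q, hq, hqd⟩ := (Metric.infDist_lt_iff hne).1
    (show Metric.infDist x S < f x + (1 - c) * ρ by
      have : 0 < (1 - c) * ρ := mul_pos (by linarith) hρ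
      simpa [hfdef] using this)
  have hfq : f x ≤ dist x q := Metric.infDist_le_dist_of_mem hq
  obtain ⟨γ, h0, h1, hγ, hlen⟩ := exists_path_split (E := E) hqd
  have hcont : ContinuousOn (fun t => dist x (γ t)) (Icc 0 1) :=
    (continuous_const.dist continuous_id).comp_continuousOn hγ.continuousOn
  have hρq : ρ < dist x q := (hρlt.trans_le (min_le_right _ _)).trans_le hfq
  -- The first time on the sphere of radius `ρ` is taken, so that until then the path stays where
  -- the gradient bound holds.
  set Z := Icc (0 : ℝ) 1 ∩ (fun t => dist x (γ t)) ⁻¹' {ρ}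
  have hZ : IsCompact Z :=
    isCompact_Icc.of_isClosed_subset (hcont.preimage_isClosed_of_isClosed isClosed_Icc
      isClosed_singleton) inter_subset_left
  have hZne : Z.Nonempty := by
    obtain ⟨t, ht, htr⟩ := intermediate_value_Icc zero_le_one hcont
      (show ρ ∈ Icc (dist x (γ 0)) (dist x (γ 1)) from
        ⟨by rw [h0, dist_self]; exact hρ.le, by rw [h1]; exact hρq.le⟩)
    exact ⟨t, ht, htr⟩
  obtain ⟨t₁, ⟨ht₁, htρ⟩, hmin⟩ := hZ.exists_isLeast hZne
  have htρ : dist x (γ t₁) = ρ := htρ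
  have hin : ∀ t ∈ Icc 0 t₁, dist x (γ t) ≤ ρ := by
    intro t ht
    by_contra! hlt
    have htne : t ≠ t₁ := fun h => by rw [h, htρ] at hlt; exact lt_irrefl _ hlt
    obtain ⟨s, hs, hsr⟩ := intermediate_value_Icc ht.1
      (hcont.mono (Icc_subset_Icc le_rfl (ht.2.trans ht₁.2)))
      (show ρ ∈ Icc (dist x (γ 0)) (dist x (γ t)) from
        ⟨by rw [h0, dist_self]; exact hρ.le, hlt.le⟩)
    have := hmin ⟨⟨hs.1, hs.2.trans (ht.2.trans ht₁.2)⟩, hsr⟩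
    exact htne (le_antisymm ht.2 (this.trans hs.2))
  have hb : ∀ t ∈ Icc 0 t₁, γ t ∈ Metric.ball x ρ₀ := fun t ht => by
    rw [Metric.mem_ball, dist_comm]
    exact (hin t ht).trans_lt (hρlt.trans_le (min_le_left _ _))
  obtain ⟨hfin, hL1, hL2⟩ := hlen t₁ ht₁
  have hmv := abs_sub_le_mul_realLength (f := f) (L := c)
    (hγ.mono (Icc_subset_Icc le_rfl ht₁.2)) ht₁.1 hfin
    (fun t ht => (hball _ (hb t ht)).2.of_le one_le_two) (fun t ht => (hball _ (hb t ht)).1.le)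
  have h2 : f (γ t₁) ≤ dist (γ t₁) q := Metric.infDist_le_dist_of_mem hq
  rw [h0] at hmv
  have := (abs_le.1 hmv).2
  nlinarith

end Eikonal

/-! ### The ordinary differential equation for the barrier profile -/

section Profile

/-- The inverse of a primitive of a positive continuous function bounded away from zero. -/
lemma exists_inverse_primitive {k : ℝ → ℝ} {c : ℝ} (hk : Continuous k) (hc : 0 < c)
    (hck : ∀ p, c ≤ k p) (P : ℝ) :
    ∃ q : ℝ → ℝ, StrictMono q ∧ (∀ p, q (∫ s in P..p, k s) = p) ∧
      ∀ t, HasDerivAt q (k (q t))⁻¹ t := by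
  set T : ℝ → ℝ := fun p => ∫ s in P..p, k s with hT
  have hd : ∀ p, HasDerivAt T (k p) p := fun p =>
    intervalIntegral.integral_hasDerivAt_right (hk.intervalIntegrable _ _)
      (hk.stronglyMeasurableAtFilter _ _) hk.continuousAt
  have hpos : ∀ p, 0 < k p := fun p => hc.trans_le (hck p)
  have hmono : StrictMono T := strictMono_of_hasDerivAt_pos hd hpos
  have hcont : Continuous T := continuous_iff_continuousAt.2 fun p => (hd p).continuousAt
  -- The lower bound `c` makes the primitive grow at least linearly in both directions, hence
  -- surjective.
  have hlin : Monotone fun p => T p - c * p := by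
    refine monotone_of_hasDerivAt_nonneg (f' := fun p => k p - c * 1)
      (fun p => (hd p).sub ((hasDerivAt_id p).const_mul c)) fun p => ?_
    simpa using hck p
  have hT0 : T P = 0 := intervalIntegral.integral_same
  have hsurj : Function.Surjective T := by
    refine hcont.surjective ?_ ?_
    · refine tendsto_atTop_mono' _ ?_
        (tendsto_atTop_add_const_left _ (-(c * P)) (tendsto_id.const_mul_atTop hc))
      filter_upwards [eventually_ge_atTop P] with p hp
      have := hlin hp
      simp only [hT0] at this
      simp only [id]
      linarith
    · refine tendsto_atBot_mono' _ ?_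
        (tendsto_atBot_add_const_left _ (-(c * P)) (tendsto_id.const_mul_atBot hc))
      filter_upwards [eventually_le_atBot P] with p hp
      have := hlin hp
      simp only [hT0] at this
      simp only [id]
      linarith
  set e := hmono.orderIsoOfSurjective T hsurj with he
  have hTe : ∀ t, T (e.symm t) = t := fun t => e.apply_symm_apply t
  refine ⟨e.symm, e.symm.strictMono, fun p => e.symm_apply_apply p, fun t => ?_⟩
  exact HasDerivAt.of_local_left_inverse e.symm.continuous.continuousAt (hd _) (hpos _).ne'
    (Eventually.of_forall hTe)

/-- A solution of `-q' h(q) = C q` which is large but has a small interval of existence,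
and whose primitive `f` attains a prescribed height. -/
lemma exists_profile_of_primitive {h H : ℝ → ℝ} {P C M δ : ℝ} (hh : Continuous h)
    (hP : 0 < P) (hpos : ∀ p, P ≤ p → 0 < h p) (hH : ∀ p, HasDerivAt H (h p) p)
    (htop : Tendsto H atTop atTop) (hC : 0 < C) (hM : 0 < M) (hMδ : M / P < δ) :
    ∃ (ℓ P₁ : ℝ) (f q q' : ℝ → ℝ), 0 < ℓ ∧ ℓ < δ ∧ f 0 = 0 ∧ f ℓ = M ∧ Continuous q' ∧
      (∀ t, HasDerivAt f (q t) t) ∧ (∀ t, HasDerivAt q (q' t) t) ∧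
      ∀ t ∈ Icc 0 ℓ, P ≤ q t ∧ q t ≤ P₁ ∧ -q' t * h (q t) = C * q t := by
  -- `P₁` is the slope at which `∫ h = C M`, that is, at which `f` has gained the height `M`.
  obtain ⟨P₁, hP₁, hHP⟩ : ∃ P₁, P ≤ P₁ ∧ H P₁ = H P + C * M := by
    obtain ⟨R, hR, hPR⟩ := ((htop.eventually_ge_atTop (H P + C * M)).and
      (eventually_ge_atTop P)).exists
    have hcont : ContinuousOn H (Icc P R) := fun p _ => (hH p).continuousAt.continuousWithinAt
    obtain ⟨P₁, h1, h2⟩ := intermediate_value_Icc hPR hcont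
      (show H P + C * M ∈ Icc (H P) (H R) from ⟨by linarith [mul_pos hC hM], hR⟩)
    exact ⟨P₁, h1.1, h2⟩
  have hlt : P < P₁ := hP₁.lt_of_ne fun h => by
    rw [← h] at hHP
    linarith [mul_pos hC hM]
  -- Clamping to `[P, P₁]` makes the rate `k` continuous and bounded below on all of `ℝ`, so that
  -- the inverse primitive is global.
  set cl : ℝ → ℝ := fun p => max P (min p P₁) with hcl
  have hclP : ∀ p, P ≤ cl p := fun p => le_max_left _ _
  have hcl1 : ∀ p, cl p ≤ P₁ := fun p => max_le hP₁ (min_le_right _ _)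
  have hclid : ∀ p ∈ Icc P P₁, cl p = p := fun p hp => by
    simp [hcl, hp.1, hp.2]
  set k : ℝ → ℝ := fun p => h (cl p) / (C * cl p) with hk
  have hclc : Continuous cl := by fun_prop
  have hCcl : ∀ p, 0 < C * cl p := fun p => mul_pos hC (hP.trans_le (hclP p))
  have hkc : Continuous k :=
    (hh.comp hclc).div (continuous_const.mul hclc) fun p => (hCcl p).ne'
  have hkpos : ∀ p, 0 < k p := fun p => div_pos (hpos _ (hclP p)) (hCcl p)
  obtain ⟨c, hc, hck⟩ : ∃ c > 0, ∀ p, c ≤ k p := by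
    obtain ⟨p₀, -, hp₀⟩ := isCompact_Icc.exists_isMinOn (nonempty_Icc.2 hP₁) hkc.continuousOn
    refine ⟨k p₀, hkpos _, fun p => ?_⟩
    have h1 : k p = k (cl p) := by
      simp only [hk, hclid (cl p) ⟨hclP p, hcl1 p⟩]
    rw [h1]
    exact hp₀ ⟨hclP p, hcl1 p⟩
  obtain ⟨q, hq, hqT, hqd⟩ := exists_inverse_primitive hkc hc hck P
  set ℓ := ∫ s in P..P₁, k s with hℓ
  have hq0 : q 0 = P := by simpa using hqT P
  have hqℓ : q ℓ = P₁ := hqT P₁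
  have hGc : Continuous fun s => s * k s := continuous_id.mul hkc
  set G : ℝ → ℝ := fun p => ∫ s in P..p, s * k s with hG
  have hGd : ∀ p, HasDerivAt G (p * k p) p := fun p =>
    intervalIntegral.integral_hasDerivAt_right (hGc.intervalIntegrable _ _)
      (hGc.stronglyMeasurableAtFilter _ _) hGc.continuousAt
  have hGP : G P = 0 := intervalIntegral.integral_same
  have hkC : ∀ s ∈ Icc P P₁, s * k s = h s / C := fun s hs => by
    have hs0 : s ≠ 0 := (hP.trans_le hs.1).ne'
    simp only [hk, hclid s hs]
    field_simp
  have hGP₁ : G P₁ = M := by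
    have h1 : G P₁ = ∫ s in P..P₁, h s / C :=
      intervalIntegral.integral_congr fun s hs => hkC s (by rwa [uIcc_of_le hP₁] at hs)
    rw [h1, intervalIntegral.integral_div,
      intervalIntegral.integral_eq_sub_of_hasDerivAt (fun p _ => hH p)
        (hh.intervalIntegrable _ _), hHP]
    field_simp
    ring
  have hℓpos : 0 < ℓ := by
    rw [← hq.lt_iff_lt, hq0, hqℓ]
    exact hlt
  -- All slopes are at least `P`, so `P ℓ` is at most the total height `M`.
  have hℓle : ℓ ≤ M / P := by
    rw [le_div_iff₀ hP, ← hGP₁, hℓ, ← intervalIntegral.integral_mul_const]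
    refine intervalIntegral.integral_mono_on hP₁ ((hkc.mul continuous_const).intervalIntegrable _ _)
      (hGc.intervalIntegrable _ _) fun s hs => ?_
    rw [mul_comm]
    exact mul_le_mul_of_nonneg_right hs.1 (hkpos s).le
  have hqd' : ∀ t, HasDerivAt (fun t => q (ℓ - t)) (-(k (q (ℓ - t)))⁻¹) t := fun t => by
    simpa using! (hqd (ℓ - t)).comp t ((hasDerivAt_id t).const_sub ℓ)
  have hqc : Continuous q := continuous_iff_continuousAt.2 fun t => (hqd t).continuousAt
  -- Time is reversed: the inverse primitive increases from `P` to `P₁`, while the profile needs a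
  -- slope decreasing from `P₁` to `P`.
  refine ⟨ℓ, P₁, fun t => M - G (q (ℓ - t)), fun t => q (ℓ - t),
    fun t => -(k (q (ℓ - t)))⁻¹, hℓpos, hℓle.trans_lt hMδ, ?_, ?_, ?_, ?_, hqd', ?_⟩
  · simp [hqℓ, hGP₁]
  · simp [hq0, hGP]
  · exact ((hkc.comp (hqc.comp (continuous_const.sub continuous_id))).inv₀
      fun t => (hkpos _).ne').neg
  · intro t
    have := ((hGd (q (ℓ - t))).comp t (hqd' t)).const_sub M
    convert! this using 1
    have := (hkpos (q (ℓ - t))).ne'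
    field_simp
  · intro t ht
    have h1 : P ≤ q (ℓ - t) := hq0 ▸ hq.monotone (by linarith [ht.2])
    have h2 : q (ℓ - t) ≤ P₁ := hqℓ ▸ hq.monotone (by linarith [ht.1])
    refine ⟨h1, h2, ?_⟩
    have h3 := hpos _ h1
    have h4 : 0 < q (ℓ - t) := hP.trans_le h1
    simp only [hk, hclid _ ⟨h1, h2⟩]
    field_simp

/-- Averaging over unit intervals replaces the possibly discontinuous `φ` by a continuous `h`. The
primitive of `h` still diverges, since it is at least `A⁻¹` times the primitive of `φ` at `A p`. -/
lemma exists_profile_of_integral {φ : ℝ → ℝ} {s₁ A C M δ p₀ : ℝ}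
    (hint : ∀ x y, IntervalIntegrable φ MeasureTheory.volume x y) (hnn : ∀ s, 0 ≤ φ s)
    (hpos : ∀ s, s₁ ≤ s → 0 < φ s)
    (htop : Tendsto (fun R : ℝ => ∫ s in (0 : ℝ)..R, φ s) atTop atTop) (hA : 0 < A)
    (hC : 0 < C) (hM : 0 < M) (hδ : 0 < δ) :
    ∃ (ℓ P₁ : ℝ) (f q q' : ℝ → ℝ), 0 < ℓ ∧ ℓ < δ ∧ f 0 = 0 ∧ f ℓ = M ∧ Continuous q' ∧
      (∀ t, HasDerivAt f (q t) t) ∧ (∀ t, HasDerivAt q (q' t) t) ∧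
      ∀ t ∈ Icc 0 ℓ, p₀ ≤ q t ∧ q t ≤ P₁ ∧
        -q' t * (∫ s in (A * q t)..(A * q t + 1), φ s) = C * q t := by
  set Φ : ℝ → ℝ := fun R => ∫ s in (0 : ℝ)..R, φ s with hΦ
  have hΦc : Continuous Φ := intervalIntegral.continuous_primitive hint 0
  have hΦsub : ∀ x y, ∫ s in x..y, φ s = Φ y - Φ x := fun x y =>
    (intervalIntegral.integral_interval_sub_left (hint _ _) (hint _ _)).symm
  have hΦm : Monotone Φ := fun x y hxy => by
    have := intervalIntegral.integral_nonneg (μ := MeasureTheory.volume) hxy fun s _ => hnn s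
    rw [hΦsub] at this
    linarith
  set F : ℝ → ℝ := fun y => ∫ s in (0 : ℝ)..y, Φ s with hF
  have hFd : ∀ y, HasDerivAt F (Φ y) y := fun y =>
    intervalIntegral.integral_hasDerivAt_right (hΦc.intervalIntegrable _ _)
      (hΦc.stronglyMeasurableAtFilter _ _) hΦc.continuousAt
  have hd : ∀ p, HasDerivAt (fun p => A⁻¹ * (F (A * p + 1) - F (A * p)))
      (∫ s in (A * p)..(A * p + 1), φ s) p := fun p => by
    have h1 : HasDerivAt (fun p => A * p) A p := by simpa using! (hasDerivAt_id p).const_mul A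
    have h2 := (((hFd (A * p + 1)).comp p (h1.add_const 1)).sub ((hFd (A * p)).comp p h1)).const_mul
      A⁻¹
    convert! h2 using 1
    rw [hΦsub]
    field_simp
  have htend : Tendsto (fun p => A⁻¹ * (F (A * p + 1) - F (A * p))) atTop atTop := by
    refine tendsto_atTop_mono (fun p => ?_)
      ((htop.comp (tendsto_id.const_mul_atTop hA)).const_mul_atTop (inv_pos.2 hA))
    refine mul_le_mul_of_nonneg_left ?_ (inv_pos.2 hA).le
    have h1 : F (A * p + 1) - F (A * p) = ∫ s in (A * p)..(A * p + 1), Φ s :=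
      intervalIntegral.integral_interval_sub_left (hΦc.intervalIntegrable _ _)
        (hΦc.intervalIntegrable _ _)
    have h2 : ∫ _ in (A * p)..(A * p + 1), Φ (A * p) ≤ ∫ s in (A * p)..(A * p + 1), Φ s :=
      intervalIntegral.integral_mono_on (by linarith) (by simp) (hΦc.intervalIntegrable _ _)
        fun s hs => hΦm hs.1
    simp only [intervalIntegral.integral_const, add_sub_cancel_left, one_smul] at h2
    simpa [h1] using h2
  -- Besides exceeding `p₀`, the smallest slope must put `A p` beyond `s₁`, where `φ` is positive,
  -- and satisfy `M / P < δ`.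
  set P := max (max p₀ 1) (max (s₁ / A) (M / δ + 1)) with hPdef
  have hP1 : 1 ≤ P := (le_max_right _ _).trans (le_max_left _ _)
  have hP0 : p₀ ≤ P := (le_max_left _ _).trans (le_max_left _ _)
  have hP2 : s₁ / A ≤ P := (le_max_left _ _).trans (le_max_right _ _)
  have hP3 : M / δ + 1 ≤ P := (le_max_right _ _).trans (le_max_right _ _)
  have hP : 0 < P := by linarith
  have hMδ : M / P < δ := by
    rw [div_lt_iff₀ hP]
    rw [div_add_one hδ.ne', div_le_iff₀ hδ] at hP3
    linarith
  have hhc : Continuous fun p => ∫ s in (A * p)..(A * p + 1), φ s := by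
    simp only [hΦsub]
    fun_prop
  obtain ⟨ℓ, P₁, f, q, q', h1, h2, h3, h4, h5, h6, h7, h8⟩ :=
    exists_profile_of_primitive hhc hP (fun p hp => by
      refine intervalIntegral.intervalIntegral_pos_of_pos_on (hint _ _) (fun s hs => ?_)
        (by linarith)
      refine hpos s (le_trans ?_ hs.1.le)
      rw [mul_comm, ← div_le_iff₀ hA]
      exact hP2.trans hp) hd htend hC hM hMδ
  exact ⟨ℓ, P₁, f, q, q', h1, h2, h3, h4, h5, h6, h7,
    fun t ht => ⟨hP0.trans (h8 t ht).1, (h8 t ht).2⟩⟩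

end Profile

/-! ### Barrier profiles from Conditions I and II -/

section Conditions

variable {a g : ℝ → ℝ} {s₀ s₁ : ℝ} {k : ℕ}

/-- Freezing the argument below `s₁` extends the quotient to the whole line, with a numerator that
is still monotone. -/
lemma intervalIntegrable_div_pow_max (hs₀ : 0 < s₀)
    (hg : MonotoneOn g (Ici s₀) ∨ AntitoneOn g (Ici s₀)) (h : s₀ ≤ s₁) (k : ℕ) (x y : ℝ) :
    IntervalIntegrable (fun s => g (max s s₁) / max s s₁ ^ k) MeasureTheory.volume x y := by
  have h1 : ∀ s, max s s₁ ∈ Ici s₀ := fun s => h.trans (le_max_right _ _)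
  have h2 : IntervalIntegrable (fun s => g (max s s₁)) MeasureTheory.volume x y := by
    rcases hg with hg | hg
    · exact Monotone.intervalIntegrable fun s t hst =>
        hg (h1 s) (h1 t) (max_le_max_right s₁ hst)
    · exact Antitone.intervalIntegrable fun s t hst =>
        hg (h1 s) (h1 t) (max_le_max_right s₁ hst)
  have h3 : Continuous fun s : ℝ => (max s s₁ ^ k)⁻¹ :=
    ((continuous_id.max continuous_const).pow k).inv₀
      fun s => pow_ne_zero _ (hs₀.trans_le (h1 s)).ne'
  simpa only [div_eq_mul_inv] using h2.mul_continuousOn h3.continuousOn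

lemma tendsto_integral_div_pow_max (hs₀ : 0 < s₀)
    (hg : MonotoneOn g (Ici s₀) ∨ AntitoneOn g (Ici s₀)) (h : s₀ ≤ s₁)
    (ht : Tendsto (fun R : ℝ => ∫ s in s₀..R, g s / s ^ k) atTop atTop) :
    Tendsto (fun R : ℝ => ∫ s in (0 : ℝ)..R, g (max s s₁) / max s s₁ ^ k) atTop atTop := by
  set φ₀ : ℝ → ℝ := fun s => g (max s s₀) / max s s₀ ^ k
  set φ : ℝ → ℝ := fun s => g (max s s₁) / max s s₁ ^ k
  have hi₀ := intervalIntegrable_div_pow_max hs₀ hg le_rfl k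
  have hi := intervalIntegrable_div_pow_max hs₀ hg h k
  refine (tendsto_atTop_add_const_right _
    ((∫ s in (0 : ℝ)..s₁, φ s) - ∫ s in s₀..s₁, φ₀ s) ht).congr' ?_
  filter_upwards [eventually_ge_atTop s₁] with R hR
  have h1 : ∫ s in s₀..R, g s / s ^ k = ∫ s in s₀..R, φ₀ s :=
    intervalIntegral.integral_congr fun s hs => by
      rw [uIcc_of_le (h.trans hR)] at hs
      simp [φ₀, max_eq_left hs.1]
  have h2 : ∫ s in s₁..R, φ₀ s = ∫ s in s₁..R, φ s :=
    intervalIntegral.integral_congr fun s hs => by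
      rw [uIcc_of_le hR] at hs
      simp [φ₀, φ, max_eq_left hs.1, max_eq_left (h.trans hs.1)]
  have h3 := intervalIntegral.integral_add_adjacent_intervals (hi₀ s₀ s₁) (hi₀ s₁ R)
  have h4 := intervalIntegral.integral_add_adjacent_intervals (hi 0 s₁) (hi s₁ R)
  simp only [h1]
  linarith

lemma exists_pos_of_tendsto_integral (hs₀ : 0 < s₀)
    (hg : MonotoneOn g (Ici s₀) ∨ AntitoneOn g (Ici s₀)) (h : s₀ ≤ s₁)
    (ht : Tendsto (fun R : ℝ => ∫ s in s₀..R, g s / s ^ k) atTop atTop) :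
    ∃ s, s₁ ≤ s ∧ 0 < g s := by
  by_contra! hcon
  obtain ⟨R, h1, h2⟩ := (((tendsto_integral_div_pow_max hs₀ hg h ht).eventually_ge_atTop 1).and
    (eventually_ge_atTop 0)).exists
  have h3 : ∫ s in (0 : ℝ)..R, g (max s s₁) / max s s₁ ^ k ≤ ∫ _ in (0 : ℝ)..R, (0 : ℝ) := by
    refine intervalIntegral.integral_mono_on h2 (intervalIntegrable_div_pow_max hs₀ hg h k _ _)
      (by simp) fun s _ => ?_
    exact div_nonpos_of_nonpos_of_nonneg (hcon _ (le_max_right _ _))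
      (pow_nonneg ((hs₀.le.trans h).trans (le_max_right _ _)) k)
  simp only [intervalIntegral.integral_zero] at h3
  linarith

/-- The barrier profile: `f` is increasing and concave on `[0, ℓ]`, its derivative `q` is large,
and `-q' (1 + b⁻(s)) ≥ C κ(q)` for all `s` within distance `K` of `q`. -/
def HasBarrierProfile (a κ : ℝ → ℝ) : Prop :=
  ∀ C M δ p₀ K : ℝ, 0 < C → 0 < M → 0 < δ →
    ∃ (ℓ P₁ : ℝ) (f q q' : ℝ → ℝ), 0 < ℓ ∧ ℓ < δ ∧ f 0 = 0 ∧ f ℓ = M ∧ Continuous q' ∧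
      (∀ t, HasDerivAt f (q t) t) ∧ (∀ t, HasDerivAt q (q' t) t) ∧
      ∀ t ∈ Icc 0 ℓ, p₀ ≤ q t ∧ q t ≤ P₁ ∧ q' t ≤ 0 ∧
        ∀ s, |s - q t| ≤ K → C * κ (q t) ≤ -q' t * (1 + min (bFun a s) 0)

/-- Solve `-q' I(q) = c C q` with `I` the averaged `φ`, multiply `hcomp` by `-q'` and cancel `c q`.
-/
lemma hasBarrierProfile_of_integral {φ κ : ℝ → ℝ} {A c : ℝ}
    (hint : ∀ x y, IntervalIntegrable φ MeasureTheory.volume x y) (hpos : ∀ s, 0 < φ s)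
    (htop : Tendsto (fun R : ℝ => ∫ s in (0 : ℝ)..R, φ s) atTop atTop) (hA : 0 < A) (hc : 0 < c)
    (hcomp : ∀ K : ℝ, ∃ p₀, ∀ p s, p₀ ≤ p → |s - p| ≤ K →
      κ p * (∫ s in (A * p)..(A * p + 1), φ s) ≤ c * p * (1 + min (bFun a s) 0)) :
    HasBarrierProfile a κ := by
  intro C M δ p₀ K hC hM hδ
  obtain ⟨p₁, hp₁⟩ := hcomp K
  obtain ⟨ℓ, P₁, f, q, q', h1, h2, h3, h4, h5, h6, h7, h8⟩ :=
    exists_profile_of_integral (p₀ := max (max p₀ 1) p₁) (s₁ := 0) hint (fun s => (hpos s).le)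
      (fun s _ => hpos s) htop hA (mul_pos hc hC) hM hδ
  refine ⟨ℓ, P₁, f, q, q', h1, h2, h3, h4, h5, h6, h7, fun t ht => ?_⟩
  obtain ⟨h9, h10, h11⟩ := h8 t ht
  have hq1 : 1 ≤ q t := ((le_max_right _ _).trans (le_max_left _ _)).trans h9
  have hq0 : 0 < q t := by linarith
  set I := ∫ s in (A * q t)..(A * q t + 1), φ s
  have hI : 0 < I := intervalIntegral.intervalIntegral_pos_of_pos_on (hint _ _)
    (fun s _ => hpos s) (by linarith)
  have hq' : 0 < -q' t := pos_of_mul_pos_left (h11 ▸ by positivity) hI.le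
  refine ⟨((le_max_left _ _).trans (le_max_left _ _)).trans h9, h10, by linarith, fun s hs => ?_⟩
  have h12 := hp₁ (q t) s ((le_max_right _ _).trans h9) hs
  have h13 := mul_le_mul_of_nonneg_left h12 hq'.le
  have h14 : -q' t * (κ (q t) * I) = c * q t * (C * κ (q t)) := by
    linear_combination κ (q t) * h11
  have h15 : -q' t * (c * q t * (1 + min (bFun a s) 0)) =
      c * q t * (-q' t * (1 + min (bFun a s) 0)) := by ring
  rw [h14, h15] at h13
  exact le_of_mul_le_mul_left h13 (by positivity)

lemma integral_unit_le {φ : ℝ → ℝ} {x B : ℝ}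
    (hint : IntervalIntegrable φ MeasureTheory.volume x (x + 1))
    (h : ∀ s ∈ Icc x (x + 1), φ s ≤ B) : ∫ s in x..(x + 1), φ s ≤ B := by
  have h2 : ∫ s in x..(x + 1), φ s ≤ ∫ _ in x..(x + 1), B :=
    intervalIntegral.integral_mono_on (by linarith) hint (by simp) h
  simpa using h2

/-- As `g` is non-decreasing, the average is taken to the left of `p`: on `[p/4, p/4 + 1]` it is at
most `g(p/2) / (p/4)²`, and `g(p/2) ≤ g(s)` because `p/2 ≤ s`. With `s ≤ 2p` the constant is `(2p)²
/ (p/4)² = 64`. -/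
lemma ConditionI.hasBarrierProfile (h : ConditionI a) : HasBarrierProfile a id := by
  obtain ⟨s₀, g, hs₀, hb, hg, ht⟩ := h
  obtain ⟨s₁, hs₁, hgs⟩ := exists_pos_of_tendsto_integral hs₀ (.inl hg) le_rfl ht
  have hs₁0 : 0 < s₁ := hs₀.trans_le hs₁
  have hpos : ∀ s, s₁ ≤ s → 0 < g s := fun s hs => hgs.trans_le (hg hs₁ (hs₁.trans hs) hs)
  refine hasBarrierProfile_of_integral
    (φ := fun s => g (max s s₁) / max s s₁ ^ 2) (A := 1 / 4) (c := 64)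
    (intervalIntegrable_div_pow_max hs₀ (.inl hg) hs₁ 2)
    (fun s => div_pos (hpos _ (le_max_right _ _)) (pow_pos (hs₁0.trans_le (le_max_right _ _)) 2))
    (tendsto_integral_div_pow_max hs₀ (.inl hg) hs₁ ht) (by norm_num) (by norm_num)
    fun K => ⟨max (max (2 * K) 4) (4 * s₁), fun p s hp hs => ?_⟩
  have hp1 : 2 * K ≤ p := ((le_max_left _ _).trans (le_max_left _ _)).trans hp
  have hp2 : 4 ≤ p := ((le_max_right _ _).trans (le_max_left _ _)).trans hp
  have hp3 : 4 * s₁ ≤ p := (le_max_right _ _).trans hp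
  have hs' := abs_le.1 hs
  have hgp := hpos (p / 2) (by linarith)
  have h1 : ∫ s in (1 / 4 * p)..(1 / 4 * p + 1), g (max s s₁) / max s s₁ ^ 2 ≤
      g (p / 2) / (p / 4) ^ 2 := by
    refine integral_unit_le (intervalIntegrable_div_pow_max hs₀ (.inl hg) hs₁ 2 _ _) fun r hr => ?_
    have hr1 : s₁ ≤ r := by linarith [hr.1]
    rw [max_eq_left hr1]
    exact div_le_div₀ hgp.le (hg (hs₁.trans hr1) (show s₀ ≤ p / 2 by linarith)
      (by linarith [hr.2])) (by positivity) (pow_le_pow_left₀ (by linarith) (by linarith [hr.1]) 2)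
  have h2 : g (p / 2) ≤ (1 + min (bFun a s) 0) * s ^ 2 :=
    (hg (show s₀ ≤ p / 2 by linarith) (show s₀ ≤ s by linarith) (by linarith)).trans
      (hb s (by linarith))
  have hs0 : 0 < s := by linarith
  have hB : 0 < 1 + min (bFun a s) 0 := pos_of_mul_pos_left (hgp.trans_le h2) (by positivity)
  have h3 : g (p / 2) ≤ (1 + min (bFun a s) 0) * (2 * p) ^ 2 :=
    h2.trans (mul_le_mul_of_nonneg_left (pow_le_pow_left₀ hs0.le (by linarith) 2) hB.le)
  have h4 : g (p / 2) / (p / 4) ^ 2 ≤ 64 * (1 + min (bFun a s) 0) := by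
    rw [div_le_iff₀ (by positivity)]
    linarith
  calc id p * _ ≤ p * (64 * (1 + min (bFun a s) 0)) :=
        mul_le_mul_of_nonneg_left (h1.trans h4) (show (0 : ℝ) ≤ p by linarith)
    _ = _ := by ring

/-- As `g` is non-increasing, the average is taken to the right: on `[2p, 2p + 1]` it is at most
`g(2p) / (2p)`, and `g(2p) ≤ g(s)` because `s ≤ 2p`. The divergent integral forces `g > 0` on its
whole domain. -/
lemma ConditionII.hasBarrierProfile (h : ConditionII a) : HasBarrierProfile a fun _ => 1 := by
  obtain ⟨s₀, g, hs₀, hb, hg, ht⟩ := h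
  have ht : Tendsto (fun R : ℝ => ∫ s in s₀..R, g s / s ^ 1) atTop atTop := by
    simpa only [pow_one] using ht
  have hpos : ∀ s, s₀ ≤ s → 0 < g s := fun s hs => by
    obtain ⟨r, hr, hgr⟩ := exists_pos_of_tendsto_integral hs₀ (.inr hg) hs ht
    exact hgr.trans_le (hg hs (hs.trans hr) hr)
  refine hasBarrierProfile_of_integral
    (φ := fun s => g (max s s₀) / max s s₀ ^ 1) (A := 2) (c := 2)
    (intervalIntegrable_div_pow_max hs₀ (.inr hg) le_rfl 1)
    (fun s => div_pos (hpos _ (le_max_right _ _)) (pow_pos (hs₀.trans_le (le_max_right _ _)) 1))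
    (tendsto_integral_div_pow_max hs₀ (.inr hg) le_rfl ht) (by norm_num) (by norm_num)
    fun K => ⟨max (max (2 * K) 1) (2 * s₀), fun p s hp hs => ?_⟩
  have hp1 : 2 * K ≤ p := ((le_max_left _ _).trans (le_max_left _ _)).trans hp
  have hp2 : 1 ≤ p := ((le_max_right _ _).trans (le_max_left _ _)).trans hp
  have hp3 : 2 * s₀ ≤ p := (le_max_right _ _).trans hp
  have hs' := abs_le.1 hs
  have hgp := hpos (2 * p) (by linarith)
  have h1 : ∫ s in (2 * p)..(2 * p + 1), g (max s s₀) / max s s₀ ^ 1 ≤ g (2 * p) / (2 * p) := by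
    refine integral_unit_le (intervalIntegrable_div_pow_max hs₀ (.inr hg) le_rfl 1 _ _)
      fun r hr => ?_
    have hr1 : s₀ ≤ r := by linarith [hr.1]
    rw [max_eq_left hr1, pow_one]
    exact div_le_div₀ hgp.le (hg (show s₀ ≤ 2 * p by linarith) hr1 hr.1) (by positivity) hr.1
  have hs0 : 0 < s := by linarith
  have h2 : g (2 * p) ≤ (1 + min (bFun a s) 0) * s ^ 2 :=
    (hg (show s₀ ≤ s by linarith) (show s₀ ≤ 2 * p by linarith) (by linarith)).trans
      (hb s (by linarith))
  have hB : 0 < 1 + min (bFun a s) 0 := pos_of_mul_pos_left (hgp.trans_le h2) (by positivity)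
  have h3 : g (2 * p) ≤ (1 + min (bFun a s) 0) * (2 * p) ^ 2 :=
    h2.trans (mul_le_mul_of_nonneg_left (pow_le_pow_left₀ hs0.le (by linarith) 2) hB.le)
  have h4 : g (2 * p) / (2 * p) ≤ 2 * p * (1 + min (bFun a s) 0) := by
    rw [div_le_iff₀ (by positivity)]
    linarith
  simpa using h1.trans h4

end Conditions

lemma continuousAt_norm_bilin {E N : Type*} [NormedAddCommGroup E] [NormedSpace ℝ E]
    [TopologicalSpace N] {G : N → E →L[ℝ] E →L[ℝ] ℝ} {x : N} (h : ContinuousAt G x) :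
    ContinuousAt (fun y => ‖G y‖) x :=
  (@continuous_norm (E →L[ℝ] E →L[ℝ] ℝ) (ContinuousLinearMap.toNormedAddCommGroup
    ).toSeminormedAddCommGroup.toSeminormedAddGroup).continuousAt.comp h

/-! ### Local bounds for covariant derivatives of `C¹` fields -/

section LocalBounds

variable {E : Type*} [NormedAddCommGroup E] [NormedSpace ℝ E] [FiniteDimensional ℝ E]
  {N : Type*} [TopologicalSpace N] [ChartedSpace E N]
  [IsManifold 𝓘(ℝ, E) ∞ N] [RiemannianBundle (fun x : N => TangentSpace 𝓘(ℝ, E) x)]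
  [IsContMDiffRiemannianBundle 𝓘(ℝ, E) ∞ E (fun x : N => TangentSpace 𝓘(ℝ, E) x)]

variable {X V W : ∀ x : N, TangentSpace 𝓘(ℝ, E) x} {x : N}

/-- `X` is a vector field of class `C¹` at `x`. -/
abbrev C1Field (X : ∀ x : N, TangentSpace 𝓘(ℝ, E) x) (x : N) : Prop :=
  ContMDiffAt 𝓘(ℝ, E) 𝓘(ℝ, E).tangent 1 (fieldSection X) x

lemma tangentSymm_trivializationAt {y : N}
    (hy : y ∈ (trivializationAt E (TangentSpace 𝓘(ℝ, E)) x).baseSet)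
    (v : TangentSpace 𝓘(ℝ, E) y) :
    tangentSymm x y (trivializationAt E (TangentSpace 𝓘(ℝ, E)) x ⟨y, v⟩).2 = v := by
  set t := trivializationAt E (TangentSpace 𝓘(ℝ, E)) x
  have h4 : (t ⟨y, v⟩).2 = t.continuousLinearMapAt ℝ y v := by
    rw [t.continuousLinearMapAt_apply (R := ℝ), t.linearMapAt_apply (R := ℝ), if_pos hy]
  rw [h4]
  exact Trivialization.symmL_continuousLinearMapAt (R := ℝ) t hy v

lemma baseSet_mem_nhds (x : N) :
    (trivializationAt E (TangentSpace 𝓘(ℝ, E)) x).baseSet ∈ 𝓝 x :=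
  (trivializationAt E (TangentSpace 𝓘(ℝ, E)) x).open_baseSet.mem_nhds
    (FiberBundle.mem_baseSet_trivializationAt' x)

lemma continuousAt_mvfderiv_field {g : N → ℝ} (hg : ContMDiffAt 𝓘(ℝ, E) 𝓘(ℝ, ℝ) 1 g x)
    (hV : C1Field V x) : ContinuousAt (fun y => mvfderiv 𝓘(ℝ, E) g y (V y)) x := by
  have h1 : ContMDiffAt 𝓘(ℝ, E) 𝓘(ℝ, E →L[ℝ] ℝ) 0
      (fun y => (mvfderiv 𝓘(ℝ, E) g y).comp (tangentSymm x y)) x := by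
    have h := hg.mfderiv_const (m := 0) (by norm_num)
    refine h.congr_of_eventuallyEq (Eventually.of_forall fun y => ?_)
    ext e
    simp [inTangentCoordinates, ContinuousLinearMap.inCoordinates, mvfderiv, tangentSymm]
    rfl
  have h2 := ((contMDiffAt_section _).1 hV).continuousAt
  refine (ContinuousAt.clm_apply h1.continuousAt h2).congr ?_
  filter_upwards [baseSet_mem_nhds (E := E) x] with y hy
  rw [ContinuousLinearMap.comp_apply, tangentSymm_trivializationAt (E := E) hy]

lemma continuousAt_inner_field
    (hX : ContMDiffAt 𝓘(ℝ, E) 𝓘(ℝ, E).tangent 0 (fieldSection X) x)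
    (hV : ContMDiffAt 𝓘(ℝ, E) 𝓘(ℝ, E).tangent 0 (fieldSection V) x) :
    ContinuousAt (fun y => inner ℝ (X y) (V y)) x := by
  have h : ContMDiffAt 𝓘(ℝ, E) 𝓘(ℝ, ℝ) 0 (fun y => inner ℝ (X y) (V y)) x :=
    ContMDiffAt.inner_bundle hX hV
  exact h.continuousAt

lemma continuousAt_koszulField (hX : C1Field X x) (hV : C1Field V x) (hW : C1Field W x) :
    ContinuousAt (koszulField X V W) x := by
  have : CompleteSpace E := FiniteDimensional.complete ℝ E
  have hbr : ∀ {Y Z T : ∀ x : N, TangentSpace 𝓘(ℝ, E) x}, C1Field Y x → C1Field Z x →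
      C1Field T x →
      ContinuousAt (fun y => inner ℝ (VectorField.mlieBracket 𝓘(ℝ, E) Y Z y) (T y)) x := by
    intro Y Z T hY hZ hT
    have : IsManifold 𝓘(ℝ, E) (((1 : ℕ∞) : WithTop ℕ∞) + 1) N :=
      IsManifold.of_le (n := ∞) (by norm_cast)
    have : IsManifold 𝓘(ℝ, E) (minSmoothness ℝ 2) N := by
      rw [minSmoothness_of_isRCLikeNormedField]
      infer_instance
    have h : ContMDiffAt 𝓘(ℝ, E) 𝓘(ℝ, E).tangent 0
        (fieldSection (VectorField.mlieBracket 𝓘(ℝ, E) Y Z)) x :=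
      ContMDiffAt.mlieBracket_vectorField (m := 0) (n := 1) hY hZ (by simp)
    exact continuousAt_inner_field h (ContMDiffAt.of_le hT zero_le_one)
  refine ContinuousAt.div_const ?_ 2
  exact ((((continuousAt_mvfderiv_field (contMDiffAt_inner_field hX hW) hV).add
    (continuousAt_mvfderiv_field (contMDiffAt_inner_field hV hW) hX)).sub
    (continuousAt_mvfderiv_field (contMDiffAt_inner_field hV hX) hW)).add (hbr hV hX hW)).sub
    (hbr hV hW hX) |>.sub (hbr hX hW hV)

lemma continuousAt_clm_of_apply {F : Type*} [NormedAddCommGroup F] [NormedSpace ℝ F]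
    {G : N → E →L[ℝ] F} (h : ∀ e : E, ContinuousAt (fun y => G y e) x) : ContinuousAt G x := by
  let b := Module.finBasis ℝ E
  have hG : G = fun y => ∑ i, ContinuousLinearMap.smulRightL ℝ E F
      (LinearMap.toContinuousLinearMap (b.coord i)) (G y (b i)) := by
    funext y
    ext e
    conv_lhs => rw [← b.sum_repr e, map_sum]
    simp
  rw [hG]
  exact tendsto_finsetSum _ fun i _ =>
    (ContinuousLinearMap.continuous _).continuousAt.comp (h (b i))

/-- A field along the trivialization at `x`. -/
abbrev frameField (x : N) (e : E) : ∀ y : N, TangentSpace 𝓘(ℝ, E) y := fun y => tangentSymm x y e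

lemma c1Field_frameField (x : N) (e : E) : C1Field (frameField x e) x :=
  (contMDiffAt_tangentSymm x e).of_le (by simp)

lemma eventually_koszul_frameField (hX : C1Field X x) (e e' : E) :
    ∀ᶠ y in 𝓝 x, koszul X y (frameField x e y) (frameField x e' y) =
      koszulField X (frameField x e) (frameField x e') y := by
  have hC : ∀ {Y : ∀ x : N, TangentSpace 𝓘(ℝ, E) x}, C1Field Y x → ∀ᶠ y in 𝓝 x, DiffField Y y := by
    intro Y hY
    filter_upwards [(contMDiffAt_iff_contMDiffAt_nhds (by simp)).1 hY] with y hy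
    exact hy.mdifferentiableAt one_ne_zero
  filter_upwards [hC hX, hC (c1Field_frameField x e), hC (c1Field_frameField x e')] with y h1 h2 h3
  exact koszul_apply_field h1 h2 h3

open Classical in
/-- The Levi-Civita derivative of `X` in the trivialization at `x`. -/
def koszulCoord (X : ∀ x : N, TangentSpace 𝓘(ℝ, E) x) (x y : N) : E →L[ℝ] E →L[ℝ] ℝ :=
  if h : DiffField X y then (koszulForm X y h).bilinearComp (tangentSymm x y) (tangentSymm x y)
  else 0

lemma koszulCoord_apply {y : N} (h : DiffField X y) (e e' : E) :
    koszulCoord X x y e e' = koszul X y (tangentSymm x y e) (tangentSymm x y e') := by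
  simp only [koszulCoord, dif_pos h, ContinuousLinearMap.bilinearComp_apply, koszulForm_apply]

/-- In the frame at `x` the covariant derivative has continuous coefficients, and the trivialization
distorts norms by a locally bounded factor. Applied to a gradient, this gives the uniform Hessian
bound near a point needed for the Hopf barrier. -/
lemma eventually_abs_koszul_le (hX : C1Field X x) :
    ∃ C, 0 ≤ C ∧ ∀ᶠ y in 𝓝 x, ∀ v, |koszul X y v v| ≤ C * ‖v‖ ^ 2 := by
  have hev : ∀ᶠ y in 𝓝 x, DiffField X y := by
    filter_upwards [(contMDiffAt_iff_contMDiffAt_nhds (by simp)).1 hX] with y hy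
    exact hy.mdifferentiableAt one_ne_zero
  have hGc : ContinuousAt (koszulCoord X x) x := by
    refine continuousAt_clm_of_apply fun e => continuousAt_clm_of_apply fun e' => ?_
    refine (continuousAt_koszulField hX (c1Field_frameField x e) (c1Field_frameField x e')).congr ?_
    filter_upwards [hev, eventually_koszul_frameField hX e e'] with y h1 h2
    rw [koszulCoord_apply h1, ← h2]
  have hGn : ContinuousAt (fun y => ‖koszulCoord X x y‖) x :=
    continuousAt_norm_bilin hGc
  have : IsContinuousRiemannianBundle E (fun y : N => TangentSpace 𝓘(ℝ, E) y) := by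
    obtain ⟨g, hg, hg'⟩ := IsContMDiffRiemannianBundle.exists_contMDiff (IB := 𝓘(ℝ, E)) (n := ∞)
      (F := E) (E := fun y : N => TangentSpace 𝓘(ℝ, E) y)
    exact ⟨g, hg.continuous, hg'⟩
  obtain ⟨C, hC, hCe⟩ := eventually_norm_trivializationAt_lt E
    (fun y : N => TangentSpace 𝓘(ℝ, E) y) x
  refine ⟨(‖koszulCoord X x x‖ + 1) * C ^ 2, by positivity, ?_⟩
  filter_upwards [hev, hCe, baseSet_mem_nhds (E := E) x,
    hGn.eventually_lt_const (lt_add_one ‖koszulCoord X x x‖)] with y h1 h2 h3 h4 v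
  set t := trivializationAt E (TangentSpace 𝓘(ℝ, E)) x
  set e := t.continuousLinearMapAt ℝ y v
  have he : tangentSymm x y e = v := Trivialization.symmL_continuousLinearMapAt (R := ℝ) t h3 v
  have he' : ‖e‖ ≤ C * ‖v‖ := ((t.continuousLinearMapAt ℝ y).le_opNorm v).trans
    (mul_le_mul_of_nonneg_right h2.le (norm_nonneg v))
  have h5 := (koszulCoord X x y).le_opNorm₂ e e
  rw [koszulCoord_apply h1, he, Real.norm_eq_abs] at h5
  calc |koszul X y v v| ≤ ‖koszulCoord X x y‖ * ‖e‖ * ‖e‖ := h5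
    _ ≤ (‖koszulCoord X x x‖ + 1) * (C * ‖v‖) * (C * ‖v‖) := by gcongr
    _ = _ := by ring

end LocalBounds

/-! ### Consequences of the structural conditions on `a` -/

section RegularOperator

variable {a : ℝ → ℝ}

lemma bFun_eq {A : ℝ → ℝ} (hA : ContDiffOn ℝ 2 A (Ici 0)) (hpos : ∀ s, 0 ≤ s → 0 < A s)
    (haA : ∀ s, 0 ≤ s → a s = s * A s) {s : ℝ} (hs : 0 < s) :
    HasDerivAt A (derivWithin A (Ici 0) s) s ∧
      bFun a s = s * derivWithin A (Ici 0) s / A s := by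
  have hnhds : Ici (0 : ℝ) ∈ 𝓝 s := Ici_mem_nhds hs
  have hd : HasDerivAt A (deriv A s) s :=
    ((hA.contDiffAt hnhds).differentiableAt (by norm_num)).hasDerivAt
  have hAs := hpos s hs.le
  have had : HasDerivAt a (A s + s * deriv A s) s := by
    have h1 : HasDerivAt (fun s => s * A s) (A s + s * deriv A s) s := by
      simpa using! (hasDerivAt_id s).mul hd
    refine h1.congr_of_eventuallyEq ?_
    filter_upwards [hnhds] with t ht using haA t ht
  rw [derivWithin_of_mem_nhds hnhds]
  refine ⟨hd, ?_⟩
  rw [bFun, had.deriv, haA s hs.le]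
  field_simp
  ring

lemma IsRegularOperator.hasDerivAt (ha : IsRegularOperator a) {s : ℝ} (hs : 0 < s) :
    HasDerivAt (fun s => a s / s) (a s / s / s * bFun a s) s ∧ 0 < a s / s ∧
      0 < 1 + bFun a s := by
  obtain ⟨A, hA, hpos, haA, hb⟩ := ha
  obtain ⟨hd, hbs⟩ := bFun_eq hA hpos haA hs
  have hAs := hpos s hs.le
  have hsA : a s / s = A s := by
    rw [haA s hs.le]
    field_simp
  refine ⟨?_, by rwa [hsA], ?_⟩
  · have h1 : a s / s / s * bFun a s = derivWithin A (Ici 0) s := by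
      rw [hbs, hsA]
      field_simp
    rw [h1]
    refine hd.congr_of_eventuallyEq ?_
    filter_upwards [Ioi_mem_nhds hs] with t ht
    have ht0 : t ≠ 0 := ne_of_gt ht
    rw [haA t (le_of_lt ht)]
    field_simp
  · have := hb s hs.le
    rwa [← hbs] at this

/-- For `s > 0` one has `b(s) = s A'(s) / A(s)`, which tends to `0` with `s` because `A` is `C¹` up
to `0`. Thus for small gradients the equation is uniformly elliptic. -/
lemma IsRegularOperator.exists_abs_bFun_le (ha : IsRegularOperator a) :
    ∃ s₀ > 0, ∀ s, 0 < s → s < s₀ → |bFun a s| ≤ 1 / 2 := by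
  obtain ⟨A, hA, hpos, haA, hb⟩ := ha
  have hc : ContinuousWithinAt (fun s => s * derivWithin A (Ici 0) s / A s) (Ici 0) 0 := by
    have h1 := (hA.continuousOn_derivWithin (uniqueDiffOn_Ici 0) (by norm_num)) 0
      (mem_Ici.2 le_rfl)
    exact (continuousWithinAt_id.mul h1).div (hA.continuousOn 0 (mem_Ici.2 le_rfl))
      (hpos 0 le_rfl).ne'
  obtain ⟨s₀, hs₀, h3⟩ := (Metric.continuousWithinAt_iff.1 hc) (1 / 2) (by norm_num)
  refine ⟨s₀, hs₀, fun s hs hlt => ?_⟩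
  have h4 := h3 (mem_Ici.2 hs.le) (by rw [Real.dist_eq, sub_zero, abs_of_pos hs]; exact hlt)
  rw [← (bFun_eq hA hpos haA hs).2, Real.dist_eq] at h4
  simpa using h4.le

end RegularOperator

/-! ### The non-divergence form and comparison at contact points -/

section Touching

variable {E : Type*} [NormedAddCommGroup E] [NormedSpace ℝ E] [FiniteDimensional ℝ E]
  {N : Type*} [TopologicalSpace N] [ChartedSpace E N]
  [IsManifold 𝓘(ℝ, E) ∞ N] [RiemannianBundle (fun x : N => TangentSpace 𝓘(ℝ, E) x)]
  [IsContMDiffRiemannianBundle 𝓘(ℝ, E) ∞ E (fun x : N => TangentSpace 𝓘(ℝ, E) x)]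

variable {a : ℝ → ℝ} {u w : N → ℝ} {x : N}

lemma IsC2At.neg (hu : IsC2At (E := E) u x) : IsC2At (E := E) (fun y => -u y) x :=
  ContMDiffAt.neg hu

lemma rGrad_neg (hu : MDifferentiableAt 𝓘(ℝ, E) 𝓘(ℝ, ℝ) u x) :
    rGrad E (fun y => -u y) x = -rGrad E u x := by
  rw [rGrad_comp hu (hasDerivAt_neg _), neg_one_smul]

lemma rHess_neg (hu : IsC2At (E := E) u x) (v v' : TangentSpace 𝓘(ℝ, E) x) :
    rHess (fun y => -u y) x v v' = -rHess u x v v' := by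
  rw [rHess_comp (F := fun t => -t) (F' := fun _ => -1) (F'' := 0) hu contDiff_neg.contDiffAt
    (Eventually.of_forall fun t => hasDerivAt_neg t) (hasDerivAt_const _ _)]
  ring

variable (E) in
/-- The Laplacian. -/
def lapl (u : N → ℝ) (x : N) : ℝ :=
  ∑ i, rHess u x (stdOrthonormalBasis ℝ (TangentSpace 𝓘(ℝ, E) x) i)
    (stdOrthonormalBasis ℝ (TangentSpace 𝓘(ℝ, E) x) i)

/-- The non-divergence form of the equation at a regular point. -/
def reducedOperator (a : ℝ → ℝ) (J : ∀ x : N, TangentSpace 𝓘(ℝ, E) x) (w : N → ℝ) (x : N) : ℝ :=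
  lapl E w x + bFun a ‖rGrad E w x‖ / ‖rGrad E w x‖ ^ 2 * rHess w x (rGrad E w x) (rGrad E w x) -
    inner ℝ (rGrad E w x) (J x)

lemma reducedOperator_eq_zero (ha : IsRegularOperator a) {J : ∀ x : N, TangentSpace 𝓘(ℝ, E) x}
    (hu : IsC2At (E := E) u x) (h0 : rGrad E u x ≠ 0)
    (heq : rDiv (fun y : N => (a ‖rGrad E u y‖ / ‖rGrad E u y‖) • rGrad E u y) x
      - a ‖rGrad E u x‖ / ‖rGrad E u x‖ * inner ℝ (rGrad E u x) (J x) = 0) :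
    reducedOperator a J u x = 0 := by
  have hs : 0 < ‖rGrad E u x‖ := norm_pos_iff.2 h0
  obtain ⟨hd, hpos, -⟩ := ha.hasDerivAt hs
  rw [rDiv_quasilinear (α := fun s => a s / s) hu h0 hd, rDiv_rGrad hu] at heq
  rw [reducedOperator, lapl]
  refine (mul_eq_zero.1 (?_ : a ‖rGrad E u x‖ / ‖rGrad E u x‖ * _ = 0)).resolve_left hpos.ne'
  rw [← heq]
  field_simp

/-- A function touching a solution from above is a subsolution at the contact point. -/
lemma reducedOperator_nonneg_of_touching (ha : IsRegularOperator a)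
    {J : ∀ x : N, TangentSpace 𝓘(ℝ, E) x} (hu : IsC2At (E := E) u x)
    (hw : IsC2At (E := E) w x) (hmax : IsLocalMax (fun y => u y - w y) x)
    (h0 : rGrad E w x ≠ 0)
    (heq : rGrad E u x ≠ 0 → reducedOperator a J u x = 0) :
    0 ≤ reducedOperator a J w x := by
  have hfun : (fun y => u y - w y) = u + fun y => -w y := by
    funext y
    exact sub_eq_add_neg _ _
  have hC : IsC2At (E := E) (fun y => u y - w y) x := by
    rw [hfun]
    exact ContMDiffAt.add hu hw.neg
  have hgrad : rGrad E u x = rGrad E w x := by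
    have h1 := rGrad_eq_zero_of_isLocalMax hC hmax
    rw [hfun, rGrad_add hu.mdiff hw.neg.mdiff, rGrad_neg hw.mdiff] at h1
    exact add_neg_eq_zero.1 h1
  have hH : ∀ v v', hessForm hC v v' = rHess u x v v' - rHess w x v v' := by
    intro v v'
    rw [hessForm_apply]
    conv_lhs => rw [hfun]
    rw [rHess_add hu hw.neg, rHess_neg hw, sub_eq_add_neg]
  have hnn : ∀ v, 0 ≤ (-hessForm hC) v v := by
    intro v
    have := rHess_nonpos_of_isLocalMax hC hmax v
    rw [← hessForm_apply hC] at this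
    simpa using this
  have hz := heq (hgrad ▸ h0)
  simp only [reducedOperator, hgrad] at hz ⊢
  set p := rGrad E w x with hp
  set e := stdOrthonormalBasis ℝ (TangentSpace 𝓘(ℝ, E) x) with he
  have hs : 0 < ‖p‖ := norm_pos_iff.2 h0
  obtain ⟨-, -, hb⟩ := ha.hasDerivAt hs
  set b := bFun a ‖p‖
  have hη : ‖‖p‖⁻¹ • p‖ = 1 := by
    rw [norm_smul, norm_inv, norm_norm, inv_mul_cancel₀ hs.ne']
  have h1 := le_sum_diag_of_nonneg hnn e hη
  have h2 : (-hessForm hC) (‖p‖⁻¹ • p) (‖p‖⁻¹ • p) = (rHess w x p p - rHess u x p p) / ‖p‖ ^ 2 := by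
    simp only [map_smul, neg_apply, smul_apply, smul_eq_mul, hH]
    field_simp
    ring
  have h3 : ∑ i, (-hessForm hC) (e i) (e i) = lapl E w x - lapl E u x := by
    simp only [neg_apply, hH, lapl, ← Finset.sum_sub_distrib]
    exact Finset.sum_congr rfl fun i _ => by ring
  have h4 := hnn (‖p‖⁻¹ • p)
  rw [h2] at h1 h4
  rw [h3] at h1
  set B := (rHess w x p p - rHess u x p p) / ‖p‖ ^ 2 with hB
  have h5 : b / ‖p‖ ^ 2 * rHess w x p p - b / ‖p‖ ^ 2 * rHess u x p p = b * B := by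
    rw [hB]
    ring
  -- The trace of the Hessian of `w - u` is at least its value `B ≥ 0` in the gradient direction, so
  -- the difference of the operators is at least `(1 + b) B ≥ 0`.
  nlinarith [mul_nonneg hb.le h4]

lemma reducedOperator_neg {J : ∀ x : N, TangentSpace 𝓘(ℝ, E) x} (hu : IsC2At (E := E) u x) :
    reducedOperator a J (fun y => -u y) x = -reducedOperator a J u x := by
  have h1 : rHess u x (-rGrad E u x) (-rGrad E u x) = rHess u x (rGrad E u x) (rGrad E u x) := by
    simp only [← hessForm_apply hu, map_neg, neg_apply, neg_neg]
  have h2 : lapl E (fun y => -u y) x = -lapl E u x := by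
    simp only [lapl, rHess_neg hu, Finset.sum_neg_distrib]
  rw [reducedOperator, reducedOperator, rGrad_neg hu.mdiff, rHess_neg hu, norm_neg, h1, h2,
    inner_neg_left]
  ring

/-- `u` solves the equation in non-divergence form at its regular points in `Λ`. -/
def SolvesAtRegularPoints (a : ℝ → ℝ) (J : ∀ x : N, TangentSpace 𝓘(ℝ, E) x) (Λ : Set N)
    (u : N → ℝ) : Prop :=
  ∀ x ∈ Λ, rGrad E u x ≠ 0 → reducedOperator a J u x = 0

lemma SolvesReducedEquation.solvesAtRegularPoints (ha : IsRegularOperator a)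
    {J : ∀ x : N, TangentSpace 𝓘(ℝ, E) x} {Λ : Set N} (hu : ∀ x ∈ Λ, IsC2At (E := E) u x)
    (heq : SolvesReducedEquation E a J Λ u) : SolvesAtRegularPoints a J Λ u :=
  fun x hx h0 => reducedOperator_eq_zero ha (hu x hx) h0 (heq x hx)

lemma SolvesAtRegularPoints.neg {J : ∀ x : N, TangentSpace 𝓘(ℝ, E) x} {Λ : Set N}
    (hu : ∀ x ∈ Λ, IsC2At (E := E) u x) (heq : SolvesAtRegularPoints a J Λ u) :
    SolvesAtRegularPoints a J Λ fun y => -u y := by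
  intro x hx h0
  rw [rGrad_neg (hu x hx).mdiff] at h0
  rw [reducedOperator_neg (hu x hx), heq x hx (neg_ne_zero.1 h0), neg_zero]

end Touching

/-! ### The operator on functions of one function -/

section Comp

variable {E : Type*} [NormedAddCommGroup E] [NormedSpace ℝ E] [FiniteDimensional ℝ E]
  {N : Type*} [TopologicalSpace N] [ChartedSpace E N]
  [IsManifold 𝓘(ℝ, E) ∞ N] [RiemannianBundle (fun x : N => TangentSpace 𝓘(ℝ, E) x)]
  [IsContMDiffRiemannianBundle 𝓘(ℝ, E) ∞ E (fun x : N => TangentSpace 𝓘(ℝ, E) x)]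

variable {a : ℝ → ℝ} {h u : N → ℝ} {x : N}

lemma sum_sq_mvfderiv (h : N → ℝ) (x : N) :
    ∑ i, mvfderiv 𝓘(ℝ, E) h x (stdOrthonormalBasis ℝ (TangentSpace 𝓘(ℝ, E) x) i) ^ 2 =
      ‖rGrad E h x‖ ^ 2 := by
  simp only [← inner_rGrad]
  exact (stdOrthonormalBasis ℝ (TangentSpace 𝓘(ℝ, E) x)).sum_sq_inner_left (rGrad E h x)

lemma lapl_comp {F F' : ℝ → ℝ} {F'' : ℝ} (hh : IsC2At (E := E) h x)
    (hFC : ContDiffAt ℝ 2 F (h x))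
    (hF : ∀ᶠ t in 𝓝 (h x), HasDerivAt F (F' t) t) (hF' : HasDerivAt F' F'' (h x)) :
    lapl E (fun y => F (h y)) x = F' (h x) * lapl E h x + F'' * ‖rGrad E h x‖ ^ 2 := by
  simp only [lapl, rHess_comp hh hFC hF hF', ← sum_sq_mvfderiv, Finset.sum_add_distrib,
    Finset.mul_sum]
  congr 1
  exact Finset.sum_congr rfl fun i _ => by ring

lemma abs_lapl_le {C : ℝ}
    (hC : ∀ v : TangentSpace 𝓘(ℝ, E) x, |rHess h x v v| ≤ C * ‖v‖ ^ 2) :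
    |lapl E h x| ≤ Module.finrank ℝ E * C := by
  refine (Finset.abs_sum_le_sum_abs _ _).trans ?_
  have h1 : ∀ i ∈ Finset.univ,
      |rHess h x (stdOrthonormalBasis ℝ (TangentSpace 𝓘(ℝ, E) x) i)
        (stdOrthonormalBasis ℝ (TangentSpace 𝓘(ℝ, E) x) i)| ≤ C := fun i _ => by
    simpa using hC (stdOrthonormalBasis ℝ (TangentSpace 𝓘(ℝ, E) x) i)
  refine (Finset.sum_le_card_nsmul _ _ _ h1).trans ?_
  rw [Finset.card_univ, Fintype.card_fin, nsmul_eq_mul]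
  exact le_rfl

/-- The `F''` part of the Hessian has rank one along `∇h`; hence its trace and its value in the
gradient direction combine to the factor `1 + b`. -/
lemma reducedOperator_comp (J : ∀ x : N, TangentSpace 𝓘(ℝ, E) x) {F F' : ℝ → ℝ} {F'' : ℝ}
    (hh : IsC2At (E := E) h x) (hFC : ContDiffAt ℝ 2 F (h x))
    (hF : ∀ᶠ t in 𝓝 (h x), HasDerivAt F (F' t) t) (hF' : HasDerivAt F' F'' (h x))
    (h0 : F' (h x) ≠ 0) (hg : rGrad E h x ≠ 0) :
    reducedOperator a J (fun y => F (h y)) x =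
      F' (h x) * (lapl E h x + bFun a (|F' (h x)| * ‖rGrad E h x‖) *
          (rHess h x (rGrad E h x) (rGrad E h x) / ‖rGrad E h x‖ ^ 2) -
          inner ℝ (rGrad E h x) (J x)) +
        F'' * (1 + bFun a (|F' (h x)| * ‖rGrad E h x‖)) * ‖rGrad E h x‖ ^ 2 := by
  have hs : ‖rGrad E h x‖ ≠ 0 := norm_ne_zero_iff.2 hg
  have hgr : rGrad E (fun y => F (h y)) x = F' (h x) • rGrad E h x :=
    rGrad_comp hh.mdiff hF.self_of_nhds
  have hH : rHess (fun y => F (h y)) x (F' (h x) • rGrad E h x) (F' (h x) • rGrad E h x) =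
      F' (h x) ^ 2 * (F' (h x) * rHess h x (rGrad E h x) (rGrad E h x) +
        F'' * (‖rGrad E h x‖ ^ 2) ^ 2) := by
    rw [rHess_comp hh hFC hF hF', ← hessForm_apply hh, ← hessForm_apply hh, ← inner_rGrad]
    simp only [map_smul, smul_apply, smul_eq_mul, inner_smul_right, real_inner_self_eq_norm_sq]
    ring
  rw [reducedOperator, lapl_comp hh hFC hF hF', hgr, norm_smul, Real.norm_eq_abs, hH,
    inner_smul_left, mul_pow, sq_abs, conj_trivial]
  field_simp
  ring

end Comp

/-! ### The strong maximum principle -/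

section StrongMaximumPrinciple

variable {E : Type*} [NormedAddCommGroup E] [InnerProductSpace ℝ E] [FiniteDimensional ℝ E]
  {N : Type*} [TopologicalSpace N] [ChartedSpace E N]
  [IsManifold 𝓘(ℝ, E) ∞ N] [RiemannianBundle (fun x : N => TangentSpace 𝓘(ℝ, E) x)]
  [IsContMDiffRiemannianBundle 𝓘(ℝ, E) ∞ E (fun x : N => TangentSpace 𝓘(ℝ, E) x)]

/-- Near a boundary point of a closed set there is a point of the set which can be touched from
outside by a hypersurface. -/
lemma exists_touching_function {Z W : Set N} (hZ : IsClosed Z) {y₀ : N} (hy₀ : y₀ ∈ Z)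
    (hint : Z ∉ 𝓝 y₀) (hW : W ∈ 𝓝 y₀) :
    ∃ y ∈ Z ∩ W, ∃ h : N → ℝ, IsC2At (E := E) h y ∧ h y = 0 ∧ rGrad E h y ≠ 0 ∧
      ∀ᶠ x in 𝓝 y, x ∈ Z → x ≠ y → h x < 0 := by
  have : ProperSpace E := FiniteDimensional.proper ℝ E
  set φ := extChartAt 𝓘(ℝ, E) y₀
  set c := φ y₀
  have htar : φ.target ∈ 𝓝 c :=
    (isOpen_extChartAt_target (I := 𝓘(ℝ, E)) y₀).mem_nhds (mem_extChartAt_target (I := 𝓘(ℝ, E)) y₀)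
  have hsymm0 : φ.symm c = y₀ := extChartAt_to_inv (I := 𝓘(ℝ, E)) y₀
  have hWc : φ.symm ⁻¹' W ∈ 𝓝 c := by
    refine (continuousAt_extChartAt_symm (I := 𝓘(ℝ, E)) y₀).preimage_mem_nhds ?_
    rwa [hsymm0]
  obtain ⟨R, hR, hball⟩ := Metric.nhds_basis_closedBall.mem_iff.1 (inter_mem htar hWc)
  have hcs : ContinuousOn φ.symm (Metric.closedBall c R) :=
    (continuousOn_extChartAt_symm (I := 𝓘(ℝ, E)) y₀).mono fun e he => (hball he).1
  set Z' := Metric.closedBall c R ∩ φ.symm ⁻¹' Z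
  have hZ' : IsCompact Z' := (isCompact_closedBall c R).of_isClosed_subset
    (hcs.preimage_isClosed_of_isClosed Metric.isClosed_closedBall hZ) inter_subset_left
  have hcZ' : c ∈ Z' := ⟨Metric.mem_closedBall_self hR.le, by rw [mem_preimage, hsymm0]; exact hy₀⟩
  -- From a point `p` outside the set, within `R / 2` of `c`, the nearest point `q` of the set lies
  -- strictly inside the chart ball of radius `R`, so the sphere about `p` through `q` touches the
  -- whole set near `q`.
  obtain ⟨p, hp, hpZ⟩ : ∃ p ∈ Metric.ball c (R / 2), φ.symm p ∉ Z := by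
    by_contra! hcon
    refine hint ?_
    filter_upwards [(continuousAt_extChartAt (I := 𝓘(ℝ, E)) y₀).preimage_mem_nhds
      (Metric.ball_mem_nhds c (half_pos hR)), extChartAt_source_mem_nhds (I := 𝓘(ℝ, E)) y₀]
      with x hx hxs
    rw [← φ.left_inv hxs]
    exact hcon _ hx
  obtain ⟨q, hqZ', hqmin⟩ := hZ'.exists_isMinOn ⟨c, hcZ'⟩
    (continuous_const.dist continuous_id : Continuous fun e => dist p e).continuousOn
  have hqp : dist p q < R / 2 :=
    (show dist p q ≤ dist p c from hqmin hcZ').trans_lt hp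
  have hqR : q ∈ Metric.ball c R := by
    rw [Metric.mem_ball] at hp ⊢
    linarith [dist_triangle q p c, dist_comm p q]
  have hqt : q ∈ φ.target := (hball hqZ'.1).1
  have hφq : φ (φ.symm q) = q := φ.right_inv hqt
  have hys : φ.symm q ∈ φ.source := φ.map_target hqt
  have hpq : p - q ≠ 0 := fun h => hpZ (by rw [sub_eq_zero.1 h]; exact hqZ'.2)
  -- The first two terms are nonpositive on the set; the last makes the contact strict without
  -- changing the gradient at `q`.
  set H : E → ℝ := fun e => ‖q - p‖ ^ 2 - ‖e - p‖ ^ 2 - ‖e - q‖ ^ 2 with hH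
  have hHC : ContDiff ℝ 2 H :=
    (contDiff_const.sub ((contDiff_id.sub contDiff_const).norm_sq ℝ)).sub
      ((contDiff_id.sub contDiff_const).norm_sq ℝ)
  have hφC : ContMDiffAt 𝓘(ℝ, E) 𝓘(ℝ, E) 2 φ (φ.symm q) :=
    contMDiffAt_extChartAt' (by simpa [φ] using hys)
  have hC : IsC2At (E := E) (fun x => H (φ x)) (φ.symm q) :=
    hHC.contMDiff.contMDiffAt.comp _ hφC
  refine ⟨φ.symm q, ⟨hqZ'.2, (hball hqZ'.1).2⟩, fun x => H (φ x), hC, by simp [hH, hφq], ?_, ?_⟩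
  · intro h0
    set γ : ℝ → N := fun t => φ.symm (q + t • (p - q)) with hγ
    have hγ0 : γ 0 = φ.symm q := by simp [hγ]
    have hline : ContMDiffAt 𝓘(ℝ, ℝ) 𝓘(ℝ, E) 1 (fun t : ℝ => q + t • (p - q)) 0 :=
      (contDiff_const.add (contDiff_id.smul contDiff_const)).contMDiff.contMDiffAt
    have hsymm : ContMDiffAt 𝓘(ℝ, E) 𝓘(ℝ, E) 1 φ.symm (q + (0 : ℝ) • (p - q)) := by
      rw [zero_smul, add_zero]
      exact (contMDiffOn_extChartAt_symm y₀).contMDiffAt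
        ((isOpen_extChartAt_target (I := 𝓘(ℝ, E)) y₀).mem_nhds hqt)
    have hγd : MDifferentiableAt 𝓘(ℝ, ℝ) 𝓘(ℝ, E) γ 0 :=
      (hsymm.comp 0 hline).mdifferentiableAt one_ne_zero
    have h1 := hasDerivAt_comp_curve (u := fun x => H (φ x)) (by rw [hγ0]; exact hC.mdiff) hγd
    rw [← inner_rGrad, hγ0, h0, inner_zero_left] at h1
    have h2 : (fun t => H (φ (γ t))) =ᶠ[𝓝 0]
        fun t : ℝ => ‖p - q‖ ^ 2 * (1 - (1 - t) ^ 2 - t ^ 2) := by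
      have hcont : ContinuousAt (fun t : ℝ => q + t • (p - q)) 0 := by fun_prop
      have hmem : ∀ᶠ t in 𝓝 (0 : ℝ), q + t • (p - q) ∈ φ.target := by
        refine hcont.eventually_mem ?_
        rw [zero_smul, add_zero]
        exact (isOpen_extChartAt_target (I := 𝓘(ℝ, E)) y₀).mem_nhds hqt
      filter_upwards [hmem] with t ht
      have h3 : φ (γ t) = q + t • (p - q) := φ.right_inv ht
      have h4 : q + t • (p - q) - p = -((1 - t) • (p - q)) := by module
      have h5 : q + t • (p - q) - q = t • (p - q) := by module
      rw [h3, hH]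
      simp only [h4, h5, norm_neg, norm_smul, mul_pow, Real.norm_eq_abs, sq_abs,
        norm_sub_rev q p]
      ring
    have h3 : HasDerivAt (fun t : ℝ => ‖p - q‖ ^ 2 * (1 - (1 - t) ^ 2 - t ^ 2))
        (‖p - q‖ ^ 2 * 2) 0 := by
      have h4 := ((((hasDerivAt_id (0 : ℝ)).const_sub 1).pow 2).const_sub 1).sub
        ((hasDerivAt_id (0 : ℝ)).pow 2)
      convert! h4.const_mul (‖p - q‖ ^ 2) using 1
      simp
    have h4 := (h1.congr_of_eventuallyEq h2.symm).unique h3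
    have h5 : 0 < ‖p - q‖ ^ 2 * 2 := by
      have := norm_pos_iff.2 hpq
      positivity
    linarith
  · have h1 : ∀ᶠ x in 𝓝 (φ.symm q), φ x ∈ Metric.ball c R ∧ x ∈ φ.source := by
      refine Filter.Eventually.and ?_ ((isOpen_extChartAt_source (I := 𝓘(ℝ, E)) y₀).mem_nhds hys)
      refine hφC.continuousAt.eventually_mem ?_
      rw [hφq]
      exact Metric.isOpen_ball.mem_nhds hqR
    filter_upwards [h1] with x hx hxZ hne
    have h2 : φ x ∈ Z' := ⟨Metric.ball_subset_closedBall hx.1, by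
      rw [mem_preimage, φ.left_inv hx.2]
      exact hxZ⟩
    have h3 : ‖q - p‖ ≤ ‖φ x - p‖ := by
      have h4 : dist p q ≤ dist p (φ x) := hqmin h2
      rwa [dist_comm, dist_comm p, dist_eq_norm, dist_eq_norm] at h4
    have h4 : 0 < ‖φ x - q‖ := by
      refine norm_pos_iff.2 (sub_ne_zero.2 fun h => hne ?_)
      rw [← h, φ.left_inv hx.2]
    have h5 := pow_le_pow_left₀ (norm_nonneg _) h3 2
    simp only [hH]
    nlinarith

end StrongMaximumPrinciple

section StrongMaximumPrinciple

variable {E : Type*} [NormedAddCommGroup E] [InnerProductSpace ℝ E] [FiniteDimensional ℝ E]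
  {N : Type*} [TopologicalSpace N] [T2Space N] [ChartedSpace E N]
  [IsManifold 𝓘(ℝ, E) ∞ N] [RiemannianBundle (fun x : N => TangentSpace 𝓘(ℝ, E) x)]
  [IsContMDiffRiemannianBundle 𝓘(ℝ, E) ∞ E (fun x : N => TangentSpace 𝓘(ℝ, E) x)]

variable {a : ℝ → ℝ} {J : ∀ x : N, TangentSpace 𝓘(ℝ, E) x} {u h : N → ℝ} {Λ : Set N}

/-- A solution cannot attain an interior maximum on a set which is touched from outside. -/
lemma not_touching_of_isMax (ha : IsRegularOperator a) (hΛ : IsOpen Λ)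
    (hu : ∀ x ∈ Λ, IsC2At (E := E) u x) (heq : SolvesAtRegularPoints a J Λ u) {M : ℝ}
    (hM : ∀ x ∈ Λ, u x ≤ M) {y : N} (hy : y ∈ Λ) (huy : u y = M) (hJ : C1Field J y)
    (hh : IsC2At (E := E) h y) (hhy : h y = 0) (hg : rGrad E h y ≠ 0) :
    ¬ ∀ᶠ x in 𝓝 y, u x = M → x ≠ y → h x < 0 := by
  intro hev
  have : LocallyCompactSpace N := Manifold.locallyCompact_of_finiteDimensional 𝓘(ℝ, E)
  obtain ⟨s₀, hs₀, hb⟩ := ha.exists_abs_bFun_le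
  obtain ⟨C, hC, hCe⟩ := eventually_abs_koszul_le (contMDiffAt_rGrad hh)
  have hgc := continuousAt_norm_field (diffField_rGrad hh)
  have hgpos : 0 < ‖rGrad E h y‖ := norm_pos_iff.2 hg
  set G := ‖rGrad E h y‖ with hG
  set m : ℝ := ((Module.finrank ℝ E : ℕ) : ℝ)
  have hm : 0 ≤ m := Nat.cast_nonneg _
  have hgood : ∀ᶠ x in 𝓝 y, (u x = M → x ≠ y → h x < 0) ∧ x ∈ Λ ∧ IsC2At (E := E) h x ∧
      (∀ v, |koszul (rGrad E h) x v v| ≤ C * ‖v‖ ^ 2) ∧ G / 2 < ‖rGrad E h x‖ ∧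
      ‖rGrad E h x‖ < 2 * G ∧ ‖J x‖ < ‖J y‖ + 1 ∧ h x < 1 := by
    filter_upwards [hev, hΛ.mem_nhds hy, hh.eventually, hCe,
      hgc.eventually_const_lt (half_lt_self hgpos),
      hgc.eventually_lt_const (show G < 2 * G by linarith),
      (continuousAt_norm_field (hJ.mdifferentiableAt one_ne_zero)).eventually_lt_const (lt_add_one ‖J y‖),
      hh.continuousAt.eventually_lt_const (show h y < 1 by rw [hhy]; exact one_pos)]
      with x h1 h2 h3 h4 h5 h6 h7 h8
    exact ⟨h1, h2, h3, h4, h5, h6, h7, h8⟩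
  obtain ⟨B, hBn, hBsub, hB⟩ := local_compact_nhds hgood
  have hBsub : ∀ x ∈ B, (u x = M → x ≠ y → h x < 0) ∧ x ∈ Λ ∧ IsC2At (E := E) h x ∧
      (∀ v, |koszul (rGrad E h) x v v| ≤ C * ‖v‖ ^ 2) ∧ G / 2 < ‖rGrad E h x‖ ∧
      ‖rGrad E h x‖ < 2 * G ∧ ‖J x‖ < ‖J y‖ + 1 ∧ h x < 1 := fun x hx => hBsub hx
  have hyB : y ∈ interior B := mem_interior_iff_mem_nhds.2 hBn
  have hhc : ContinuousOn h B := fun x hx =>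
    (hBsub x hx).2.2.1.continuousAt.continuousWithinAt
  have huc : ContinuousOn u B := fun x hx =>
    (hu x (hBsub x hx).2.1).continuousAt.continuousWithinAt
  -- On the part of the edge of `B` where `h ≥ 0` the maximum `M` is not attained, so compactness
  -- leaves a gap `η`.
  obtain ⟨η, hη, hηB⟩ : ∃ η > 0, ∀ x ∈ B, x ∉ interior B → 0 ≤ h x → u x ≤ M - η := by
    set S := (B \ interior B) ∩ h ⁻¹' Ici 0
    have hSB : S ⊆ B := fun x hx => hx.1.1
    have hS : IsCompact S := by
      have hD : IsCompact (B \ interior B) := hB.diff isOpen_interior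
      exact hD.of_isClosed_subset ((hhc.mono sdiff_subset).preimage_isClosed_of_isClosed
        hD.isClosed isClosed_Ici) inter_subset_left
    rcases S.eq_empty_or_nonempty with hem | hne
    · refine ⟨1, one_pos, fun x hx hxi hx0 => ?_⟩
      have : x ∈ S := ⟨⟨hx, hxi⟩, hx0⟩
      rw [hem] at this
      exact this.elim
    · obtain ⟨x₁, hx₁, hmax⟩ := hS.exists_isMaxOn hne (huc.mono hSB)
      refine ⟨M - u x₁, ?_, fun x hx hxi hx0 => ?_⟩
      · refine sub_pos.2 ((hM x₁ (hBsub _ (hSB hx₁)).2.1).lt_of_ne fun h1 => ?_)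
        have hx₁y : x₁ ≠ y := fun h2 => hx₁.1.2 (h2 ▸ hyB)
        exact absurd ((hBsub _ (hSB hx₁)).1 h1 hx₁y) (not_lt.2 hx₁.2)
      · have : u x ≤ u x₁ := hmax (show x ∈ S from ⟨⟨hx, hxi⟩, hx0⟩)
        linarith
  -- `A` bounds the Laplacian, the normal second derivative and the drift term of `h`; `α` is chosen
  -- so that `α · (1/2) · (G/2)² > A`.
  set A := m * C + C + 2 * G * (‖J y‖ + 1) with hA
  have hApos : 0 < A := by positivity
  set α := 8 * A / G ^ 2 + 1 with hα
  have hαpos : 0 < α := by positivity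
  -- A small `ε` serves two purposes: the perturbation stays below the gap `η`, and the gradient of
  -- `F ∘ h` stays below `s₀`, where `|b| ≤ 1/2`.
  obtain ⟨ε, hε, hε1, hε2⟩ : ∃ ε > 0, ε * Real.exp α < η ∧ ε * (α * Real.exp α * (2 * G)) < s₀ := by
    have h1 : 0 < Real.exp α := Real.exp_pos α
    have h2 : 0 < α * Real.exp α * (2 * G) := by positivity
    refine ⟨min (η / Real.exp α) (s₀ / (α * Real.exp α * (2 * G))) / 2, by positivity, ?_, ?_⟩
    · rw [← lt_div_iff₀ h1]
      exact (half_lt_self (by positivity)).trans_le (min_le_left _ _)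
    · rw [← lt_div_iff₀ h2]
      exact (half_lt_self (by positivity)).trans_le (min_le_right _ _)
  set F : ℝ → ℝ := fun t => ε * (1 - Real.exp (α * t)) with hF
  set F' : ℝ → ℝ := fun t => -(ε * α * Real.exp (α * t)) with hF'
  have hexp : ∀ t, HasDerivAt (fun t => Real.exp (α * t)) (α * Real.exp (α * t)) t := fun t => by
    have h1 : HasDerivAt (fun t => α * t) α t := by simpa using! (hasDerivAt_id t).const_mul α
    have h2 := h1.exp
    rwa [mul_comm] at h2
  have hFd : ∀ t, HasDerivAt F (F' t) t := fun t => by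
    have := ((hexp t).const_sub 1).const_mul ε
    convert! this using 1
    simp only [hF']
    ring
  have hFd' : ∀ t, HasDerivAt F' (α * F' t) t := fun t => by
    have := ((hexp t).const_mul (ε * α)).neg
    convert! this using 1
    simp only [hF']
    ring
  have hFC : ContDiff ℝ 2 F := by
    have : ContDiff ℝ 2 fun t : ℝ => Real.exp (α * t) := (contDiff_const.mul contDiff_id).exp
    exact contDiff_const.mul (contDiff_const.sub this)
  obtain ⟨z, hzB, hzmax⟩ := hB.exists_isMaxOn (f := fun x => u x - F (h x))
    ⟨y, interior_subset hyB⟩ (huc.sub (hFC.continuous.comp_continuousOn hhc))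
  have hzM : M ≤ u z - F (h z) := by
    have h1 : u y - F (h y) ≤ u z - F (h z) := hzmax (interior_subset hyB)
    rw [huy, hhy] at h1
    simpa [hF] using h1
  obtain ⟨-, hzΛ, hhz, hkz, hgz, hgz', hJz, hz1⟩ := hBsub z hzB
  have huz := hM z hzΛ
  have hexpz : Real.exp (α * h z) ≤ Real.exp α :=
    Real.exp_le_exp.2 (by nlinarith)
  have hexp0 := Real.exp_pos (α * h z)
  -- Comparison with the value at `y` gives `F (h z) ≤ 0`; the sign of `h z` is what makes the gap
  -- `η` applicable at `z`.
  have hz0 : 0 ≤ h z := by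
    have h1 : F (h z) ≤ 0 := by linarith
    have h2 : 1 - Real.exp (α * h z) ≤ 0 := nonpos_of_mul_nonpos_right h1 hε
    have h3 : 0 ≤ α * h z := Real.one_le_exp_iff.1 (by linarith)
    exact nonneg_of_mul_nonneg_right h3 hαpos
  have hzint : z ∈ interior B := by
    by_contra hzi
    have h1 := hηB z hzB hzi hz0
    have h2 : ε * Real.exp (α * h z) ≤ ε * Real.exp α := mul_le_mul_of_nonneg_left hexpz hε.le
    simp only [hF] at hzM
    nlinarith
  have hlm : IsLocalMax (fun x => u x - F (h x)) z := by
    filter_upwards [mem_interior_iff_mem_nhds.1 hzint] with x hx using hzmax hx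
  have hF'z : F' (h z) < 0 := by
    simp only [hF']
    have : 0 < ε * α * Real.exp (α * h z) := by positivity
    linarith
  have hgz0 : rGrad E h z ≠ 0 := fun h0 => by
    rw [h0, norm_zero] at hgz
    linarith
  have hgr : rGrad E (fun y => F (h y)) z = F' (h z) • rGrad E h z :=
    rGrad_comp hhz.mdiff (hFd _)
  have h1 := reducedOperator_nonneg_of_touching ha (hu z hzΛ) (hhz.comp_real hFC.contDiffAt) hlm
    (by rw [hgr]; exact smul_ne_zero hF'z.ne hgz0) (heq z hzΛ)
  rw [reducedOperator_comp J hhz hFC.contDiffAt (Eventually.of_forall hFd) (hFd' _) hF'z.ne hgz0]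
    at h1
  set s := |F' (h z)| * ‖rGrad E h z‖ with hs
  have hgn : 0 < ‖rGrad E h z‖ := by linarith
  have hspos : 0 < s := mul_pos (abs_pos.2 hF'z.ne) hgn
  have hslt : s < s₀ := by
    refine lt_of_le_of_lt ?_ hε2
    rw [hs, abs_of_neg hF'z]
    simp only [hF', neg_neg]
    calc ε * α * Real.exp (α * h z) * ‖rGrad E h z‖ ≤ ε * α * Real.exp α * (2 * G) := by gcongr
      _ = _ := by ring
  have hbs := abs_le.1 (hb s hspos hslt)
  have hHess : ∀ v, |rHess h z v v| ≤ C * ‖v‖ ^ 2 := fun v => by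
    rw [rHess_eq_koszul hhz]
    exact hkz v
  have hl := (abs_le.1 (abs_lapl_le hHess)).1
  have hn : |rHess h z (rGrad E h z) (rGrad E h z) / ‖rGrad E h z‖ ^ 2| ≤ C := by
    rw [abs_div, abs_of_pos (pow_pos hgn 2), div_le_iff₀ (pow_pos hgn 2)]
    exact hHess _
  have hbn : |bFun a s * (rHess h z (rGrad E h z) (rGrad E h z) / ‖rGrad E h z‖ ^ 2)| ≤ C := by
    rw [abs_mul]
    calc _ ≤ 1 * C := mul_le_mul ((hb s hspos hslt).trans (by norm_num)) hn (abs_nonneg _)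
          zero_le_one
      _ = C := one_mul C
  have hJn : inner ℝ (rGrad E h z) (J z) ≤ 2 * G * (‖J y‖ + 1) :=
    (real_inner_le_norm _ _).trans (mul_le_mul hgz'.le hJz.le (norm_nonneg _) (by positivity))
  have hmain : A < α * (1 + bFun a s) * ‖rGrad E h z‖ ^ 2 := by
    have h2 : G ^ 2 / 4 ≤ ‖rGrad E h z‖ ^ 2 := by nlinarith
    have h3 : A < α * (1 / 2) * (G ^ 2 / 4) := by
      have : α * (1 / 2) * (G ^ 2 / 4) = A + G ^ 2 / 8 := by
        rw [hα]
        field_simp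
        ring
      rw [this]
      have := pow_pos hgpos 2
      linarith
    refine h3.trans_le (mul_le_mul (mul_le_mul_of_nonneg_left (by linarith) hαpos.le) h2
      (by positivity) (mul_nonneg hαpos.le (by linarith)))
  have hfac : F' (h z) * (lapl E h z + bFun a s *
      (rHess h z (rGrad E h z) (rGrad E h z) / ‖rGrad E h z‖ ^ 2) - inner ℝ (rGrad E h z) (J z)) +
      α * F' (h z) * (1 + bFun a s) * ‖rGrad E h z‖ ^ 2 =
      F' (h z) * (lapl E h z + bFun a s *
      (rHess h z (rGrad E h z) (rGrad E h z) / ‖rGrad E h z‖ ^ 2) - inner ℝ (rGrad E h z) (J z) +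
      α * (1 + bFun a s) * ‖rGrad E h z‖ ^ 2) := by ring
  rw [hfac] at h1
  have hbn' := (abs_le.1 hbn).1
  exact absurd h1 (not_le.2 (mul_neg_of_neg_of_pos hF'z (by linarith)))

/-- The maximum principle for solutions of the reduced equation. -/
lemma le_of_solves (ha : IsRegularOperator a) (hΛ : IsOpen Λ) (hconn : IsConnected Λ)
    (hcomp : IsCompact (closure Λ)) (hfr : (frontier Λ).Nonempty)
    (huc : ContinuousOn u (closure Λ)) (hu : ∀ x ∈ Λ, IsC2At (E := E) u x)
    (heq : SolvesAtRegularPoints a J Λ u) (hJ : ∀ x, C1Field J x) {K : ℝ}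
    (hK : ∀ y ∈ frontier Λ, u y ≤ K) : ∀ x ∈ closure Λ, u x ≤ K := by
  obtain ⟨z, hz, hmax⟩ := hcomp.exists_isMaxOn hconn.nonempty.closure huc
  have hmax : ∀ x ∈ closure Λ, u x ≤ u z := fun x hx => hmax hx
  by_contra! hcon
  obtain ⟨x₀, hx₀, hKx⟩ := hcon
  have hKz : K < u z := hKx.trans_le (hmax x₀ hx₀)
  set Z := closure Λ ∩ u ⁻¹' {u z}
  have hZ : IsClosed Z := huc.preimage_isClosed_of_isClosed isClosed_closure isClosed_singleton
  have hZΛ : Z ⊆ Λ := fun x hx => by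
    by_contra hxΛ
    have h1 := hK x ⟨hx.1, fun h => hxΛ (interior_subset h)⟩
    rw [show u x = u z from hx.2] at h1
    linarith
  -- The maximum set is closed and lies in `Λ`. Were it not open, it could be touched from outside;
  -- being open, it is all of `Λ` by connectedness, and a frontier point gives a contradiction.
  have hopen : IsOpen Z := by
    refine isOpen_iff_mem_nhds.2 fun y₀ hy₀ => ?_
    by_contra hint
    obtain ⟨y, hy, h, hh, hhy, hg, hev⟩ := exists_touching_function (E := E) hZ hy₀ hint
      (hΛ.mem_nhds (hZΛ hy₀))
    refine not_touching_of_isMax ha hΛ hu heq (fun x hx => hmax x (subset_closure hx)) hy.2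
      hy.1.2 (hJ y) hh hhy hg ?_
    filter_upwards [hev, hΛ.mem_nhds hy.2] with x h1 h2 h3 h4
    exact h1 ⟨subset_closure h2, h3⟩ h4
  have hsub : Λ ⊆ Z := hconn.isPreconnected.subset_isClopen ⟨hZ, hopen⟩
    ⟨z, hZΛ ⟨hz, rfl⟩, hz, rfl⟩
  obtain ⟨y, hy⟩ := hfr
  have h1 : y ∈ Λ := hZΛ (closure_minimal hsub hZ hy.1)
  exact hy.2 (by rwa [hΛ.interior_eq])

end StrongMaximumPrinciple

/-! ### The numerical inequality for the barrier -/

section BarrierReal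

/-- The remainder bound in the barrier estimate. -/
def remainderBound (K : ℝ) : ℝ := K + 4 * K ^ 3 + 4 * K ^ 2

/-- The concavity required of the barrier. -/
def barrierConst (m K : ℝ) : ℝ := 2 * remainderBound K + 2 * (m * K) + K ^ 2 + K + 1

/-- Here `s = |∇w|`, `c = ⟨∇d, ∇w⟩`, and `ld`, `dJ` stand for `Δd`, `⟨∇d, J⟩`. Once the normal
second derivative of `w` is nonpositive, `b` may be replaced by `b⁻ ∈ (-1, 0]`, so no upper bound on
`b` is needed, and `q' (1 + b⁻)` absorbs everything else. -/
lemma barrier_real {m K p s b q' κ c Hψ D₁ D₂ lψ ld ψJ dJ : ℝ} (hK : 0 ≤ K)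
    (hm : 0 ≤ m) (hp : 10 * K + 1 ≤ p) (hs1 : p - K ≤ s) (hs2 : s ≤ p + K) (hκ : 1 ≤ κ)
    (hb : 0 < 1 + b) (hq' : q' ≤ 0)
    (hq : barrierConst m K * κ ≤ -q' * (1 + min b 0)) (hc1 : p - K ≤ c) (hc2 : |c| ≤ s)
    (hHψ : |Hψ| ≤ K * s ^ 2) (hD₁ : |D₁| ≤ K ^ 3) (hD₂ : |D₂| ≤ K ^ 2) (hlψ : |lψ| ≤ m * K)
    (hψJ : |ψJ| ≤ K ^ 2) (hld : p * (ld - dJ) ≤ κ * (m * K + K)) :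
    lψ + (p * ld + q') + b / s ^ 2 * (Hψ + p * (D₁ + p * D₂) + q' * c ^ 2) -
      (ψJ + p * dJ) < 0 := by
  have hp0 : 0 < p := by linarith
  have hs : 0 < s := by linarith
  have hmK : 0 ≤ m * K := mul_nonneg hm hK
  have hR0 : 0 ≤ remainderBound K := by
    unfold remainderBound
    positivity
  have hps : p ≤ 2 * s := by linarith
  have hpp : p ≤ p ^ 2 := by nlinarith
  have hp2 : p ^ 2 ≤ 4 * s ^ 2 := by nlinarith
  set R := (Hψ + p * (D₁ + p * D₂)) / s ^ 2 with hR
  have hRb : |R| ≤ remainderBound K := by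
    rw [hR, abs_div, abs_of_pos (pow_pos hs 2), div_le_iff₀ (pow_pos hs 2)]
    have h1 : |Hψ + p * (D₁ + p * D₂)| ≤ K * s ^ 2 + p * (K ^ 3 + p * K ^ 2) := by
      refine (abs_add_le _ _).trans (add_le_add hHψ ?_)
      rw [abs_mul, abs_of_pos hp0]
      refine mul_le_mul_of_nonneg_left ((abs_add_le _ _).trans (add_le_add hD₁ ?_)) hp0.le
      rw [abs_mul, abs_of_pos hp0]
      exact mul_le_mul_of_nonneg_left hD₂ hp0.le
    have h2 : p * K ^ 3 ≤ 4 * s ^ 2 * K ^ 3 :=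
      mul_le_mul_of_nonneg_right (hpp.trans hp2) (pow_nonneg hK 3)
    have h3 : p ^ 2 * K ^ 2 ≤ 4 * s ^ 2 * K ^ 2 := mul_le_mul_of_nonneg_right hp2 (sq_nonneg K)
    unfold remainderBound
    linarith
  set t := c ^ 2 / s ^ 2 with ht
  have ht1 : t ≤ 1 := by
    rw [ht, div_le_one (pow_pos hs 2)]
    exact sq_le_sq' (abs_le.1 hc2).1 (abs_le.1 hc2).2
  -- `p ≥ 10 K` gives `c ≥ 9p/10` and `s ≤ 11p/10`: the gradient of the barrier is nearly parallel
  -- to `∇d`.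
  have ht2 : 1 / 2 ≤ t := by
    rw [ht, le_div_iff₀ (pow_pos hs 2)]
    have h1 : (9 / 10 * p) ^ 2 ≤ c ^ 2 := pow_le_pow_left₀ (by linarith) (by linarith) 2
    have h2 : s ^ 2 ≤ (11 / 10 * p) ^ 2 := pow_le_pow_left₀ hs.le (by linarith) 2
    nlinarith [pow_pos hp0 2]
  have hsplit : b / s ^ 2 * (Hψ + p * (D₁ + p * D₂) + q' * c ^ 2) = b * (R + q' * t) := by
    rw [hR, ht]
    field_simp
  rw [hsplit]
  set β := min b 0 with hβ
  have hβ0 : β ≤ 0 := min_le_right _ _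
  have hβb : β ≤ b := min_le_left _ _
  have hβ1 : 0 < 1 + β := by
    rcases min_choice b 0 with h | h <;> rw [hβ, h]
    · exact hb
    · norm_num
  have hC0 : 0 ≤ barrierConst m K := by
    unfold barrierConst
    positivity
  have hCκ : barrierConst m K ≤ barrierConst m K * κ := le_mul_of_one_le_right hC0 hκ
  have hq1 : barrierConst m K ≤ -q' := by
    have : -q' * (1 + β) ≤ -q' * 1 := mul_le_mul_of_nonneg_left (by linarith) (by linarith)
    linarith
  have hRabs := abs_le.1 hRb
  -- The summand `2 * remainderBound K` in `barrierConst` compensates `t ≥ 1/2`.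
  have hHn : R + q' * t ≤ 0 := by
    have h1 : q' * t ≤ q' * (1 / 2) := mul_le_mul_of_nonpos_left ht2 hq'
    unfold barrierConst at hq1
    have : 0 ≤ K ^ 2 := sq_nonneg K
    linarith
  have h1 : b * (R + q' * t) ≤ β * (R + q' * t) := mul_le_mul_of_nonpos_right hβb hHn
  have h2 : β * R ≤ remainderBound K := by nlinarith
  have h3 : β * q' * t ≤ β * q' * 1 :=
    mul_le_mul_of_nonneg_left ht1 (mul_nonneg_of_nonpos_of_nonpos hβ0 hq')
  have h4 := (abs_le.1 hlψ).2
  have h5 := (abs_le.1 hψJ).1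
  have h6 : barrierConst m K * κ ≥ κ * (m * K + K) + (remainderBound K + m * K + K ^ 2 + 1) := by
    have : (barrierConst m K - (m * K + K)) * 1 ≤ (barrierConst m K - (m * K + K)) * κ := by
      refine mul_le_mul_of_nonneg_left hκ ?_
      unfold barrierConst
      have : 0 ≤ K ^ 2 := sq_nonneg K
      linarith
    unfold barrierConst at this ⊢
    linarith
  linarith

end BarrierReal

/-! ### The barrier is a strict supersolution -/

section Barrier

variable {E : Type*} [NormedAddCommGroup E] [NormedSpace ℝ E] [FiniteDimensional ℝ E]
  {N : Type*} [TopologicalSpace N] [ChartedSpace E N]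
  [IsManifold 𝓘(ℝ, E) ∞ N] [RiemannianBundle (fun x : N => TangentSpace 𝓘(ℝ, E) x)]
  [IsContMDiffRiemannianBundle 𝓘(ℝ, E) ∞ E (fun x : N => TangentSpace 𝓘(ℝ, E) x)]

variable {a : ℝ → ℝ} {J : ∀ x : N, TangentSpace 𝓘(ℝ, E) x} {ψ d : N → ℝ} {x : N}

/-- Differentiate `|∇d|² = 1`. -/
lemma rHess_rGrad_eq_zero (hd : IsC2At (E := E) d x) (h1 : ∀ᶠ y in 𝓝 x, ‖rGrad E d y‖ = 1)
    (v : TangentSpace 𝓘(ℝ, E) x) : rHess d x v (rGrad E d x) = 0 := by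
  have h2 := mvfderiv_normSq_rGrad hd v
  have h3 : (fun y => inner ℝ (rGrad E d y) (rGrad E d y)) =ᶠ[𝓝 x] fun _ => (1 : ℝ) := by
    filter_upwards [h1] with y hy
    rw [real_inner_self_eq_norm_sq, hy, one_pow]
  have h4 : mvfderiv 𝓘(ℝ, E) (fun _ : N => (1 : ℝ)) x v = 0 := by
    simp [mvfderiv, mfderiv_const]
  rw [mvfderiv_congr h3, h4] at h2
  linarith

/-- The unit normal is `∇d` itself, and the trace of `∇²d` has no component in that direction. -/
lemma levelMeanCurvature_eq (hd : IsC2At (E := E) d x) (h1 : ∀ᶠ y in 𝓝 x, ‖rGrad E d y‖ = 1) :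
    levelMeanCurvature E d x = -lapl E d x := by
  have hη : ∀ᶠ y in 𝓝 x, levelNormal E d y = rGrad E d y := by
    filter_upwards [h1] with y hy
    rw [levelNormal, hy, inv_one, one_smul]
  have hX := diffField_rGrad hd
  have hY : DiffField (levelNormal E d) x := by
    refine hX.congr_of_eventuallyEq ?_
    filter_upwards [hη] with y hy
    rw [fieldSection, hy]
  have hn : ‖levelNormal E d x‖ = 1 := by rw [hη.self_of_nhds, h1.self_of_nhds]
  have h2 := sum_diag_eq_add_orthogonal (hessForm hd) (stdOrthonormalBasis ℝ _) hn
    (stdOrthonormalBasis ℝ (Submodule.span ℝ {levelNormal E d x})ᗮ)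
  have h3 : hessForm hd (levelNormal E d x) (levelNormal E d x) = 0 := by
    rw [hessForm_apply, hη.self_of_nhds, rHess_rGrad_eq_zero hd h1]
  rw [h3, zero_add] at h2
  rw [levelMeanCurvature, lapl, neg_inj]
  simp only [hessForm_apply] at h2
  rw [h2]
  refine Finset.sum_congr rfl fun i _ => ?_
  rw [inner_covDeriv hY, koszul_congr hη, rHess_eq_koszul hd]

/-- The barrier `ψ + f(d)` is a strict supersolution. -/
lemma reducedOperator_barrier_neg (ha : IsRegularOperator a) {K κ : ℝ} (hK : 0 ≤ K)
    (hψ : IsC2At (E := E) ψ x) (hd : IsC2At (E := E) d x)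
    (h1 : ∀ᶠ y in 𝓝 x, ‖rGrad E d y‖ = 1) {f q q' : ℝ → ℝ} (hfC : ContDiff ℝ 2 f)
    (hf : ∀ t, HasDerivAt f (q t) t) (hq : ∀ t, HasDerivAt q (q' t) t)
    (hp : 10 * K + 1 ≤ q (d x)) (hκ : 1 ≤ κ) (hq' : q' (d x) ≤ 0)
    (hprof : ∀ s, |s - q (d x)| ≤ K → barrierConst (Module.finrank ℝ E) K * κ ≤
      -q' (d x) * (1 + min (bFun a s) 0))
    (hψ1 : ‖rGrad E ψ x‖ ≤ K) (hψ2 : hessNorm E ψ x ≤ K) (hd2 : hessNorm E d x ≤ K)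
    (hJ : ‖J x‖ ≤ K)
    (hcurv : q (d x) * (lapl E d x - inner ℝ (rGrad E d x) (J x)) ≤
      κ * (Module.finrank ℝ E * K + K)) :
    IsC2At (E := E) (fun y => ψ y + f (d y)) x ∧ rGrad E (fun y => ψ y + f (d y)) x ≠ 0 ∧
      reducedOperator a J (fun y => ψ y + f (d y)) x < 0 := by
  have hfd : IsC2At (E := E) (fun y => f (d y)) x := hd.comp_real hfC.contDiffAt
  have hw : IsC2At (E := E) (fun y => ψ y + f (d y)) x := ContMDiffAt.add hψ hfd
  set p := q (d x)
  have hgr : rGrad E (fun y => ψ y + f (d y)) x = rGrad E ψ x + p • rGrad E d x := by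
    change rGrad E (ψ + fun y => f (d y)) x = _
    rw [rGrad_add hψ.mdiff hfd.mdiff, rGrad_comp hd.mdiff (hf _)]
  have hH : ∀ v v', rHess (fun y => ψ y + f (d y)) x v v' = rHess ψ x v v' +
      (p * rHess d x v v' + q' (d x) * inner ℝ (rGrad E d x) v * inner ℝ (rGrad E d x) v') := by
    intro v v'
    change rHess (ψ + fun y => f (d y)) x v v' = _
    rw [rHess_add hψ hfd, rHess_comp hd hfC.contDiffAt (Eventually.of_forall hf) (hq _),
      inner_rGrad, inner_rGrad]
  have hlap : lapl E (fun y => ψ y + f (d y)) x = lapl E ψ x + (p * lapl E d x + q' (d x)) := by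
    have h2 := lapl_comp hd hfC.contDiffAt (Eventually.of_forall hf) (hq (d x))
    rw [h1.self_of_nhds, one_pow, mul_one] at h2
    rw [← h2, lapl, lapl, lapl, ← Finset.sum_add_distrib]
    refine Finset.sum_congr rfl fun i _ => ?_
    exact rHess_add hψ hfd _ _
  have hd1 := h1.self_of_nhds
  set gψ := rGrad E ψ x
  set gd := rGrad E d x
  have hp0 : 0 < p := by linarith
  have hpn : ‖p • gd‖ = p := by rw [norm_smul, hd1, mul_one, Real.norm_eq_abs, abs_of_pos hp0]
  set w := gψ + p • gd with hwdef
  have hs1 : p - K ≤ ‖w‖ := by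
    have := norm_sub_le w gψ
    rw [hwdef, add_sub_cancel_left, hpn] at this
    linarith
  have hs2 : ‖w‖ ≤ p + K := by
    have := norm_add_le gψ (p • gd)
    rw [hpn] at this
    linarith
  have hw0 : w ≠ 0 := norm_pos_iff.1 (by linarith)
  refine ⟨hw, by rw [hgr]; exact hw0, ?_⟩
  have hgd2 : inner ℝ gd gd = (1 : ℝ) := by rw [real_inner_self_eq_norm_sq, hd1, one_pow]
  have hgψd : |inner ℝ gd gψ| ≤ K := by
    have := abs_real_inner_le_norm gd gψ
    rw [hd1, one_mul] at this
    exact this.trans hψ1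
  have hc : inner ℝ gd w = p + inner ℝ gd gψ := by
    rw [hwdef, inner_add_right, inner_smul_right, hgd2]
    ring
  have hDz : ∀ v, rHess d x v gd = 0 := rHess_rGrad_eq_zero hd h1
  -- Only `∇²d(·, ∇d) = 0` is used. The term `∇²d(∇d, ∇ψ)` is kept and estimated, which avoids the
  -- symmetry of the Hessian.
  have hD : rHess d x w w = rHess d x gψ gψ + p * rHess d x gd gψ := by
    have h2 : rHess d x w w = rHess d x w gψ := by
      have h3 : rHess d x w (gψ + p • gd) = rHess d x w gψ + p * rHess d x w gd := by
        simp only [← hessForm_apply hd, map_add, map_smul, smul_eq_mul]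
      rw [hDz, mul_zero, add_zero] at h3
      exact h3
    rw [h2, hwdef]
    simp only [← hessForm_apply hd, map_add, map_smul, smul_eq_mul, add_apply, smul_apply]
  have hbound : ∀ {φ : N → ℝ}, IsC2At (E := E) φ x → hessNorm E φ x ≤ K → ∀ v v',
      |rHess φ x v v'| ≤ K * ‖v‖ * ‖v'‖ := fun hφ hφK v v' =>
    (abs_rHess_le hφ v v').trans (by gcongr)
  have hlψ : |lapl E ψ x| ≤ Module.finrank ℝ E * K :=
    abs_lapl_le fun v => (hbound hψ hψ2 v v).trans_eq (by ring)
  rw [reducedOperator, hgr, hlap, hH, hD, inner_add_left, inner_smul_left, conj_trivial]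
  have key := barrier_real (m := Module.finrank ℝ E) (K := K) (p := p) (s := ‖w‖)
    (b := bFun a ‖w‖) (q' := q' (d x)) (κ := κ) (c := inner ℝ gd w) (Hψ := rHess ψ x w w)
    (D₁ := rHess d x gψ gψ) (D₂ := rHess d x gd gψ) (lψ := lapl E ψ x) (ld := lapl E d x)
    (ψJ := inner ℝ gψ (J x)) (dJ := inner ℝ gd (J x)) hK (Nat.cast_nonneg _) hp hs1 hs2 hκ
    (ha.hasDerivAt (norm_pos_iff.2 hw0)).2.2 hq'
    (hprof _ (abs_le.2 ⟨by linarith, by linarith⟩))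
    (by rw [hc]; linarith [(abs_le.1 hgψd).1])
    (by simpa [hd1] using abs_real_inner_le_norm gd w)
    ((hbound hψ hψ2 w w).trans_eq (by ring))
    ((hbound hd hd2 gψ gψ).trans (by
      calc K * ‖gψ‖ * ‖gψ‖ ≤ K * K * K := by gcongr
        _ = K ^ 3 := by ring))
    ((hbound hd hd2 gd gψ).trans (by
      rw [hd1, mul_one, sq]
      exact mul_le_mul_of_nonneg_left hψ1 hK))
    hlψ
    ((abs_real_inner_le_norm _ _).trans (by
      rw [sq]
      exact mul_le_mul hψ1 hJ (norm_nonneg _) hK)) hcurv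
  convert! key using 4
  ring

end Barrier

/-! ### Comparison in the boundary strip and the normal derivative -/

section BoundaryEstimate

variable {E : Type*} [NormedAddCommGroup E] [InnerProductSpace ℝ E] [FiniteDimensional ℝ E]
  {N : Type*} [MetricSpace N] [ChartedSpace E N]
  [IsManifold 𝓘(ℝ, E) ∞ N] [RiemannianBundle (fun x : N => TangentSpace 𝓘(ℝ, E) x)]
  [IsContMDiffRiemannianBundle 𝓘(ℝ, E) ∞ E (fun x : N => TangentSpace 𝓘(ℝ, E) x)]
  [IsRiemannianManifold 𝓘(ℝ, E) N]

variable {a : ℝ → ℝ} {J : ∀ x : N, TangentSpace 𝓘(ℝ, E) x} {ψ u : N → ℝ} {Λ : Set N}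

lemma continuous_bdryDist (Λ : Set N) : Continuous (bdryDist Λ) :=
  Metric.continuous_infDist_pt _

lemma bdryDist_eq_zero {y : N} (hy : y ∈ frontier Λ) : bdryDist Λ y = 0 :=
  Metric.infDist_zero_of_mem hy

lemma norm_rGrad_bdryDist_eventually (hΛ : IsOpen Λ) (hfr : (frontier Λ).Nonempty) {δ : ℝ}
    (hd : ∀ x ∈ Λ, bdryDist Λ x < δ → IsC2At (E := E) (bdryDist Λ) x)
    {x : N} (hx : x ∈ Λ) (hxd : bdryDist Λ x < δ) :
    ∀ᶠ z in 𝓝 x, ‖rGrad E (bdryDist Λ) z‖ = 1 := by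
  filter_upwards [hΛ.mem_nhds hx,
    (continuous_bdryDist Λ).continuousAt.eventually_lt_const hxd] with z h1 h2
  refine norm_rGrad_infDist isClosed_frontier hfr (fun h => h.2 ?_) (hd z h1 h2)
  rwa [hΛ.interior_eq]

/-- A solution stays below the barrier in the boundary strip. -/
lemma le_barrier (ha : IsRegularOperator a) (hΛ : IsOpen Λ) (hcomp : IsCompact (closure Λ))
    (hfr : (frontier Λ).Nonempty) {δ K ℓ : ℝ} (hK : 0 ≤ K)
    (hd : ∀ x ∈ Λ, bdryDist Λ x < δ → IsC2At (E := E) (bdryDist Λ) x)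
    (huc : ContinuousOn u (closure Λ)) (hψc : ContinuousOn ψ (closure Λ))
    (hu : ∀ x ∈ Λ, IsC2At (E := E) u x) (hψ : ∀ x ∈ Λ, IsC2At (E := E) ψ x)
    (heq : SolvesAtRegularPoints a J Λ u) (hbd : ∀ y ∈ frontier Λ, u y = ψ y)
    (hKψ : ∀ x ∈ Λ, |ψ x| ≤ K ∧ ‖rGrad E ψ x‖ ≤ K ∧ hessNorm E ψ x ≤ K)
    (hKd : ∀ x ∈ Λ, bdryDist Λ x < δ → hessNorm E (bdryDist Λ) x ≤ K)
    (hKJ : ∀ x ∈ Λ, bdryDist Λ x < δ → ‖J x‖ ≤ K) (huK : ∀ x ∈ Λ, u x ≤ K)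
    {κ f q q' : ℝ → ℝ} (hfC : ContDiff ℝ 2 f) (hf : ∀ t, HasDerivAt f (q t) t)
    (hq : ∀ t, HasDerivAt q (q' t) t) (hf0 : f 0 = 0) (hℓ : ℓ < δ) (hfℓ : 2 * K ≤ f ℓ)
    (hprof : ∀ t ∈ Icc 0 ℓ, 10 * K + 1 ≤ q t ∧ 1 ≤ κ (q t) ∧ q' t ≤ 0 ∧
      ∀ s, |s - q t| ≤ K → barrierConst (Module.finrank ℝ E) K * κ (q t) ≤
        -q' t * (1 + min (bFun a s) 0))
    (hcurv : ∀ x ∈ Λ, bdryDist Λ x < δ → ∀ p, 1 ≤ p →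
      p * (lapl E (bdryDist Λ) x - inner ℝ (rGrad E (bdryDist Λ) x) (J x)) ≤
        κ p * (Module.finrank ℝ E * K + K)) :
    ∀ x ∈ closure Λ, bdryDist Λ x ≤ ℓ → u x ≤ ψ x + f (bdryDist Λ x) := by
  set d := bdryDist Λ with hddef
  have hdc : Continuous d := continuous_bdryDist Λ
  have hfc : Continuous f := hfC.continuous
  intro x₀ hx₀ hx₀ℓ
  have hD : IsCompact (closure Λ ∩ d ⁻¹' Iic ℓ) :=
    hcomp.inter_right (isClosed_Iic.preimage hdc)
  obtain ⟨z, ⟨hz, hzℓ⟩, hmax⟩ := hD.exists_isMaxOn (f := fun x => u x - (ψ x + f (d x)))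
    ⟨x₀, hx₀, hx₀ℓ⟩ ((huc.sub (hψc.add (hfc.comp hdc).continuousOn)).mono inter_subset_left)
  have hmax : ∀ x ∈ closure Λ, d x ≤ ℓ → u x - (ψ x + f (d x)) ≤ u z - (ψ z + f (d z)) :=
    fun x hx hxℓ => hmax ⟨hx, hxℓ⟩
  suffices hz0 : u z - (ψ z + f (d z)) ≤ 0 by linarith [hmax x₀ hx₀ hx₀ℓ]
  by_contra! hpos
  have hzΛ : z ∈ Λ := by
    by_contra hzn
    have hzf : z ∈ frontier Λ := ⟨hz, by rwa [hΛ.interior_eq]⟩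
    rw [hbd z hzf, hddef, bdryDist_eq_zero hzf, hf0] at hpos
    linarith
  -- At `d = ℓ` the barrier wins because `u - ψ ≤ 2K ≤ f ℓ`.
  have hzlt : d z < ℓ := by
    refine lt_of_le_of_ne hzℓ fun h => ?_
    rw [h] at hpos
    linarith [huK z hzΛ, (abs_le.1 (hKψ z hzΛ).1).1]
  have hzδ : d z < δ := hzlt.trans hℓ
  have hstrip : ∀ᶠ x in 𝓝 z, x ∈ Λ ∧ d x < ℓ :=
    Filter.Eventually.and (hΛ.mem_nhds hzΛ) (hdc.continuousAt.eventually_lt_const hzlt)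
  have hgrad : ∀ᶠ x in 𝓝 z, ‖rGrad E d x‖ = 1 :=
    norm_rGrad_bdryDist_eventually hΛ hfr hd hzΛ hzδ
  obtain ⟨h1, h2, h3, h4⟩ := hprof (d z) ⟨Metric.infDist_nonneg, hzℓ⟩
  obtain ⟨-, h5, h6⟩ := hKψ z hzΛ
  obtain ⟨hw, hw0, hneg⟩ := reducedOperator_barrier_neg ha hK (hψ z hzΛ) (hd z hzΛ hzδ) hgrad hfC
    hf hq h1 h2 h3 h4 h5 h6 (hKd z hzΛ hzδ) (hKJ z hzΛ hzδ)
    (hcurv z hzΛ hzδ _ (by linarith))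
  have hlm : IsLocalMax (fun x => u x - (ψ x + f (d x))) z := by
    filter_upwards [hstrip] with x hx
    exact hmax x (subset_closure hx.1) hx.2.le
  exact absurd (reducedOperator_nonneg_of_touching ha (hu z hzΛ) hw hlm hw0 (heq z hzΛ))
    (not_le.2 hneg)

/-- The boundary normal derivative of a function trapped between two barriers. -/
lemma abs_mvfderivWithin_le_of_barriers {y : N} (hy : y ∈ frontier Λ)
    {ν : TangentSpace 𝓘(ℝ, E) y} (hν : IsInnerUnitNormal E Λ y ν)
    (hu : ContMDiffOn 𝓘(ℝ, E) 𝓘(ℝ, ℝ) 1 u (closure Λ)) (hψc : ContinuousOn ψ (closure Λ))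
    (hψ : ∀ x ∈ Λ, IsC2At (E := E) ψ x) {K P ℓ : ℝ}
    (hKψ : ∀ x ∈ Λ, ‖rGrad E ψ x‖ ≤ K) (hbd : u y = ψ y) (hP : 0 ≤ P) (hℓ : 0 < ℓ)
    (hb : ∀ x ∈ closure Λ, bdryDist Λ x ≤ ℓ → |u x - ψ x| ≤ P * bdryDist Λ x) :
    |mvfderivWithin 𝓘(ℝ, E) u (closure Λ) y ν| ≤ 2 * (K + P) := by
  obtain ⟨ρ, ⟨hρ0, U, hU, hyU, hρC, hUΛ⟩, rfl⟩ := hν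
  have hρn : 0 < ‖rGrad E ρ y‖ := norm_pos_iff.2 hρ0
  set ν := ‖rGrad E ρ y‖⁻¹ • rGrad E ρ y with hνdef
  -- The test curve starts with unit speed and keeps speed at most `2`; this is the origin of the
  -- factor `2` in the bound.
  have hν1 : ‖ν‖ < 2 := by
    rw [hνdef, norm_smul, norm_inv, norm_norm, inv_mul_cancel₀ hρn.ne']
    norm_num
  obtain ⟨γ, h0, ⟨τ, hτ, hγ⟩, hdγ, hdγ'⟩ := exists_curve_speed_le ν hν1
  have hρm : MDifferentiableAt 𝓘(ℝ, E) 𝓘(ℝ, ℝ) ρ y :=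
    (hρC.contMDiffAt (hU.mem_nhds hyU)).mdifferentiableAt (by norm_num)
  have hρd := hdγ ρ hρm
  have hρpos : 0 < mvfderiv 𝓘(ℝ, E) ρ y ν := by
    rw [← inner_rGrad, hνdef, inner_smul_right, real_inner_self_eq_norm_sq]
    positivity
  have hρy : 0 ≤ ρ y := by
    by_contra! hlt
    obtain ⟨x, hx⟩ := (mem_closure_iff_frequently.1 hy.1).and_eventually
      (Filter.Eventually.and (hρm.continuousAt.eventually_lt_const hlt) (hU.mem_nhds hyU)) |>.exists
    have h1 : x ∈ U ∩ Λ := ⟨hx.2.2, hx.1⟩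
    rw [hUΛ] at h1
    exact lt_asymm h1.2 hx.2.1
  have hγc : ContinuousAt γ 0 := (hγ 0 ⟨le_rfl, hτ.le⟩).1.continuousAt
  -- Since `ρ y ≥ 0` and `ρ` increases along the curve at a positive initial rate, the curve enters
  -- `Λ` at once.
  have hin : ∀ᶠ t in 𝓝[>] (0 : ℝ), γ t ∈ Λ := by
    have h1 : ∀ᶠ t in 𝓝[>] (0 : ℝ), 0 < slope (fun t => ρ (γ t)) 0 t := by
      have := hρd.hasDerivWithinAt (s := Ioi 0)
      rw [hasDerivWithinAt_iff_tendsto_slope' (by simp)] at this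
      exact this.eventually_const_lt hρpos
    have h2 : ∀ᶠ t in 𝓝[>] (0 : ℝ), γ t ∈ U :=
      (hγc.eventually_mem (by rw [h0]; exact hU.mem_nhds hyU)).filter_mono nhdsWithin_le_nhds
    filter_upwards [h1, h2, self_mem_nhdsWithin] with t ht1 ht2 ht3
    have ht3 : 0 < t := ht3
    rw [slope_def_field, sub_zero, h0] at ht1
    have h4 := (div_pos_iff_of_pos_right ht3).1 ht1
    have h5 : γ t ∈ {x ∈ U | 0 < ρ x} := ⟨ht2, by linarith⟩
    rw [← hUΛ] at h5
    exact h5.2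
  obtain ⟨τ₁, hτ₁, hinτ⟩ := mem_nhdsGT_iff_exists_Ioo_subset.1 hin
  have hτ₁ : 0 < τ₁ := hτ₁
  -- The bound `ℓ / 2` keeps the curve, of speed at most `2`, in the strip `d ≤ ℓ`.
  set T := min (min τ (τ₁ / 2)) (ℓ / 2) with hT
  have hTpos : 0 < T := by positivity
  have hTτ : T ≤ τ := (min_le_left _ _).trans (min_le_left _ _)
  have hTτ₁ : T < τ₁ :=
    ((min_le_left _ _).trans (min_le_right _ _)).trans_lt (half_lt_self hτ₁)
  have hTℓ : T ≤ ℓ / 2 := min_le_right _ _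
  have hγΛ : ∀ t, 0 < t → t ≤ T → γ t ∈ Λ := fun t h1 h2 => hinτ ⟨h1, h2.trans_lt hTτ₁⟩
  have hmaps : MapsTo γ (Icc 0 T) (closure Λ) := by
    intro t ht
    rcases ht.1.eq_or_lt with h | h
    · rw [← h, h0]
      exact hy.1
    · exact subset_closure (hγΛ t h ht.2)
  have hγcont : ContinuousOn γ (Icc 0 T) := fun t ht =>
    (hγ t ⟨ht.1, ht.2.trans hTτ⟩).1.continuousAt.continuousWithinAt
  have hquot : ∀ t, 0 < t → t ≤ T → |u (γ t) - u y| ≤ 2 * (K + P) * t := by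
    intro t ht htT
    have h1 : dist y (γ t) ≤ 2 * t := by
      have := dist_le_mul_of_norm_le (E := E) (γ := γ) (a := 0) (b := t) (C := 2)
        (fun s hs => ((hγ s ⟨hs.1, hs.2.trans (htT.trans hTτ)⟩).1.of_le
          (by simp)).contMDiffWithinAt)
        ht.le zero_le_two (fun s hs => (hγ s ⟨hs.1.le, hs.2.le.trans (htT.trans hTτ)⟩).2)
      rwa [h0, sub_zero] at this
    have h2 : bdryDist Λ (γ t) ≤ 2 * t :=
      (Metric.infDist_le_dist_of_mem hy).trans (by rwa [dist_comm])
    have h3 : |u (γ t) - ψ (γ t)| ≤ P * (2 * t) :=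
      (hb _ (hmaps ⟨ht.le, htT⟩) (by linarith)).trans (mul_le_mul_of_nonneg_left h2 hP)
    obtain ⟨c, hc, hceq⟩ := exists_hasDerivAt_eq_slope (fun s => ψ (γ s))
      (fun s => mvfderiv 𝓘(ℝ, E) ψ (γ s) (mfderiv 𝓘(ℝ, ℝ) 𝓘(ℝ, E) γ s (1 : ℝ))) ht
      ((hψc.comp hγcont hmaps).mono (Icc_subset_Icc le_rfl htT)) (fun s hs =>
        hasDerivAt_comp_curve (hψ _ (hγΛ s hs.1 (hs.2.le.trans htT))).mdiff
          ((hγ s ⟨hs.1.le, hs.2.le.trans (htT.trans hTτ)⟩).1.mdifferentiableAt (by simp)))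
    have hcΛ := hγΛ c hc.1 (hc.2.le.trans htT)
    have hK0 : 0 ≤ K := (norm_nonneg _).trans (hKψ _ hcΛ)
    have h4 : |mvfderiv 𝓘(ℝ, E) ψ (γ c) (mfderiv 𝓘(ℝ, ℝ) 𝓘(ℝ, E) γ c (1 : ℝ))| ≤ K * 2 := by
      rw [← inner_rGrad]
      exact (abs_real_inner_le_norm _ _).trans (mul_le_mul (hKψ _ hcΛ)
        (hγ c ⟨hc.1.le, hc.2.le.trans (htT.trans hTτ)⟩).2 (norm_nonneg _) hK0)
    rw [hceq, sub_zero, abs_div, abs_of_pos ht, div_le_iff₀ ht, h0] at h4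
    have h5 : u (γ t) - u y = (u (γ t) - ψ (γ t)) + (ψ (γ t) - ψ y) := by
      rw [hbd]
      ring
    rw [h5]
    refine (abs_add_le _ _).trans ((add_le_add h3 h4).trans_eq ?_)
    ring
  have hum : MDifferentiableWithinAt 𝓘(ℝ, E) 𝓘(ℝ, ℝ) u (closure Λ) y :=
    (hu y hy.1).mdifferentiableWithinAt one_ne_zero
  have hder := (hdγ' u _ _ hum hmaps).mono (Ioc_subset_Icc_self)
  rw [hasDerivWithinAt_iff_tendsto_slope' (by simp)] at hder
  have hne : (𝓝[Ioc 0 T] (0 : ℝ)).NeBot := by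
    rw [nhdsWithin_Ioc_eq_nhdsGT hTpos]
    infer_instance
  refine le_of_tendsto hder.abs ?_
  filter_upwards [self_mem_nhdsWithin] with t ht
  rw [slope_def_field, sub_zero, abs_div, abs_of_pos ht.1, div_le_iff₀ ht.1, h0]
  exact hquot t ht.1 ht.2

end BoundaryEstimate

/-! ### The boundary gradient estimate for a given profile -/

section BoundaryGradient

lemma contDiff_two_of_hasDerivAt {f q q' : ℝ → ℝ} (hf : ∀ t, HasDerivAt f (q t) t)
    (hq : ∀ t, HasDerivAt q (q' t) t) (hc : Continuous q') : ContDiff ℝ 2 f := by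
  have h1 : deriv f = q := funext fun t => (hf t).deriv
  have h2 : deriv q = q' := funext fun t => (hq t).deriv
  have h3 : ContDiff ℝ 1 q := contDiff_one_iff_deriv.2 ⟨fun t => (hq t).differentiableAt, h2 ▸ hc⟩
  rw [show (2 : WithTop ℕ∞) = 1 + 1 by norm_num, contDiff_succ_iff_deriv]
  exact ⟨fun t => (hf t).differentiableAt, by simp, h1 ▸ h3⟩

variable {E : Type*} [NormedAddCommGroup E] [InnerProductSpace ℝ E] [FiniteDimensional ℝ E]
  {N : Type*} [MetricSpace N] [CompleteSpace N] [ChartedSpace E N]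
  [IsManifold 𝓘(ℝ, E) ∞ N] [RiemannianBundle (fun x : N => TangentSpace 𝓘(ℝ, E) x)]
  [IsContMDiffRiemannianBundle 𝓘(ℝ, E) ∞ E (fun x : N => TangentSpace 𝓘(ℝ, E) x)]
  [IsRiemannianManifold 𝓘(ℝ, E) N]

variable {a : ℝ → ℝ} {J : ∀ x : N, TangentSpace 𝓘(ℝ, E) x} {ψ u : N → ℝ} {Λ : Set N}

lemma hessNorm_neg {x : N} (hu : IsC2At (E := E) u x) :
    hessNorm E (fun y => -u y) x = hessNorm E u x := by
  simp only [hessNorm, rHess_neg hu, neg_sq]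

/-- The boundary gradient estimate for a given barrier profile. -/
lemma abs_normalDeriv_le (ha : IsRegularOperator a) {δ K ℓ P : ℝ} (hK : 0 ≤ K)
    {κ f q q' : ℝ → ℝ} (hq'c : Continuous q') (hf : ∀ t, HasDerivAt f (q t) t)
    (hq : ∀ t, HasDerivAt q (q' t) t) (hf0 : f 0 = 0) (hℓ0 : 0 < ℓ) (hℓ : ℓ < δ)
    (hfℓ : 2 * K ≤ f ℓ)
    (hprof : ∀ t ∈ Icc 0 ℓ, 10 * K + 1 ≤ q t ∧ 1 ≤ κ (q t) ∧ q' t ≤ 0 ∧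
      ∀ s, |s - q t| ≤ K → barrierConst (Module.finrank ℝ E) K * κ (q t) ≤
        -q' t * (1 + min (bFun a s) 0))
    (hqP : ∀ t ∈ Icc 0 ℓ, q t ≤ P)
    (hJ : ∀ x, C1Field J x) (hΛ : IsC2Domain E Λ) (hΛb : Bornology.IsBounded Λ)
    (hd : ∀ x ∈ Λ, bdryDist Λ x < δ → IsC2At (E := E) (bdryDist Λ) x)
    (hψ : ContMDiffOn 𝓘(ℝ, E) 𝓘(ℝ, ℝ) 2 ψ (closure Λ))
    (hu1 : ContMDiffOn 𝓘(ℝ, E) 𝓘(ℝ, ℝ) 1 u (closure Λ))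
    (hu2 : ContMDiffOn 𝓘(ℝ, E) 𝓘(ℝ, ℝ) 2 u Λ)
    (heq : SolvesReducedEquation E a J Λ u) (hbd : ∀ y ∈ frontier Λ, u y = ψ y)
    (hcurv : ∀ x ∈ Λ, bdryDist Λ x < δ → ∀ p, 1 ≤ p →
      p * (lapl E (bdryDist Λ) x - inner ℝ (rGrad E (bdryDist Λ) x) (J x)) ≤
        κ p * (Module.finrank ℝ E * K + K))
    (hKψ : ∀ x ∈ Λ, |ψ x| ≤ K ∧ ‖rGrad E ψ x‖ ≤ K ∧ hessNorm E ψ x ≤ K)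
    (hKd : ∀ x ∈ Λ, bdryDist Λ x < δ → hessNorm E (bdryDist Λ) x ≤ K)
    (hKJ : ∀ x ∈ Λ, bdryDist Λ x < δ → ‖J x‖ ≤ K) {y : N} (hy : y ∈ frontier Λ)
    {ν : TangentSpace 𝓘(ℝ, E) y} (hν : IsInnerUnitNormal E Λ y ν) :
    |mvfderivWithin 𝓘(ℝ, E) u (closure Λ) y ν| ≤ 2 * (K + P) := by
  obtain ⟨hΛo, hΛc, -⟩ := hΛ
  have : ProperSpace N := properSpace_of_complete E N
  have hcomp : IsCompact (closure Λ) := hΛb.isCompact_closure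
  have hfr : (frontier Λ).Nonempty := ⟨y, hy⟩
  have huC : ∀ x ∈ Λ, IsC2At (E := E) u x := fun x hx => hu2.contMDiffAt (hΛo.mem_nhds hx)
  have hψC : ∀ x ∈ Λ, IsC2At (E := E) ψ x := fun x hx =>
    (hψ.mono subset_closure).contMDiffAt (hΛo.mem_nhds hx)
  have hψK : ∀ x ∈ closure Λ, |ψ x| ≤ K := fun x hx =>
    isClosed_Iic.closure_subset (show |ψ x| ∈ closure (Iic K) from
      ((hψ.continuousOn.abs x hx).mono subset_closure).mem_closure hx fun z hz => (hKψ z hz).1)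
  have hreg := heq.solvesAtRegularPoints ha huC
  have hreg' := hreg.neg huC
  have huK : ∀ x ∈ closure Λ, u x ≤ K := le_of_solves ha hΛo hΛc hcomp hfr hu1.continuousOn huC
    hreg hJ fun z hz => by
      rw [hbd z hz]
      exact (abs_le.1 (hψK z hz.1)).2
  have huK' : ∀ x ∈ closure Λ, -u x ≤ K := le_of_solves (u := fun x => -u x) ha hΛo hΛc hcomp hfr
    hu1.continuousOn.neg (fun x hx => (huC x hx).neg) hreg' hJ fun z hz => by
      rw [hbd z hz]
      linarith [(abs_le.1 (hψK z hz.1)).1]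
  have hfC := contDiff_two_of_hasDerivAt hf hq hq'c
  have hup := le_barrier ha hΛo hcomp hfr hK hd hu1.continuousOn hψ.continuousOn huC hψC hreg hbd
    hKψ hKd hKJ (fun x hx => huK x (subset_closure hx)) hfC hf hq hf0 hℓ hfℓ hprof hcurv
  -- The reduced operator is odd, so `-u` with boundary values `-ψ` admits the same profile.
  have hlow := le_barrier (u := fun x => -u x) (ψ := fun x => -ψ x) ha hΛo hcomp hfr hK hd hu1.continuousOn.neg
    hψ.continuousOn.neg (fun x hx => (huC x hx).neg) (fun x hx => (hψC x hx).neg) hreg'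
    (fun z hz => by rw [hbd z hz]) (fun x hx => by
      rw [abs_neg, rGrad_neg (hψC x hx).mdiff, norm_neg, hessNorm_neg (hψC x hx)]
      exact hKψ x hx) hKd hKJ (fun x hx => huK' x (subset_closure hx)) hfC hf hq hf0 hℓ hfℓ
    hprof hcurv
  have hP : 0 ≤ P := by linarith [(hprof 0 ⟨le_rfl, hℓ0.le⟩).1, hqP 0 ⟨le_rfl, hℓ0.le⟩]
  have hfP : ∀ t ∈ Icc 0 ℓ, f t ≤ P * t := fun t ht => by
    have h1 := (convex_Icc 0 ℓ).image_sub_le_mul_sub_of_deriv_le hfC.continuous.continuousOn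
      (fun s _ => (hf s).differentiableAt.differentiableWithinAt)
      (fun s hs => by
        rw [(hf s).deriv]
        exact hqP s (interior_subset hs)) 0 ⟨le_rfl, hℓ0.le⟩ t ht ht.1
    simpa [hf0] using h1
  refine abs_mvfderivWithin_le_of_barriers hy hν hu1 hψ.continuousOn hψC
    (fun x hx => (hKψ x hx).2.1) (hbd y hy) hP hℓ0 fun x hx hxℓ => ?_
  have h1 := hfP (bdryDist Λ x) ⟨Metric.infDist_nonneg, hxℓ⟩
  have h2 := hup x hx hxℓ
  have h3 := hlow x hx hxℓ
  exact abs_le.2 ⟨by linarith, by linarith⟩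

lemma isC2At_bdryDist (hΛ : IsOpen Λ) {δ₀ : ℝ}
    (hd : ContMDiffOn 𝓘(ℝ, E) 𝓘(ℝ, ℝ) 2 (bdryDist Λ) {x ∈ closure Λ | bdryDist Λ x ≤ δ₀})
    {x : N} (hx : x ∈ Λ) (hxd : bdryDist Λ x < δ₀) : IsC2At (E := E) (bdryDist Λ) x := by
  refine hd.contMDiffAt ?_
  filter_upwards [hΛ.mem_nhds hx,
    (continuous_bdryDist Λ).continuousAt.eventually_lt_const hxd] with z h1 h2
  exact ⟨subset_closure h1, h2.le⟩

/-- The crude bound used under Condition I; multiplied by the slope it is what forces `κ = id`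
there. -/
lemma lapl_bdryDist_sub_le (hΛ : IsOpen Λ) (hfr : (frontier Λ).Nonempty) {δ K : ℝ}
    (hd : ∀ x ∈ Λ, bdryDist Λ x < δ → IsC2At (E := E) (bdryDist Λ) x)
    {x : N} (hx : x ∈ Λ) (hxd : bdryDist Λ x < δ) (hK : hessNorm E (bdryDist Λ) x ≤ K)
    (hJ : ‖J x‖ ≤ K) :
    lapl E (bdryDist Λ) x - inner ℝ (rGrad E (bdryDist Λ) x) (J x) ≤
      Module.finrank ℝ E * K + K := by
  have h1 := (norm_rGrad_bdryDist_eventually hΛ hfr hd hx hxd).self_of_nhds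
  have h2 : |lapl E (bdryDist Λ) x| ≤ Module.finrank ℝ E * K := abs_lapl_le fun v => by
    refine (abs_rHess_le (hd x hx hxd) v v).trans ?_
    rw [mul_assoc, ← sq]
    gcongr
  have h3 := abs_real_inner_le_norm (rGrad E (bdryDist Λ) x) (J x)
  rw [h1, one_mul] at h3
  linarith [(abs_le.1 h2).2, (abs_le.1 h3).1]

end BoundaryGradient

end

/-! ### The main theorem -/

theorem mainTheorem6
    (m : ℕ) (a : ℝ → ℝ) (ha : IsRegularOperator a) (δ : ℝ) (hδ : 0 < δ) (K : ℝ) :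
    ∃ C : ℝ, ∀ (N : Type*) [MetricSpace N] [CompleteSpace N]
      [ChartedSpace (EuclideanSpace ℝ (Fin m)) N]
      [IsManifold 𝓘(ℝ, EuclideanSpace ℝ (Fin m)) ∞ N]
      [RiemannianBundle (fun x : N => TangentSpace 𝓘(ℝ, EuclideanSpace ℝ (Fin m)) x)]
      [IsContMDiffRiemannianBundle 𝓘(ℝ, EuclideanSpace ℝ (Fin m)) ∞ (EuclideanSpace ℝ (Fin m))
        (fun x : N => TangentSpace 𝓘(ℝ, EuclideanSpace ℝ (Fin m)) x)]
      [IsRiemannianManifold 𝓘(ℝ, EuclideanSpace ℝ (Fin m)) N]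
      (J : ∀ x : N, TangentSpace 𝓘(ℝ, EuclideanSpace ℝ (Fin m)) x)
      (_hJ : ContMDiff 𝓘(ℝ, EuclideanSpace ℝ (Fin m)) 𝓘(ℝ, EuclideanSpace ℝ (Fin m)).tangent ∞
        (fun x => (⟨x, J x⟩ : TangentBundle 𝓘(ℝ, EuclideanSpace ℝ (Fin m)) N)))
      (Λ : Set N) (_hΛ : IsC2Domain (EuclideanSpace ℝ (Fin m)) Λ)
      (_hΛb : Bornology.IsBounded Λ)
      (δ₀ : ℝ) (_hδ₀ : δ ≤ δ₀)
      (_hd : ContMDiffOn 𝓘(ℝ, EuclideanSpace ℝ (Fin m)) 𝓘(ℝ, ℝ) 2 (bdryDist Λ)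
        {x ∈ closure Λ | bdryDist Λ x ≤ δ₀})
      (ψ u : N → ℝ)
      (_hψ : ContMDiffOn 𝓘(ℝ, EuclideanSpace ℝ (Fin m)) 𝓘(ℝ, ℝ) 2 ψ (closure Λ))
      (_hu1 : ContMDiffOn 𝓘(ℝ, EuclideanSpace ℝ (Fin m)) 𝓘(ℝ, ℝ) 1 u (closure Λ))
      (_hu2 : ContMDiffOn 𝓘(ℝ, EuclideanSpace ℝ (Fin m)) 𝓘(ℝ, ℝ) 2 u Λ)
      (_heq : SolvesReducedEquation (EuclideanSpace ℝ (Fin m)) a J Λ u)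
      (_hbd : ∀ y ∈ frontier Λ, u y = ψ y)
      -- the alternative: Condition I, or Condition II with the mean curvature condition
      (_hcond : ConditionI a ∨ (ConditionII a ∧
        ∀ x ∈ Λ, bdryDist Λ x < δ →
          -inner ℝ (J x) (levelNormal (EuclideanSpace ℝ (Fin m)) (bdryDist Λ) x) ≤
            levelMeanCurvature (EuclideanSpace ℝ (Fin m)) (bdryDist Λ) x))
      -- the quantities on which the constant may depend are at most `K`
      (_hKψ : ∀ x ∈ Λ, |ψ x| ≤ K ∧ ‖rGrad (EuclideanSpace ℝ (Fin m)) ψ x‖ ≤ K ∧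
        hessNorm (EuclideanSpace ℝ (Fin m)) ψ x ≤ K)
      (_hKd : ∀ x ∈ Λ, bdryDist Λ x < δ₀ →
        hessNorm (EuclideanSpace ℝ (Fin m)) (bdryDist Λ) x ≤ K)
      (_hKJ : ∀ x ∈ Λ, bdryDist Λ x < δ₀ → ‖J x‖ ≤ K),
      ∀ y ∈ frontier Λ, ∀ ν : TangentSpace 𝓘(ℝ, EuclideanSpace ℝ (Fin m)) y,
        IsInnerUnitNormal (EuclideanSpace ℝ (Fin m)) Λ y ν →
          |mvfderivWithin 𝓘(ℝ, EuclideanSpace ℝ (Fin m)) u (closure Λ) y ν| ≤ C := by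
  classical
  by_cases hK : 0 ≤ K
  swap
  -- A negative `K` is impossible, because `Λ` is non-empty and `|ψ| ≤ K` on it.
  · refine ⟨0, ?_⟩
    intro N _ _ _ _ _ _ _ J _ Λ hΛ _ δ₀ _ _ ψ u _ _ _ _ _ _ hKψ
    obtain ⟨x, hx⟩ := hΛ.2.1.nonempty
    exact absurd ((abs_nonneg _).trans (hKψ x hx).1) hK
  have hBC : 0 < barrierConst (Module.finrank ℝ (EuclideanSpace ℝ (Fin m))) K := by
    unfold barrierConst remainderBound
    positivity
  -- The conditions concern `a` only, so the case distinction can precede the choice of the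
  -- constant, before any manifold is given.
  by_cases hI : ConditionI a
  · obtain ⟨ℓ, P, f, q, q', hℓ0, hℓ, hf0, hfℓ, hc, hf, hq, hprof⟩ :=
      -- The height `2K + 1` instead of `2K` keeps it positive when `K = 0`.
      hI.hasBarrierProfile _ (2 * K + 1) δ (10 * K + 1) K hBC (by linarith) hδ
    refine ⟨2 * (K + P), ?_⟩
    intro N _ _ _ _ _ _ _ J hJ Λ hΛ hΛb δ₀ hδ₀ hd ψ u hψ hu1 hu2 heq hbd _ hKψ hKd hKJ y hy ν hν
    have hdC : ∀ x ∈ Λ, bdryDist Λ x < δ → IsC2At (E := EuclideanSpace ℝ (Fin m)) (bdryDist Λ) x :=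
      fun x hx hxd => isC2At_bdryDist hΛ.1 hd hx (hxd.trans_le hδ₀)
    refine abs_normalDeriv_le ha hK (κ := id) hc hf hq hf0 hℓ0 hℓ (by linarith) (fun t ht => ?_)
      (fun t ht => (hprof t ht).2.1) (fun x => (hJ x).of_le (by simp)) hΛ hΛb hdC hψ hu1 hu2 heq
      hbd (fun x hx hxd p hp => ?_) hKψ (fun x hx hxd => hKd x hx (hxd.trans_le hδ₀))
      (fun x hx hxd => hKJ x hx (hxd.trans_le hδ₀)) hy hν
    · obtain ⟨h1, -, h2, h3⟩ := hprof t ht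
      exact ⟨h1, show 1 ≤ q t by linarith, h2, h3⟩
    · exact mul_le_mul_of_nonneg_left (lapl_bdryDist_sub_le hΛ.1 ⟨y, hy⟩ hdC hx hxd
        (hKd x hx (hxd.trans_le hδ₀)) (hKJ x hx (hxd.trans_le hδ₀))) (by linarith)
  by_cases hII : ConditionII a
  · obtain ⟨ℓ, P, f, q, q', hℓ0, hℓ, hf0, hfℓ, hc, hf, hq, hprof⟩ :=
      hII.hasBarrierProfile _ (2 * K + 1) δ (10 * K + 1) K hBC (by linarith) hδ
    refine ⟨2 * (K + P), ?_⟩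
    intro N _ _ _ _ _ _ _ J hJ Λ hΛ hΛb δ₀ hδ₀ hd ψ u hψ hu1 hu2 heq hbd hcond hKψ hKd hKJ y hy ν hν
    have hdC : ∀ x ∈ Λ, bdryDist Λ x < δ → IsC2At (E := EuclideanSpace ℝ (Fin m)) (bdryDist Λ) x :=
      fun x hx hxd => isC2At_bdryDist hΛ.1 hd hx (hxd.trans_le hδ₀)
    refine abs_normalDeriv_le ha hK (κ := fun _ => 1) hc hf hq hf0 hℓ0 hℓ (by linarith)
      (fun t ht => ?_)
      (fun t ht => (hprof t ht).2.1) (fun x => (hJ x).of_le (by simp)) hΛ hΛb hdC hψ hu1 hu2 heq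
      hbd (fun x hx hxd p hp => ?_) hKψ (fun x hx hxd => hKd x hx (hxd.trans_le hδ₀))
      (fun x hx hxd => hKJ x hx (hxd.trans_le hδ₀)) hy hν
    · obtain ⟨h1, -, h2, h3⟩ := hprof t ht
      exact ⟨h1, le_rfl, h2, h3⟩
    · have hgrad := norm_rGrad_bdryDist_eventually hΛ.1 ⟨y, hy⟩ hdC hx hxd
      -- With `H = -Δd` and unit normal `∇d`, the curvature condition reads `Δd - ⟨∇d, J⟩ ≤ 0`, so
      -- large slopes only help and `κ = 1` suffices.
      have hcx := (hcond.resolve_left hI).2 x hx hxd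
      rw [levelMeanCurvature_eq (hdC x hx hxd) hgrad, levelNormal, hgrad.self_of_nhds, inv_one,
        one_smul, real_inner_comm] at hcx
      have h1 : p * (lapl (EuclideanSpace ℝ (Fin m)) (bdryDist Λ) x -
          inner ℝ (rGrad (EuclideanSpace ℝ (Fin m)) (bdryDist Λ) x) (J x)) ≤ 0 :=
        mul_nonpos_of_nonneg_of_nonpos (by linarith) (by linarith)
      exact h1.trans (by positivity)
  · refine ⟨0, ?_⟩
    intro N _ _ _ _ _ _ _ J _ Λ _ _ δ₀ _ _ ψ u _ _ _ _ _ hcond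
    exact absurd hcond (by tauto)
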